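/- Let $q\ge 4$ be even, $k\ge 2$, $d=5q^k$, $\Delta=d+1$, $t=(q^k-q)^{1/\Delta}$. Let $B=(B_{ij})_{0\le i,j\le q}$ be the symmetric matrix with $B_{00}=t^2$, $B_{0i}=B_{i0}=t$, $B_{ii}=0$ for $1\le i\le q$, and $B_{ij}=1$ for distinct $i,j\in\{1,\dots,q\}$. For an integer $n$, let $G$ be uniformly random among the (simple, labelled) $\Delta$-regular bipartite graphs with $n$ vertices on each side. For vectors $a,b\in\mathbb{Z}_{\ge0}^{q+1}$ with $\sum_i a_i=\sum_i b_i=n$, let $Z^{a,b}(G)$ be the sum, over all assignments $\sigma$ of colours $0,\dots,q$ to the vertices that use colour $i$ exactly $a_i$ times on the left and $b_i$ times on the right, of $\prod_{uv\in E(G)}B_{\sigma(u)\sigma(v)}$. For probability vectors $\alpha,\beta$ on $\{0,\dots,q\}$ put $$\Psi_1(\alpha,\beta)=\lim \frac1n\log \mathbb{E}\big[Z^{a,b}(G)\big],$$ the limit being taken as $n\to\infty$, $a/n\to\alpha$, $b/n\to\beta$, whenever it exists. A positive fixpoint of the tree recursion is a pair of vectors $R=(R_0,\dots,R_q)$, $C=(C_0,\dots,C_q)$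 with positive entries such that, for some constants $A,A'$ and all $1\le i\le q$, $$R_0=A\,t^d\Big(tC_0+\sum_{j=1}^qC_j\Big)^d,\quad R_i=A\Big(tC_0+\sum_{1\le j\le q,\ j\ne i}C_j\Big)^d,$$ $$C_0=A'\,t^d\Big(tR_0+\sum_{j=1}^qR_j\Big)^d,\quad C_i=A'\Big(tR_0+\sum_{1\le j\le q,\ j\ne i}R_j\Big)^d.$$ It is of type $(q_1,q_2,q_3)$ if the non-zero numbers among $q_1,q_2,q_3$ are, up to order, the multiplicities of the distinct values among $R_1,\dots,R_q$. The value of $\Psi_1$ at the fixpoint is $\Psi_1(\alpha,\beta)$, where $\alpha_i=R_i^{p}/\sum_jR_j^{p}$, $\beta_i=C_i^{p}/\sum_jC_j^{p}$ and $p=\Delta/(\Delta-1)$. Then the limit defining $\Psi_1$ exists at every positive fixpoint, and the maximum of $\Psi_1$ over all positive fixpoints is attained, uniquely at the type $(q/2,q/2,0)$: there is a positive fixpoint of type $(q/2,q/2,0)$ at which $\Psi_1$ is at least its value at every positive fixpoint, and every positive fixpoint at which $\Psi_1$ takes this maximal value is of type $(q/2,q/2,0)$. -/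

import Mathlib

open Filter Topology

namespace HypergraphColouring

/-- The weight `t = (q^k - q)^{1/Δ}` of the special colour `0`, where `Δ = d + 1`. -/
noncomputable def tParam (q k d : ℕ) : ℝ :=
  ((q : ℝ) ^ k - (q : ℝ)) ^ ((1 : ℝ) / ((d : ℝ) + 1))

/-- The interaction matrix on the colours `{0, 1, …, q}`: `B₀₀ = t²`, `B₀ᵢ = Bᵢ₀ = t`, `Bᵢᵢ = 0`
and `Bᵢⱼ = 1` for distinct `i, j ≥ 1`. -/
noncomputable def interaction (q k d : ℕ) : Matrix (Fin (q + 1)) (Fin (q + 1)) ℝ :=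
  fun i j =>
    if i = 0 then (if j = 0 then tParam q k d ^ 2 else tParam q k d)
    else if j = 0 then tParam q k d
    else if i = j then 0 else 1

section RandomGraphs

open scoped Classical in
/-- The `Δ`-regular bipartite (simple, labelled) graphs with `n` vertices on each side. -/
noncomputable def regularBipartite (Δ n : ℕ) : Finset (SimpleGraph (Fin n ⊕ Fin n)) :=
  Finset.univ.filter fun G =>
    G ≤ completeBipartiteGraph (Fin n) (Fin n) ∧ G.IsRegularOfDegree Δ

open scoped Classical in
/-- The weight of the assignment `(σ, τ)` on a bipartite graph: the product over all edges of the
interaction of the colours of the two end points. -/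
noncomputable def weight {q n : ℕ} (B : Matrix (Fin (q + 1)) (Fin (q + 1)) ℝ)
    (G : SimpleGraph (Fin n ⊕ Fin n)) (σ τ : Fin n → Fin (q + 1)) : ℝ :=
  ∏ u : Fin n, ∏ v : Fin n, if G.Adj (Sum.inl u) (Sum.inr v) then B (σ u) (τ v) else 1

/-- The assignments of `q + 1` colours to `n` vertices in which colour `i` is used exactly `a i`
times. -/
def assignments {q : ℕ} (n : ℕ) (a : Fin (q + 1) → ℕ) : Finset (Fin n → Fin (q + 1)) :=
  Finset.univ.filter fun σ => ∀ i, (Finset.univ.filter fun u => σ u = i).card = a i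

/-- The total weight of the assignments with colour counts `a` on the left and `b` on the right. -/
noncomputable def partitionFunction {q n : ℕ} (B : Matrix (Fin (q + 1)) (Fin (q + 1)) ℝ)
    (a b : Fin (q + 1) → ℕ) (G : SimpleGraph (Fin n ⊕ Fin n)) : ℝ :=
  ∑ σ ∈ assignments n a, ∑ τ ∈ assignments n b, weight B G σ τ

/-- The expectation of `partitionFunction B a b G` for `G` uniform in `regularBipartite Δ n`. -/
noncomputable def firstMoment {q : ℕ} (B : Matrix (Fin (q + 1)) (Fin (q + 1)) ℝ) (Δ n : ℕ)
    (a b : Fin (q + 1) → ℕ) : ℝ :=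
  (∑ G ∈ regularBipartite Δ n, partitionFunction B a b G) / ((regularBipartite Δ n).card : ℝ)

/-- `(1/n) log E[Z^{a,b}(G)]` as a function of `(n, a, b)`. -/
noncomputable def logFirstMoment {q : ℕ} (B : Matrix (Fin (q + 1)) (Fin (q + 1)) ℝ) (Δ : ℕ)
    (x : ℕ × (Fin (q + 1) → ℕ) × (Fin (q + 1) → ℕ)) : ℝ :=
  (1 / (x.1 : ℝ)) * Real.log (firstMoment B Δ x.1 x.2.1 x.2.2)

/-- The limit process behind `Ψ₁(α, β)`: `n → ∞`, with integer colour counts `a`, `b` of total `n`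
on the two sides whose fractions `a / n`, `b / n` tend to `α`, `β`. (For irrational `α` no
assignment has colour fractions exactly `α`.) -/
noncomputable def phaseFilter {q : ℕ} (α β : Fin (q + 1) → ℝ) :
    Filter (ℕ × (Fin (q + 1) → ℕ) × (Fin (q + 1) → ℕ)) :=
  comap (fun x => x.1) atTop
    ⊓ comap (fun x => fun i => (x.2.1 i : ℝ) / (x.1 : ℝ)) (𝓝 α)
    ⊓ comap (fun x => fun i => (x.2.2 i : ℝ) / (x.1 : ℝ)) (𝓝 β)
    ⊓ 𝓟 {x | ∑ i, x.2.1 i = x.1 ∧ ∑ i, x.2.2 i = x.1}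

/-- `Ψ₁(α, β) = lim (1/n) log E[Z^{α,β}(G)]`, the exponential growth rate of the first moment on
random `Δ`-regular bipartite graphs. -/
noncomputable def Psi1 {q : ℕ} (B : Matrix (Fin (q + 1)) (Fin (q + 1)) ℝ) (Δ : ℕ)
    (α β : Fin (q + 1) → ℝ) : ℝ :=
  limUnder (phaseFilter α β) (logFirstMoment B Δ)

end RandomGraphs

/-- Positive fixpoints `(R, C)` of the tree recursion; each of `R`, `C` is prescribed up to a
factor. -/
structure IsPosFixpoint (q k d : ℕ) (R C : Fin (q + 1) → ℝ) : Prop where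
  R_pos : ∀ i, 0 < R i
  C_pos : ∀ i, 0 < C i
  R_eq : ∃ A : ℝ,
    R 0 = A * (tParam q k d ^ d * (tParam q k d * C 0 + ∑ j : Fin q, C j.succ) ^ d) ∧
    ∀ i : Fin q,
      R i.succ = A * (tParam q k d * C 0 + ∑ j ∈ Finset.univ.erase i, C j.succ) ^ d
  C_eq : ∃ A : ℝ,
    C 0 = A * (tParam q k d ^ d * (tParam q k d * R 0 + ∑ i : Fin q, R i.succ) ^ d) ∧
    ∀ j : Fin q,
      C j.succ = A * (tParam q k d * R 0 + ∑ i ∈ Finset.univ.erase j, R i.succ) ^ d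

/-- `R` is of type `(q₁, q₂, q₃)`: the nonzero ones among `q₁, q₂, q₃` are, up to order, the
multiplicities of the distinct values among `R₁, …, R_q`. -/
def HasType {q : ℕ} (R : Fin (q + 1) → ℝ) (q₁ q₂ q₃ : ℕ) : Prop :=
  (Finset.univ.image fun i : Fin q => R i.succ).val.map
      (fun v => (Finset.univ.filter fun i : Fin q => R i.succ = v).card)
    = ({q₁, q₂, q₃} : Multiset ℕ).filter (fun m => m ≠ 0)

/-- The colour fractions `αᵢ = Rᵢ^p / ∑ⱼ Rⱼ^p`, with `p = (d + 1) / d`, attached to `R`. -/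
noncomputable def phase {q : ℕ} (d : ℕ) (R : Fin (q + 1) → ℝ) : Fin (q + 1) → ℝ :=
  fun i => R i ^ (((d : ℝ) + 1) / (d : ℝ)) / ∑ j, R j ^ (((d : ℝ) + 1) / (d : ℝ))

/-- The value of `Ψ₁` at the phase corresponding to `(R, C)`, for the degree `Δ = d + 1`. -/
noncomputable def psi1At (q k d : ℕ) (R C : Fin (q + 1) → ℝ) : ℝ :=
  Psi1 (interaction q k d) (d + 1) (phase d R) (phase d C)

end HypergraphColouring

open HypergraphColouring

namespace HypergraphColouring

/-! ### One-sided first-order conditions -/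

section Calculus

/-! At a positive fixpoint the first moment grows at the rate `messageRate`, that is Δ log(RᵀBC) − d
log ∑ Rᵢ^p − d log ∑ Cⱼ^p (`tendsto_logFirstMoment_fixpoint`). Two bounds meet there: a saddle point
bound with the variables z = C, and the contribution of the single edge distribution Rᵢ Bᵢⱼ Cⱼ /
RᵀBC, whose margins are the two phases. Both are computed in the configuration model. Passing to
simple graphs costs only a polynomial factor, because colour-preserving rearrangements of the
half-edges remove multiple edges often enough (`sum_balanced_le`).

The maximisation goes through a relaxation. The matrix B is v vᵀ with v = (t, 1, …, 1), minus the
identity on the ordinary colours. After scaling to vᵀR = vᵀC = 1, the rate depends only on the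
averages over the q ordinary colours of ξ, η, ξη, ξ^p and η^p, where (ξ, η) is the pair of messages
of a colour (`messageRate_eq`). The uniform measure on these q pairs is now replaced by an arbitrary
finitely supported probability measure on a box [0, c]² that contains the messages of all fixpoints
(`message_le`). The averages then fill a compact convex set, so a maximiser exists, and every atom
of it maximises the linearised rate (`isMaxOn_rateDeriv_of_atom`).

This determines the maximiser (`maximiser_structure`). Optimality in each coordinate gives the tree
recursion x = A(1 − y)^d, y = A'(1 − x)^d at each atom (`euler_coordinate`). Comparing an atom with
its mirror image, together with the normalisation, gives A = A'. An atom with x = y could be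
improved by moving its two messages apart, since dA ≥ 5 makes the recursion steep
(`not_diagonal_max`). The map x ↦ A(1 − x)^d has at most one two-cycle of distinct points {a, b}
(`twoCycle_unique`), so all atoms are (a, b) or (b, a), and the normalisation forces equal masses.

As q is even, the half-half split is realised by an actual fixpoint of type (q/2, q/2, 0), so the
relaxation is tight. Any fixpoint with the same value is itself a relaxed maximiser and hence splits
its colours in the same way. -/

theorem deriv_nonpos_of_le_right {f : ℝ → ℝ} {f' x b : ℝ} (hxb : x < b) (hf : HasDerivAt f f' x)
    (hmax : ∀ y ∈ Set.Icc x b, f y ≤ f x) : f' ≤ 0 := by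
  have h := (hasDerivAt_iff_tendsto_slope.1 hf).mono_left
    (nhdsWithin_mono x (fun y (hy : x < y) => ne_of_gt hy) : 𝓝[>] x ≤ 𝓝[≠] x)
  refine le_of_tendsto h ?_
  filter_upwards [Ioo_mem_nhdsGT hxb] with y hy
  rw [slope_def_field]
  exact div_nonpos_of_nonpos_of_nonneg (sub_nonpos.2 (hmax y ⟨hy.1.le, hy.2.le⟩))
    (sub_nonneg.2 hy.1.le)

theorem deriv_nonneg_of_le_left {f : ℝ → ℝ} {f' x a : ℝ} (hax : a < x) (hf : HasDerivAt f f' x)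
    (hmax : ∀ y ∈ Set.Icc a x, f y ≤ f x) : 0 ≤ f' := by
  have h := (hasDerivAt_iff_tendsto_slope.1 hf).mono_left
    (nhdsWithin_mono x (fun y (hy : y < x) => ne_of_lt hy) : 𝓝[<] x ≤ 𝓝[≠] x)
  refine ge_of_tendsto h ?_
  filter_upwards [Ioo_mem_nhdsLT hax] with y hy
  rw [slope_def_field]
  exact div_nonneg_of_nonpos (sub_nonpos.2 (hmax y ⟨hy.1.le, hy.2.le⟩))
    (sub_nonpos.2 hy.2.le)

end Calculus

/-! ### Compactness of convex hulls -/

section Convex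

/-- The convex hull of a compact set in a finite-dimensional space is compact. -/
theorem isCompact_convexHull_of_finiteDimensional {E : Type*} [NormedAddCommGroup E]
    [NormedSpace ℝ E] [FiniteDimensional ℝ E] {s : Set E} (hs : IsCompact s) :
    IsCompact (convexHull ℝ s) := by
  classical
  rcases s.eq_empty_or_nonempty with rfl | ⟨z₀, hz₀⟩
  · simp
  set n := Module.finrank ℝ E + 1
  -- By Carathéodory, at most `n` points of `s` are needed; shorter combinations are padded with
  -- weight 0 at `z₀`. The hull is thus a continuous image of a compact product.
  have himg : convexHull ℝ s =
      (fun a : (Fin n → ℝ) × (Fin n → E) => ∑ i, a.1 i • a.2 i) ''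
        (stdSimplex ℝ (Fin n) ×ˢ Set.univ.pi fun _ => s) := by
    apply Set.Subset.antisymm
    · intro x hx
      obtain ⟨ι, _, z, w, hz, haff, hw, hw1, rfl⟩ := eq_pos_convex_span_of_mem_convexHull hx
      have hcard : Fintype.card ι ≤ Fintype.card (Fin n) := by
        simpa [n] using haff.card_le_finrank_succ.trans
          (Nat.succ_le_succ (Submodule.finrank_le _))
      obtain ⟨e⟩ := Function.Embedding.nonempty_of_card_le hcard
      have hinj := e.injective
      refine ⟨(Function.extend e w 0, Function.extend e z fun _ => z₀), ⟨⟨?_, ?_⟩, ?_⟩, ?_⟩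
      · intro i
        by_cases h : ∃ a, e a = i
        · obtain ⟨a, rfl⟩ := h
          simpa [hinj.extend_apply] using (hw a).le
        · simp [Function.extend_apply' _ _ _ h]
      · rw [← hw1]
        refine (Fintype.sum_of_injective e hinj w _ (fun i hi => ?_) fun i => ?_).symm
        · simp [Function.extend_apply' _ _ _ hi]
        · simp [hinj.extend_apply]
      · intro i _
        by_cases h : ∃ a, e a = i
        · obtain ⟨a, rfl⟩ := h
          simpa [hinj.extend_apply] using hz ⟨a, rfl⟩
        · simpa [Function.extend_apply' _ _ _ h] using hz₀
      · refine (Fintype.sum_of_injective e hinj _ _ (fun i hi => ?_) fun i => ?_).symm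
        · simp [Function.extend_apply' _ _ _ hi]
        · simp [hinj.extend_apply]
    · rintro _ ⟨a, ⟨ha, hs'⟩, rfl⟩
      exact (convex_convexHull ℝ s).sum_mem (fun i _ => ha.1 i) ha.2
        fun i _ => subset_convexHull ℝ s (hs' i trivial)
  rw [himg]
  refine ((isCompact_stdSimplex ℝ (Fin n)).prod (isCompact_univ_pi fun _ => hs)).image ?_
  fun_prop

end Convex

end HypergraphColouring

namespace HypergraphColouring

/-! ### The relaxed optimisation problem and its linearisation -/

section Relaxation

/-- The five statistics of a pair of messages `(ξ, η)` on which the growth rate depends linearly. -/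
noncomputable def stat (d : ℕ) (ξ η : ℝ) : Fin 5 → ℝ :=
  ![ξ, η, ξ * η, ξ ^ (((d : ℝ) + 1) / d), η ^ (((d : ℝ) + 1) / d)]

/-- Averages of `stat` over messages in the box `[0, c]²`. -/
def statHull (d : ℕ) (c : ℝ) : Set (Fin 5 → ℝ) :=
  convexHull ℝ ((fun z : ℝ × ℝ => stat d z.1 z.2) '' (Set.Icc 0 c ×ˢ Set.Icc 0 c))

/-- The `p`-norm power of messages normalised to have total weight `1`, the special colour carrying
`1 - q X` in total weight `w`. -/
noncomputable def normPow (d : ℕ) (q w X P : ℝ) : ℝ :=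
  w * ((1 - q * X) / w) ^ (((d : ℝ) + 1) / d) + q * P

/-- The growth rate as a function of the averaged statistics of `q` colours. -/
noncomputable def rate (d : ℕ) (q w : ℝ) (m : Fin 5 → ℝ) : ℝ :=
  ((d : ℝ) + 1) * Real.log (1 - q * m 2) - d * Real.log (normPow d q w (m 0) (m 3))
    - d * Real.log (normPow d q w (m 1) (m 4))

/-- Up to a positive factor, the derivative of `rate` at `m` in the direction `v`. -/
noncomputable def rateDeriv (d : ℕ) (q w : ℝ) (m v : Fin 5 → ℝ) : ℝ :=
  - v 2 / (1 - q * m 2)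
    + (((1 - q * m 0) / w) ^ ((1 : ℝ) / d) * v 0 - v 3 / (((d : ℝ) + 1) / d))
        / normPow d q w (m 0) (m 3)
    + (((1 - q * m 1) / w) ^ ((1 : ℝ) / d) * v 1 - v 4 / (((d : ℝ) + 1) / d))
        / normPow d q w (m 1) (m 4)

variable {d : ℕ} {q w c : ℝ}

theorem statHull_mono_bounds (hc : 0 < c) {m : Fin 5 → ℝ} (hm : m ∈ statHull d c) :
    (0 ≤ m 0 ∧ m 0 ≤ c) ∧ (0 ≤ m 1 ∧ m 1 ≤ c) ∧ (0 ≤ m 2 ∧ m 2 ≤ c * c) ∧ 0 ≤ m 3 ∧ 0 ≤ m 4 := by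
  have key : statHull d c ⊆ {m | (0 ≤ m 0 ∧ m 0 ≤ c) ∧ (0 ≤ m 1 ∧ m 1 ≤ c) ∧
      (0 ≤ m 2 ∧ m 2 ≤ c * c) ∧ 0 ≤ m 3 ∧ 0 ≤ m 4} := by
    apply convexHull_min
    · rintro _ ⟨⟨ξ, η⟩, ⟨⟨h1, h2⟩, h3, h4⟩, rfl⟩
      simp only [stat, Set.mem_ofPred_eq, Matrix.cons_val]
      simp only at h1 h2 h3 h4
      exact ⟨⟨h1, h2⟩, ⟨h3, h4⟩, ⟨by positivity, mul_le_mul h2 h4 h3 hc.le⟩, by positivity,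
        by positivity⟩
    · intro x hx y hy a b ha hb hab
      simp only [Set.mem_ofPred_eq, Pi.add_apply, Pi.smul_apply, smul_eq_mul] at hx hy ⊢
      have conv : ∀ u v K : ℝ, u ≤ K → v ≤ K → a * u + b * v ≤ K := fun u v K hu hv => by
        calc a * u + b * v ≤ a * K + b * K := by gcongr
          _ = K := by rw [← add_mul, hab, one_mul]
      have nn : ∀ u v : ℝ, 0 ≤ u → 0 ≤ v → 0 ≤ a * u + b * v := fun u v hu hv => by positivity
      exact ⟨⟨nn _ _ hx.1.1 hy.1.1, conv _ _ _ hx.1.2 hy.1.2⟩,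
        ⟨nn _ _ hx.2.1.1 hy.2.1.1, conv _ _ _ hx.2.1.2 hy.2.1.2⟩,
        ⟨nn _ _ hx.2.2.1.1 hy.2.2.1.1, conv _ _ _ hx.2.2.1.2 hy.2.2.1.2⟩,
        nn _ _ hx.2.2.2.1 hy.2.2.2.1, nn _ _ hx.2.2.2.2 hy.2.2.2.2⟩
  exact key hm

theorem normPow_pos (hq : 0 < q) (hw : 0 < w) (hqc : q * c < 1) {X P : ℝ} (hX : X ≤ c)
    (hP : 0 ≤ P) : 0 < normPow d q w X P := by
  have : 0 < 1 - q * X := by nlinarith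
  unfold normPow
  positivity

theorem isCompact_statHull : IsCompact (statHull d c) := by
  apply isCompact_convexHull_of_finiteDimensional
  apply (isCompact_Icc.prod isCompact_Icc).image_of_continuousOn
  rw [continuousOn_pi]
  have hp : (0 : ℝ) ≤ ((d : ℝ) + 1) / d := by positivity
  intro i
  apply Continuous.continuousOn
  have h1 : Continuous fun z : ℝ × ℝ => z.1 ^ (((d : ℝ) + 1) / d) :=
    continuous_fst.rpow_const fun _ => Or.inr hp
  have h2 : Continuous fun z : ℝ × ℝ => z.2 ^ (((d : ℝ) + 1) / d) :=
    continuous_snd.rpow_const fun _ => Or.inr hp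
  fin_cases i <;> simp [stat] <;> fun_prop

theorem exists_isMaxOn_rate (hq : 0 < q) (hw : 0 < w) (hc : 0 < c) (hqc : q * c < 1) (hc1 : c ≤ 1) :
    ∃ m ∈ statHull d c, IsMaxOn (rate d q w) (statHull d c) m := by
  apply isCompact_statHull.exists_isMaxOn
  · refine Set.Nonempty.convexHull (Set.Nonempty.image _ ⟨(0, 0), ?_⟩)
    simp [hc.le]
  · have hp : (0 : ℝ) ≤ ((d : ℝ) + 1) / d := by positivity
    have hn : ∀ i j : Fin 5, ContinuousOn (fun m : Fin 5 → ℝ => normPow d q w (m i) (m j))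
        (statHull d c) := by
      intro i j
      unfold normPow
      apply Continuous.continuousOn
      refine Continuous.add (continuous_const.mul (Continuous.rpow_const ?_ fun _ => Or.inr hp)) ?_
      · fun_prop
      · fun_prop
    unfold rate
    refine ContinuousOn.sub (ContinuousOn.sub ?_ ?_) ?_
    · refine continuousOn_const.mul (ContinuousOn.log (by fun_prop) fun m hm => ?_)
      have := statHull_mono_bounds hc hm
      nlinarith [mul_le_mul_of_nonneg_left hc1 hc.le]
    · refine continuousOn_const.mul (ContinuousOn.log (hn 0 3) fun m hm => ?_)
      have := statHull_mono_bounds hc hm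
      exact (normPow_pos hq hw hqc this.1.2 this.2.2.2.1).ne'
    · refine continuousOn_const.mul (ContinuousOn.log (hn 1 4) fun m hm => ?_)
      have := statHull_mono_bounds hc hm
      exact (normPow_pos hq hw hqc this.2.1.2 this.2.2.2.2).ne'

/-- The factor q p is pulled out because d p = d + 1: all three terms in the derivative of `rate`
then share the factor (d + 1) q, which `rateDeriv` drops. -/
theorem hasDerivAt_normPow (hd : 0 < d) (hw : 0 < w) {X P V S : ℝ} (hX : 0 < 1 - q * X) :
    HasDerivAt (fun ε : ℝ => normPow d q w (X + ε * (V - X)) (P + ε * (S - P)))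
      (-(q * (((d : ℝ) + 1) / d) * (((1 - q * X) / w) ^ ((1 : ℝ) / d) * (V - X)
        - (S - P) / (((d : ℝ) + 1) / d)))) 0 := by
  have hd' : (0 : ℝ) < d := by exact_mod_cast hd
  have hb : (1 - q * (X + 0 * (V - X))) / w ≠ 0 := by
    simp only [zero_mul, add_zero]; positivity
  have h1 : HasDerivAt (fun ε : ℝ => (1 - q * (X + ε * (V - X))) / w) (-(q * (V - X)) / w) 0 := by
    have := (((((hasDerivAt_id (0 : ℝ)).mul_const (V - X)).const_add X).const_mul q).const_sub
      1).div_const w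
    simpa using this
  have h2 := (h1.rpow_const (p := ((d : ℝ) + 1) / d) (Or.inl hb)).const_mul w
  have h3 : HasDerivAt (fun ε : ℝ => q * (P + ε * (S - P))) (q * (S - P)) 0 := by
    have := (((hasDerivAt_id (0 : ℝ)).mul_const (S - P)).const_add P).const_mul q
    simpa using this
  have h4 := h2.add h3
  unfold normPow
  refine h4.congr_deriv ?_
  have hexp : ((d : ℝ) + 1) / d - 1 = 1 / d := by field_simp; ring
  rw [hexp]
  simp only [zero_mul, add_zero]
  field_simp
  ring

/-- The rate need not be concave; only its one-sided derivative at `m` along the segment towards `v`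
is used. By linearity in the direction, this is a difference of two values of `rateDeriv`. -/
theorem rateDeriv_le_of_isMaxOn (hd : 0 < d) (hq : 0 < q) (hw : 0 < w) (hc : 0 < c)
    (hqc : q * c < 1) (hc1 : c ≤ 1) {m v : Fin 5 → ℝ} (hm : m ∈ statHull d c)
    (hmax : IsMaxOn (rate d q w) (statHull d c) m) (hv : v ∈ statHull d c) :
    rateDeriv d q w m v ≤ rateDeriv d q w m m := by
  have hd' : (0 : ℝ) < d := by exact_mod_cast hd
  obtain ⟨b0, b1, b2, b3, b4⟩ := statHull_mono_bounds hc hm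
  have hN : 0 < 1 - q * m 2 := by nlinarith [mul_le_mul_of_nonneg_left hc1 hc.le]
  have hU := normPow_pos (d := d) hq hw hqc b0.2 b3
  have hU' := normPow_pos (d := d) hq hw hqc b1.2 b4
  have hX : 0 < 1 - q * m 0 := by nlinarith
  have hY : 0 < 1 - q * m 1 := by nlinarith
  have hline : ∀ ε ∈ Set.Icc (0 : ℝ) 1, m + ε • (v - m) ∈ statHull d c := fun ε hε => by
    have e : m + ε • (v - m) = (1 - ε) • m + ε • v := by module
    rw [e]
    exact (convex_convexHull ℝ _) hm hv (sub_nonneg.2 hε.2) hε.1 (by ring)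
  have h1 : HasDerivAt (fun ε : ℝ => 1 - q * (m 2 + ε * (v 2 - m 2))) (-(q * (v 2 - m 2))) 0 := by
    have := ((((hasDerivAt_id (0 : ℝ)).mul_const (v 2 - m 2)).const_add (m 2)).const_mul q).const_sub
      1
    simpa using this
  have hlog1 := (h1.log (by simpa using hN.ne')).const_mul ((d : ℝ) + 1)
  have hlog2 := ((hasDerivAt_normPow (P := m 3) (V := v 0) (S := v 3) hd hw hX).log
    (by simpa using hU.ne')).const_mul (d : ℝ)
  have hlog3 := ((hasDerivAt_normPow (P := m 4) (V := v 1) (S := v 4) hd hw hY).log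
    (by simpa using hU'.ne')).const_mul (d : ℝ)
  have hder := (hlog1.sub hlog2).sub hlog3
  have hle := deriv_nonpos_of_le_right (b := 1) one_pos hder fun ε hε => by
    have := hmax (hline ε hε)
    simpa [rate] using this
  simp only [zero_mul, add_zero] at hle
  have heq : ((d : ℝ) + 1) * (-(q * (v 2 - m 2)) / (1 - q * m 2))
      - d * (-(q * (((d : ℝ) + 1) / d) * (((1 - q * m 0) / w) ^ ((1 : ℝ) / d) * (v 0 - m 0)
        - (v 3 - m 3) / (((d : ℝ) + 1) / d))) / normPow d q w (m 0) (m 3))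
      - d * (-(q * (((d : ℝ) + 1) / d) * (((1 - q * m 1) / w) ^ ((1 : ℝ) / d) * (v 1 - m 1)
        - (v 4 - m 4) / (((d : ℝ) + 1) / d))) / normPow d q w (m 1) (m 4))
      = ((d : ℝ) + 1) * q * (rateDeriv d q w m v - rateDeriv d q w m m) := by
    unfold rateDeriv
    field_simp
    ring
  rw [heq] at hle
  have : rateDeriv d q w m v - rateDeriv d q w m m ≤ 0 := by
    by_contra hcon
    have := mul_pos (mul_pos (by positivity : (0 : ℝ) < d + 1) hq) (not_le.1 hcon)
    linarith
  linarith

theorem rateDeriv_sum {ι : Type*} [Fintype ι] (m : Fin 5 → ℝ) (s : ι → ℝ) (z : ι → Fin 5 → ℝ) :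
    rateDeriv d q w m (∑ i, s i • z i) = ∑ i, s i * rateDeriv d q w m (z i) := by
  unfold rateDeriv
  simp only [Finset.sum_apply, Pi.smul_apply, smul_eq_mul, mul_add, Finset.sum_add_distrib]
  congr 1
  · congr 1
    · rw [← Finset.sum_neg_distrib, Finset.sum_div]
      exact Finset.sum_congr rfl fun i _ => by ring
    · rw [Finset.mul_sum, Finset.sum_div, ← Finset.sum_sub_distrib, Finset.sum_div]
      exact Finset.sum_congr rfl fun i _ => by ring
  · rw [Finset.mul_sum, Finset.sum_div, ← Finset.sum_sub_distrib, Finset.sum_div]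
    exact Finset.sum_congr rfl fun i _ => by ring

/-- Every message carrying mass in a maximiser of the rate maximises the linearised rate. -/
theorem isMaxOn_rateDeriv_of_atom (hd : 0 < d) (hq : 0 < q) (hw : 0 < w) (hc : 0 < c)
    (hqc : q * c < 1) (hc1 : c ≤ 1) {ι : Type*} [Fintype ι] {s x y : ι → ℝ} (hs : ∀ i, 0 ≤ s i)
    (hs1 : ∑ i, s i = 1) (hx : ∀ i, x i ∈ Set.Icc 0 c) (hy : ∀ i, y i ∈ Set.Icc 0 c)
    {m : Fin 5 → ℝ} (hm : ∑ i, s i • stat d (x i) (y i) = m)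
    (hmax : IsMaxOn (rate d q w) (statHull d c) m) (i : ι) (hi : 0 < s i) {ξ η : ℝ}
    (hξ : ξ ∈ Set.Icc 0 c) (hη : η ∈ Set.Icc 0 c) :
    rateDeriv d q w m (stat d ξ η) ≤ rateDeriv d q w m (stat d (x i) (y i)) := by
  have hmem : ∀ ξ η : ℝ, ξ ∈ Set.Icc 0 c → η ∈ Set.Icc 0 c → stat d ξ η ∈ statHull d c :=
    fun ξ η hξ hη => subset_convexHull ℝ _ ⟨(ξ, η), ⟨hξ, hη⟩, rfl⟩
  have hmK : m ∈ statHull d c := by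
    rw [← hm]
    exact (convex_convexHull ℝ _).sum_mem (fun i _ => hs i) hs1
      fun i _ => hmem _ _ (hx i) (hy i)
  have hle := fun v hv => rateDeriv_le_of_isMaxOn (v := v) hd hq hw hc hqc hc1 hmK hmax hv
  refine (hle _ (hmem _ _ hξ hη)).trans ?_
  by_contra hcon
  -- The value at `m` is the average of the values at the atoms, none of which exceeds it, so an
  -- atom of positive mass cannot fall short.
  have hsum : ∑ j, s j * rateDeriv d q w m (stat d (x j) (y j)) < ∑ j, s j * rateDeriv d q w m m :=
    Finset.sum_lt_sum (fun j _ => mul_le_mul_of_nonneg_left (hle _ (hmem _ _ (hx j) (hy j))) (hs j))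
      ⟨i, Finset.mem_univ i, mul_lt_mul_of_pos_left (not_le.1 hcon) hi⟩
  rw [← rateDeriv_sum, hm, ← Finset.sum_mul, hs1, one_mul] at hsum
  exact lt_irrefl _ hsum

end Relaxation

end HypergraphColouring

namespace HypergraphColouring

/-! ### Stationarity of the atoms -/

section Atoms

variable {d : ℕ} {q w c : ℝ}

/-- The right end `c` is never optimal, because `hκ` makes the derivative negative there. What
remains is ξ = 0 or an interior critical point, expressed as complementary slackness. -/
theorem coordinate_isMax {κ U N η ξ : ℝ} (hd : 0 < d) (hU : 0 < U) (hN : 0 < N) (hη : 0 ≤ η)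
    (hc : 0 < c) (hκ : κ < c ^ ((1 : ℝ) / d)) (hξ : ξ ∈ Set.Icc 0 c)
    (hmax : ∀ z ∈ Set.Icc 0 c, -(z * η) / N + (κ * z - z ^ (((d : ℝ) + 1) / d) / (((d : ℝ) + 1) / d)) / U
      ≤ -(ξ * η) / N + (κ * ξ - ξ ^ (((d : ℝ) + 1) / d) / (((d : ℝ) + 1) / d)) / U) :
    -η / N + (κ - ξ ^ ((1 : ℝ) / d)) / U ≤ 0 ∧
      ξ * (-η / N + (κ - ξ ^ ((1 : ℝ) / d)) / U) = 0 := by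
  have hd' : (0 : ℝ) < d := by exact_mod_cast hd
  have hp : (1 : ℝ) ≤ ((d : ℝ) + 1) / d := by rw [le_div_iff₀ hd']; linarith
  have hexp : ((d : ℝ) + 1) / d - 1 = 1 / d := by field_simp; ring
  have hder : HasDerivAt (fun z : ℝ => -(z * η) / N
      + (κ * z - z ^ (((d : ℝ) + 1) / d) / (((d : ℝ) + 1) / d)) / U)
      (-η / N + (κ - ξ ^ ((1 : ℝ) / d)) / U) ξ := by
    have h1 := (((hasDerivAt_id ξ).mul_const η).neg).div_const N
    have h2 := (Real.hasDerivAt_rpow_const (x := ξ) (p := ((d : ℝ) + 1) / d) (Or.inr hp)).div_const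
      (((d : ℝ) + 1) / d)
    have h3 := (((hasDerivAt_id ξ).const_mul κ).sub h2).div_const U
    refine (h1.add h3).congr_deriv ?_
    rw [hexp]
    field_simp
  have hneg : ξ ≠ c := by
    rintro rfl
    have h0 := deriv_nonneg_of_le_left hc hder fun z hz => hmax z hz
    have h1 : (κ - ξ ^ ((1 : ℝ) / d)) / U < 0 := div_neg_of_neg_of_pos (by linarith) hU
    have h2 : -η / N ≤ 0 := div_nonpos_of_nonpos_of_nonneg (by linarith) hN.le
    linarith
  have hlt : ξ < c := lt_of_le_of_ne hξ.2 hneg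
  have hle := deriv_nonpos_of_le_right hlt hder fun z hz => hmax z ⟨hξ.1.trans hz.1, hz.2⟩
  refine ⟨hle, ?_⟩
  rcases hξ.1.eq_or_lt with h | h
  · rw [← h, zero_mul]
  · have := deriv_nonneg_of_le_left h hder fun z hz => hmax z ⟨hz.1, hz.2.trans hξ.2⟩
    rw [le_antisymm hle this, mul_zero]

/-- Euler's identity for the `p`-norm, one side. -/
theorem euler_coordinate (hd : 0 < d) (hq : 0 < q) (hw : 0 < w) (hc : 0 < c) (hc1 : c < 1)
    (hqc : q * c < 1) (hwc : 1 / w < c)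
    {ι : Type*} [Fintype ι] {s x y : ι → ℝ} (hs : ∀ i, 0 ≤ s i) (hs1 : ∑ i, s i = 1)
    (hx : ∀ i, x i ∈ Set.Icc 0 c) (hy : ∀ i, y i ∈ Set.Icc 0 c) {X P Z : ℝ}
    (hX : ∑ i, s i * x i = X) (hZ : ∑ i, s i * (x i * y i) = Z)
    (hP : ∑ i, s i * x i ^ (((d : ℝ) + 1) / d) = P)
    (hmax : ∀ i, 0 < s i → ∀ z ∈ Set.Icc 0 c, -(z * y i) / (1 - q * Z)
        + (((1 - q * X) / w) ^ ((1 : ℝ) / d) * z - z ^ (((d : ℝ) + 1) / d) / (((d : ℝ) + 1) / d))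
          / normPow d q w X P
      ≤ -(x i * y i) / (1 - q * Z) + (((1 - q * X) / w) ^ ((1 : ℝ) / d) * x i
        - x i ^ (((d : ℝ) + 1) / d) / (((d : ℝ) + 1) / d)) / normPow d q w X P) :
    normPow d q w X P = (1 - q * Z) * ((1 - q * X) / w) ^ ((1 : ℝ) / d) ∧
      ∀ i, 0 < s i → x i = (1 - q * X) / w * (1 - y i) ^ d := by
  have hd' : (0 : ℝ) < d := by exact_mod_cast hd
  have hexp : ((d : ℝ) + 1) / d = 1 + 1 / d := by field_simp
  have hX0 : 0 ≤ X := by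
    rw [← hX]; exact Finset.sum_nonneg fun i _ => mul_nonneg (hs i) (hx i).1
  have hXc : X ≤ c := by
    rw [← hX]
    calc ∑ i, s i * x i ≤ ∑ i, s i * c :=
          Finset.sum_le_sum fun i _ => mul_le_mul_of_nonneg_left (hx i).2 (hs i)
      _ = c := by rw [← Finset.sum_mul, hs1, one_mul]
  have hZc : Z ≤ c := by
    rw [← hZ]
    calc ∑ i, s i * (x i * y i) ≤ ∑ i, s i * c :=
          Finset.sum_le_sum fun i _ => mul_le_mul_of_nonneg_left
            (by nlinarith [(hx i).1, (hx i).2, (hy i).1, (hy i).2]) (hs i)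
      _ = c := by rw [← Finset.sum_mul, hs1, one_mul]
  have hP0 : 0 ≤ P := by
    rw [← hP]
    exact Finset.sum_nonneg fun i _ => mul_nonneg (hs i) (Real.rpow_nonneg (hx i).1 _)
  have hN : 0 < 1 - q * Z := by nlinarith
  have h1X : 0 < 1 - q * X := by nlinarith
  have hU : 0 < normPow d q w X P := normPow_pos hq hw hqc hXc hP0
  set N := 1 - q * Z with hNdef
  set U := normPow d q w X P with hUdef
  set κ := ((1 - q * X) / w) ^ ((1 : ℝ) / d) with hκdef
  have hA : 0 < (1 - q * X) / w := by positivity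
  have hAc : (1 - q * X) / w < c := by
    refine lt_of_le_of_lt ?_ hwc
    gcongr
    nlinarith
  have hκc : κ < c ^ ((1 : ℝ) / d) := Real.rpow_lt_rpow hA.le hAc (by positivity)
  have hκ0 : 0 < κ := Real.rpow_pos_of_pos hA _
  have hκd : κ ^ d = (1 - q * X) / w := by
    rw [hκdef, ← Real.rpow_natCast, ← Real.rpow_mul hA.le, one_div, inv_mul_cancel₀ hd'.ne',
      Real.rpow_one]
  have hcoord := fun i hi => coordinate_isMax hd hU hN (hy i).1 hc hκc (hx i) (hmax i hi)
  have hUeq : U = (1 - q * X) * κ + q * P := by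
    rw [hUdef, normPow, hexp, Real.rpow_add hA, Real.rpow_one, ← hκdef]
    field_simp
  -- Averaging the slackness relations leaves one equation between the statistics `X`, `P` and `Z`.
  have hsum : ∑ i, s i * (x i * (-y i / N + (κ - x i ^ ((1 : ℝ) / d)) / U)) = 0 := by
    refine Finset.sum_eq_zero fun i _ => ?_
    rcases (hs i).eq_or_lt with h | h
    · rw [← h, zero_mul]
    · rw [(hcoord i h).2, mul_zero]
  have hsum2 : -Z / N + (κ * X - P) / U = 0 := by
    rw [← hsum, ← hX, ← hZ, ← hP, Finset.mul_sum, ← Finset.sum_sub_distrib, Finset.sum_div,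
      ← Finset.sum_neg_distrib, Finset.sum_div, ← Finset.sum_add_distrib]
    refine Finset.sum_congr rfl fun i _ => ?_
    rw [hexp, Real.rpow_add' (hx i).1 (by positivity), Real.rpow_one]
    ring
  -- Since U = κ − q(κX − P) and qZ = 1 − N, the averaged relation becomes (κ − U)N = (1 − N)U.
  have hfst : U = N * κ := by
    have h3 : (κ * X - P) * N = Z * U := by
      field_simp at hsum2
      linarith
    have h4 : q * Z = 1 - N := by rw [hNdef]; ring
    have h5 : (κ - U) * N = (1 - N) * U := by
      rw [← h4, hUeq] at *
      linear_combination q * h3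
    linear_combination -h5
  refine ⟨hfst, fun i hi => ?_⟩
  obtain ⟨hle, hz⟩ := hcoord i hi
  have hform : ∀ v : ℝ, -y i / N + (κ - v) / U = (κ * (1 - y i) - v) / U := fun v => by
    rw [hfst]; field_simp; ring
  rw [hform] at hle hz
  have hyi := hy i
  -- At 0 the derivative would be κ(1 − y)/U, which is positive because y ≤ c < 1.
  have hxi : x i ≠ 0 := by
    intro h0
    rw [h0, Real.zero_rpow (by positivity), sub_zero] at hle
    have : 0 < κ * (1 - y i) / U := div_pos (mul_pos hκ0 (by linarith [hyi.2])) hU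
    linarith
  have h6 : x i ^ ((1 : ℝ) / d) = κ * (1 - y i) := by
    have := (mul_eq_zero.1 hz).resolve_left hxi
    rw [div_eq_zero_iff] at this
    have := this.resolve_right hU.ne'
    linarith
  rw [← hκd, ← mul_pow, ← h6, ← Real.rpow_natCast, ← Real.rpow_mul (hx i).1, one_div,
    inv_mul_cancel₀ hd'.ne', Real.rpow_one]

end Atoms

/-! ### Uniqueness of the two-cycle -/

section TwoCycle

theorem exists_deriv_zero_between {f f' : ℝ → ℝ} {a b : ℝ} (hab : a < b)
    (hf : ∀ x ∈ Set.Icc a b, HasDerivAt f (f' x) x) (ha : f a = 0) (hb : f b = 0) :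
    ∃ z ∈ Set.Ioo a b, f' z = 0 := by
  obtain ⟨z, hz, h⟩ := exists_hasDerivAt_eq_zero hab
    (fun x hx => (hf x hx).continuousAt.continuousWithinAt) (ha.trans hb.symm)
    fun x hx => hf x ⟨hx.1.le, hx.2.le⟩
  exact ⟨z, hz, h⟩

/-- The map `ξ ↦ A (1 - A (1 - ξ)^d)^d` does not have four fixed points in `(0, 1)`. -/
theorem not_four_fixedPoints {d : ℕ} (hd : 2 ≤ d) {A a₁ a₂ a₃ a₄ : ℝ} (hA : 0 < A) (hA1 : A ≤ 1)
    (h0 : 0 < a₁) (h12 : a₁ < a₂) (h23 : a₂ < a₃) (h34 : a₃ < a₄) (h1 : a₄ < 1)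
    (hfix : ∀ a ∈ ({a₁, a₂, a₃, a₄} : Set ℝ), a = A * (1 - A * (1 - a) ^ d) ^ d) : False := by
  have hd' : (2 : ℝ) ≤ d := by exact_mod_cast hd
  have hb : ∀ x ∈ Set.Ioo (0 : ℝ) 1, 0 < 1 - A * (1 - x) ^ d := fun x hx => by
    have : (1 - x) ^ d < 1 := pow_lt_one₀ (by linarith [hx.2]) (by linarith [hx.1]) (by omega)
    have h2 : 0 ≤ (1 - x) ^ d := pow_nonneg (by linarith [hx.2]) d
    nlinarith
  -- The logarithm of the fixed-point equation: four zeros of `L` give three zeros of `L'` by Rolle.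
  set L : ℝ → ℝ := fun x => Real.log x - Real.log A - d * Real.log (1 - A * (1 - x) ^ d) with hL
  set L' : ℝ → ℝ := fun x => 1 / x - d * (A * (d * (1 - x) ^ (d - 1)) / (1 - A * (1 - x) ^ d))
    with hL'
  have hder : ∀ x ∈ Set.Ioo (0 : ℝ) 1, HasDerivAt L (L' x) x := fun x hx => by
    have h2 := hb x hx
    have h3 : HasDerivAt (fun x : ℝ => 1 - A * (1 - x) ^ d) (A * (d * (1 - x) ^ (d - 1))) x := by
      have := ((((hasDerivAt_id x).const_sub 1).pow d).const_mul A).const_sub 1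
      refine this.congr_deriv ?_
      simp
    have h4 := ((Real.hasDerivAt_log hx.1.ne').sub_const (Real.log A)).sub
      ((h3.log h2.ne').const_mul (d : ℝ))
    refine h4.congr_deriv ?_
    simp [hL']
  have hLz : ∀ a ∈ ({a₁, a₂, a₃, a₄} : Set ℝ), a ∈ Set.Ioo (0 : ℝ) 1 → L a = 0 := fun a ha hI => by
    have h2 := hb a hI
    have h3 := congrArg Real.log (hfix a ha)
    rw [Real.log_mul hA.ne' (by positivity), Real.log_pow] at h3
    simp only [hL]
    linarith
  have hI : ∀ x, a₁ ≤ x → x ≤ a₄ → x ∈ Set.Ioo (0 : ℝ) 1 := fun x hx1 hx4 =>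
    ⟨by linarith, by linarith⟩
  have hz : ∀ a b, a ∈ ({a₁, a₂, a₃, a₄} : Set ℝ) → b ∈ ({a₁, a₂, a₃, a₄} : Set ℝ) → a₁ ≤ a →
      a < b → b ≤ a₄ → ∃ z ∈ Set.Ioo a b, L' z = 0 := fun a b ha hb' h1a hab hb4 =>
    exists_deriv_zero_between hab (fun x hx => hder x (hI x (h1a.trans hx.1) (hx.2.trans hb4)))
      (hLz a ha (hI a h1a (hab.le.trans hb4))) (hLz b hb' (hI b (h1a.trans hab.le) hb4))
  obtain ⟨z₁, hz1, e1⟩ := hz a₁ a₂ (by simp) (by simp) le_rfl h12 (by linarith)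
  obtain ⟨z₂, hz2, e2⟩ := hz a₂ a₃ (by simp) (by simp) h12.le h23 h34.le
  obtain ⟨z₃, hz3, e3⟩ := hz a₃ a₄ (by simp) (by simp) (by linarith) h34 le_rfl
  -- A critical point of `L` satisfies A(1 − z)^(d−1)(1 + (d² − 1)z) = 1, whose logarithm is M(z) =
  -- −log A. As `M` is strictly concave, it cannot take one value three times.
  set M : ℝ → ℝ := fun x => ((d : ℝ) - 1) * Real.log (1 - x) + Real.log (1 + ((d : ℝ) ^ 2 - 1) * x)
    with hM
  have hMz : ∀ z ∈ Set.Ioo (0 : ℝ) 1, L' z = 0 → M z = -Real.log A := fun z hzI e => by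
    have h2 := hb z hzI
    have h1z : 0 < 1 - z := by linarith [hzI.2]
    have hz0 := hzI.1
    have h3 : 1 - A * (1 - z) ^ d = d * A * d * (1 - z) ^ (d - 1) * z := by
      simp only [hL'] at e
      field_simp at e
      linarith
    have h4 : (1 - z) ^ d = (1 - z) ^ (d - 1) * (1 - z) := by
      rw [← pow_succ]; congr 1; omega
    have h5 : A * ((1 - z) ^ (d - 1) * (1 + ((d : ℝ) ^ 2 - 1) * z)) = 1 := by
      rw [h4] at h3
      linarith
    have h6 : 0 < 1 + ((d : ℝ) ^ 2 - 1) * z := by nlinarith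
    have h7 := congrArg Real.log h5
    rw [Real.log_mul hA.ne' (by positivity), Real.log_mul (by positivity) h6.ne', Real.log_pow,
      Real.log_one] at h7
    have h8 : ((d - 1 : ℕ) : ℝ) = d - 1 := by rw [Nat.cast_sub (by omega), Nat.cast_one]
    rw [h8] at h7
    simp only [hM]
    linarith
  have hconc : StrictConcaveOn ℝ (Set.Ioo (0 : ℝ) 1) M := by
    refine ⟨convex_Ioo _ _, fun x hx y hy hxy a b ha hb' hab => ?_⟩
    have hd1 : (0 : ℝ) < d - 1 := by linarith
    have g1 := strictConcaveOn_log_Ioi.2 (x := 1 - x) (y := 1 - y) (by simpa using hx.2)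
      (by simpa using hy.2) (by intro h; exact hxy (by linarith)) ha hb' hab
    have hpos : ∀ x ∈ Set.Ioo (0 : ℝ) 1, 0 < 1 + ((d : ℝ) ^ 2 - 1) * x := fun x hx => by
      have hd2 : (0 : ℝ) < (d : ℝ) ^ 2 - 1 := by nlinarith
      have := mul_pos hd2 hx.1
      linarith
    have g2 := strictConcaveOn_log_Ioi.concaveOn.2 (x := 1 + ((d : ℝ) ^ 2 - 1) * x)
      (y := 1 + ((d : ℝ) ^ 2 - 1) * y) (hpos x hx) (hpos y hy) ha.le hb'.le hab
    simp only [smul_eq_mul, hM] at g1 g2 ⊢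
    have k1 : 1 - (a * x + b * y) = a * (1 - x) + b * (1 - y) := by linear_combination -hab
    have k2 : 1 + ((d : ℝ) ^ 2 - 1) * (a * x + b * y)
        = a * (1 + ((d : ℝ) ^ 2 - 1) * x) + b * (1 + ((d : ℝ) ^ 2 - 1) * y) := by
      linear_combination -hab
    rw [k1, k2]
    nlinarith
  have I1 := hI z₁ hz1.1.le (by linarith [hz1.2])
  have I2 := hI z₂ (by linarith [hz2.1]) (by linarith [hz2.2])
  have I3 := hI z₃ (by linarith [hz3.1]) hz3.2.le
  have hlt := hconc.lt_on_openSegment I1 I3 (by linarith [hz1.2, hz3.1])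
    (z := z₂) (by rw [openSegment_eq_Ioo (by linarith [hz1.2, hz3.1])]
                  exact ⟨by linarith [hz1.2, hz2.1], by linarith [hz2.2, hz3.1]⟩)
  rw [hMz _ I1 e1, hMz _ I2 e2, hMz _ I3 e3, min_self] at hlt
  exact lt_irrefl _ hlt

/-- The two-cycle of `x ↦ A (1 - x)^d` is unique. -/
theorem twoCycle_unique {d : ℕ} (hd : 2 ≤ d) {A x₁ y₁ x₂ y₂ : ℝ} (hA : 0 < A) (hA1 : A < 1)
    (hx1 : 0 < x₁ ∧ x₁ < 1) (hy1 : 0 < y₁ ∧ y₁ < 1) (hx2 : 0 < x₂ ∧ x₂ < 1) (hy2 : 0 < y₂ ∧ y₂ < 1)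
    (e1 : x₁ = A * (1 - y₁) ^ d) (f1 : y₁ = A * (1 - x₁) ^ d)
    (e2 : x₂ = A * (1 - y₂) ^ d) (f2 : y₂ = A * (1 - x₂) ^ d) (h1 : y₁ < x₁) (h2 : y₂ < x₂) :
    x₁ = x₂ ∧ y₁ = y₂ := by
  have key : ∀ {x₁ y₁ x₂ y₂ : ℝ}, (0 < x₁ ∧ x₁ < 1) → (0 < y₁ ∧ y₁ < 1) → (0 < x₂ ∧ x₂ < 1) →
      (0 < y₂ ∧ y₂ < 1) → x₁ = A * (1 - y₁) ^ d → y₁ = A * (1 - x₁) ^ d →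
      x₂ = A * (1 - y₂) ^ d → y₂ = A * (1 - x₂) ^ d → y₁ < x₁ → y₂ < x₂ → ¬ x₁ < x₂ := by
    intro x₁ y₁ x₂ y₂ hx1 hy1 hx2 hy2 e1 f1 e2 f2 h1 h2 hlt
    -- The map is decreasing, so distinct two-cycles are nested, y₂ < y₁ < x₁ < x₂, and yield four
    -- fixed points of the second iterate.
    have hy : y₂ < y₁ := by
      rw [f1, f2]
      have : (1 - x₂) ^ d < (1 - x₁) ^ d :=
        pow_lt_pow_left₀ (by linarith) (by linarith [hx2.2]) (by omega)
      gcongr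
    refine not_four_fixedPoints hd hA hA1.le hy2.1 hy h1 hlt hx2.2 ?_
    intro a ha
    simp only [Set.mem_insert_iff, Set.mem_singleton_iff] at ha
    rcases ha with rfl | rfl | rfl | rfl
    · rw [← e2]; exact f2
    · rw [← e1]; exact f1
    · rw [← f1]; exact e1
    · rw [← f2]; exact e2
  have hx : x₁ = x₂ := le_antisymm
    (not_lt.1 (key hx2 hy2 hx1 hy1 e2 f2 e1 f1 h2 h1)) (not_lt.1 (key hx1 hy1 hx2 hy2 e1 f1 e2 f2 h1 h2))
  exact ⟨hx, by rw [f1, f2, hx]⟩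

end TwoCycle

end HypergraphColouring

namespace HypergraphColouring

/-! ### Instability of symmetric messages -/

section Diagonal

/-- At a symmetric fixed point of a steep recursion, moving the two messages apart increases the
linearised rate. -/
theorem not_diagonal_max {d : ℕ} {A x δ : ℝ} (hd : 2 ≤ d) (hA : 0 < A) (h5 : 5 ≤ d * A)
    (hx : 0 < x) (hx1 : x < 1) (hfix : x = A * (1 - x) ^ d) (hδ : 0 < δ) (hδx : δ < x)
    (hmax : ∀ ε ∈ Set.Icc 0 δ, ε ^ 2 - ((x + ε) ^ (((d : ℝ) + 1) / d) + (x - ε) ^ (((d : ℝ) + 1) / d))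
      / (((d : ℝ) + 1) / d * A ^ ((1 : ℝ) / d)) ≤
        - (2 * x ^ (((d : ℝ) + 1) / d)) / (((d : ℝ) + 1) / d * A ^ ((1 : ℝ) / d))) : False := by
  have hd' : (2 : ℝ) ≤ d := by exact_mod_cast hd
  have hd0 : (0 : ℝ) < d := by linarith
  have hp : (1 : ℝ) ≤ ((d : ℝ) + 1) / d := by rw [le_div_iff₀ hd0]; linarith
  have hexp : ((d : ℝ) + 1) / d - 1 = 1 / d := by field_simp; ring
  have hκ : 0 < A ^ ((1 : ℝ) / d) := Real.rpow_pos_of_pos hA _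
  set κ := A ^ ((1 : ℝ) / d) with hκdef
  have hroot : x ^ ((1 : ℝ) / d) = κ * (1 - x) := by
    conv_lhs => rw [hfix]
    rw [Real.mul_rpow hA.le (pow_nonneg (by linarith) d), ← Real.rpow_natCast,
      ← Real.rpow_mul (by linarith), mul_one_div_cancel hd0.ne', Real.rpow_one]
  -- The recursion has slope −dx/(1 − x) at `x`; the claim is that its modulus exceeds 1. Otherwise
  -- x ≤ 1/(d + 1), so (1 − x)^(d−1) ≥ 1/e, whereas `h5` and the fixed-point equation give (1 −
  -- x)^(d−1) ≤ 1/5.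
  have hsmall : 1 - x < d * x := by
    by_contra hcon
    have hcon := not_lt.1 hcon
    have h1x : 0 < 1 - x := by linarith
    have h1 : 5 * (1 - x) ^ (d - 1) ≤ 1 := by
      have h2 : (1 - x) ^ d = (1 - x) ^ (d - 1) * (1 - x) := by
        rw [← pow_succ]; congr 1; omega
      have h3 : 5 * (1 - x) ^ d ≤ 1 - x := by
        calc 5 * (1 - x) ^ d ≤ d * A * (1 - x) ^ d := by gcongr
          _ = d * x := by rw [mul_assoc, ← hfix]
          _ ≤ 1 - x := hcon
      rw [h2, ← mul_assoc] at h3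
      exact le_of_mul_le_mul_right (by linarith) h1x
    have h2 : Real.exp (-(1 / d)) ≤ 1 - x := by
      rw [Real.exp_neg, inv_le_comm₀ (Real.exp_pos _) h1x]
      refine le_trans ?_ (Real.add_one_le_exp _)
      rw [inv_eq_one_div, div_le_iff₀ h1x]
      have : x ≤ 1 / (d + 1) := by rw [le_div_iff₀ (by linarith)]; linarith
      have h4 : (1 : ℝ) = (1 / d + 1) * (1 - 1 / (d + 1)) := by field_simp; ring
      calc (1 : ℝ) = (1 / d + 1) * (1 - 1 / (d + 1)) := h4
        _ ≤ (1 / d + 1) * (1 - x) := by gcongr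
    have h3 : Real.exp (-1) ≤ (1 - x) ^ (d - 1) := by
      calc Real.exp (-1) ≤ Real.exp (((d - 1 : ℕ) : ℝ) * -(1 / d)) := by
            apply Real.exp_le_exp.2
            rw [Nat.cast_sub (by omega)]
            push_cast
            have : ((d : ℝ) - 1) * -(1 / d) = -1 + 1 / d := by field_simp; ring
            rw [this]
            have : (0 : ℝ) < 1 / d := by positivity
            linarith
        _ = Real.exp (-(1 / d)) ^ (d - 1) := Real.exp_nat_mul _ _
        _ ≤ (1 - x) ^ (d - 1) := by gcongr
    have h4 : Real.exp (-1) * Real.exp 1 = 1 := by rw [← Real.exp_add]; simp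
    have h5 := Real.exp_one_lt_d9
    nlinarith [Real.exp_pos 1, Real.exp_pos (-1)]
  set ψ : ℝ → ℝ := fun ε => ε ^ 2 - ((x + ε) ^ (((d : ℝ) + 1) / d)
    + (x - ε) ^ (((d : ℝ) + 1) / d)) / (((d : ℝ) + 1) / d * κ) with hψ
  -- The derivative of `ψ`. It vanishes at 0 with positive slope there, so `ψ` increases strictly to
  -- the right of 0.
  set φ : ℝ → ℝ := fun ε => 2 * ε - ((x + ε) ^ ((1 : ℝ) / d) - (x - ε) ^ ((1 : ℝ) / d)) / κ with hφ
  have hψ' : ∀ ε, HasDerivAt ψ (φ ε) ε := fun ε => by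
    have h1 := (((hasDerivAt_id ε).const_add x).rpow_const (p := ((d : ℝ) + 1) / d) (Or.inr hp)).add
      (((hasDerivAt_id ε).const_sub x).rpow_const (p := ((d : ℝ) + 1) / d) (Or.inr hp))
    have h2 := (hasDerivAt_pow 2 ε).sub (h1.div_const (((d : ℝ) + 1) / d * κ))
    refine h2.congr_deriv ?_
    rw [hexp]
    simp only [hφ, id]
    field_simp
    ring
  have hφ' : HasDerivAt φ (2 - 2 * ((1 - x) / (d * x))) 0 := by
    have h1 := (((hasDerivAt_id (0 : ℝ)).const_add x).rpow_const (p := (1 : ℝ) / d)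
      (Or.inl (by simpa using hx.ne'))).sub
      (((hasDerivAt_id (0 : ℝ)).const_sub x).rpow_const (p := (1 : ℝ) / d)
        (Or.inl (by simpa using hx.ne')))
    have h2 := ((hasDerivAt_id (0 : ℝ)).const_mul 2).sub (h1.div_const κ)
    refine h2.congr_deriv ?_
    simp only [id, add_zero, sub_zero]
    rw [Real.rpow_sub_one hx.ne', hroot]
    field_simp
    ring
  have hpos : 0 < 2 - 2 * ((1 - x) / (d * x)) := by
    have : (1 - x) / (d * x) < 1 := by rw [div_lt_one (by positivity)]; exact hsmall
    linarith
  have hev : ∀ᶠ ε in 𝓝[>] (0 : ℝ), 0 < φ ε := by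
    have h := (hasDerivAt_iff_tendsto_slope.1 hφ').mono_left
      (nhdsWithin_mono 0 (fun y (hy : 0 < y) => ne_of_gt hy) : 𝓝[>] (0 : ℝ) ≤ 𝓝[≠] 0)
    filter_upwards [h.eventually (lt_mem_nhds hpos), self_mem_nhdsWithin] with ε hε hε0
    have h0 : φ 0 = 0 := by simp [hφ]
    rw [slope_def_field, h0, sub_zero, sub_zero] at hε
    exact (div_pos_iff_of_pos_right hε0).1 hε
  obtain ⟨η, hη, hη2⟩ := mem_nhdsGT_iff_exists_Ioo_subset.1 hev
  have hη : 0 < η := hη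
  set e := min δ (η / 2)
  have he0 : 0 < e := lt_min hδ (by linarith)
  have heη : e < η := lt_of_le_of_lt (min_le_right _ _) (by linarith)
  have hmono : StrictMonoOn ψ (Set.Icc 0 e) := by
    apply strictMonoOn_of_deriv_pos (convex_Icc _ _)
    · exact fun ε _ => (hψ' ε).continuousAt.continuousWithinAt
    · intro ε hε
      rw [interior_Icc] at hε
      rw [(hψ' ε).deriv]
      exact hη2 ⟨hε.1, hε.2.trans heη⟩
  have hlt := hmono ⟨le_rfl, he0.le⟩ ⟨he0.le, le_rfl⟩ he0
  have hle := hmax e ⟨he0.le, min_le_left _ _⟩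
  have h0 : ψ 0 = - (2 * x ^ (((d : ℝ) + 1) / d)) / (((d : ℝ) + 1) / d * κ) := by
    simp [hψ]; ring
  rw [← h0] at hle
  exact absurd hlt (not_lt.2 hle)

end Diagonal

/-! ### Structure of the relaxed maximiser -/

section Structure

variable {d : ℕ} {q w c : ℝ}

/-- If x ≤ y on the support, then ∑ s(1 − y)^d ≤ ∑ s(1 − x)^d, so the normalisations force A' ≤ A.
-/
theorem not_lt_of_forall_le {ι : Type*} [Fintype ι] {s x y : ι → ℝ} {A A' : ℝ} (hq : 0 < q)
    (hw : 0 < w) (hA : 0 < A) (hs : ∀ i, 0 ≤ s i) (hx : ∀ i, x i ≤ 1) (hy : ∀ i, y i ≤ 1)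
    (h : A * (w + q * ∑ i, s i * (1 - y i) ^ d) = 1)
    (h' : A' * (w + q * ∑ i, s i * (1 - x i) ^ d) = 1)
    (hxy : ∀ i, 0 < s i → x i ≤ y i) : ¬ A < A' := by
  intro hlt
  have hI : ∑ i, s i * (1 - y i) ^ d ≤ ∑ i, s i * (1 - x i) ^ d := by
    refine Finset.sum_le_sum fun i _ => ?_
    rcases (hs i).eq_or_lt with h0 | h0
    · rw [← h0, zero_mul, zero_mul]
    · have := hxy i h0
      have := hy i
      gcongr
  have hI0 : 0 ≤ ∑ i, s i * (1 - x i) ^ d := Finset.sum_nonneg fun i _ =>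
    mul_nonneg (hs i) (pow_nonneg (by linarith [hx i]) d)
  have h1 : A * (w + q * ∑ i, s i * (1 - y i) ^ d) ≤ A * (w + q * ∑ i, s i * (1 - x i) ^ d) := by
    gcongr
  have h2 : A * (w + q * ∑ i, s i * (1 - x i) ^ d) < A' * (w + q * ∑ i, s i * (1 - x i) ^ d) := by
    gcongr
  linarith

/-- Vector-valued `F` lets the same formula serve for the scalar moments of the two messages and for
`stat` itself. -/
theorem sum_two_valued {ι : Type*} [Fintype ι] {E : Type*} [AddCommGroup E] [Module ℝ E]
    {s x y : ι → ℝ} (hs : ∀ i, 0 ≤ s i) (hs1 : ∑ i, s i = 1) {a b : ℝ} (hab : a ≠ b)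
    (hval : ∀ i, 0 < s i → (x i = a ∧ y i = b) ∨ (x i = b ∧ y i = a)) (F : ℝ → ℝ → E) :
    ∑ i, s i • F (x i) (y i) = (∑ i, if x i = a then s i else 0) • F a b
      + (1 - ∑ i, if x i = a then s i else 0) • F b a := by
  have : (1 - ∑ i, if x i = a then s i else 0) = ∑ i, if x i = a then 0 else s i := by
    rw [← hs1, ← Finset.sum_sub_distrib]
    exact Finset.sum_congr rfl fun i _ => by split_ifs <;> simp
  rw [this, Finset.sum_smul, Finset.sum_smul, ← Finset.sum_add_distrib]
  refine Finset.sum_congr rfl fun i _ => ?_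
  rcases (hs i).eq_or_lt with h0 | h0
  · simp [← h0]
  · rcases hval i h0 with ⟨h1, h2⟩ | ⟨h1, h2⟩
    · simp [h1, h2]
    · simp [h1, h2, hab.symm]

/-- The gain of the mirror image (y, x) over an atom (x, y), with k, k' the d-th roots of A, A' and
`X`, `Y` standing for x^p, y^p. The gain is at most 0, so x^p − y^p and k' − k cannot have the same
strict sign. -/
theorem swap_identity {p N k k' x y X Y : ℝ} (hp : p ≠ 0) (hN : N ≠ 0) (hk : k ≠ 0) (hk' : k' ≠ 0) :
    (X - Y) * (k' - k) = p * N * k * k' *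
      ((-(y * x) / N + (k * y - Y / p) / (N * k) + (k' * x - X / p) / (N * k'))
        - (-(x * y) / N + (k * x - X / p) / (N * k) + (k' * y - Y / p) / (N * k'))) := by
  field_simp
  ring

/-- The gain of (x + ε, x − ε) over (x, x). The terms linear in ε cancel, and ε² is left to compete
with the convexity of the p-th power. -/
theorem spread_identity {p N k x ε X Y Z : ℝ} (hp : p ≠ 0) (hN : N ≠ 0) (hk : k ≠ 0) :
    ε ^ 2 - (Y + Z) / (p * k) - -(2 * X) / (p * k) = N *
      ((-((x + ε) * (x - ε)) / N + (k * (x + ε) - Y / p) / (N * k) + (k * (x - ε) - Z / p) / (N * k))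
        - (-(x * x) / N + (k * x - X / p) / (N * k) + (k * x - X / p) / (N * k))) := by
  field_simp
  ring

set_option maxHeartbeats 1000000 in
/-- A maximiser of the rate splits its mass evenly between two messages `(a, b)` and `(b, a)`. -/
theorem maximiser_structure (hd : 2 ≤ d) (hq : 0 < q) (hw : 0 < w) (hc : 0 < c) (hc1 : c < 1)
    (hqc : q * c < 1) (hwc : 1 / w < c) (h5 : 5 * (w + q) ≤ d)
    {ι : Type*} [Fintype ι] {s x y : ι → ℝ} (hs : ∀ i, 0 ≤ s i) (hs1 : ∑ i, s i = 1)
    (hx : ∀ i, x i ∈ Set.Icc 0 c) (hy : ∀ i, y i ∈ Set.Icc 0 c) {m : Fin 5 → ℝ}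
    (hm : ∑ i, s i • stat d (x i) (y i) = m) (hmax : IsMaxOn (rate d q w) (statHull d c) m) :
    ∃ A a b : ℝ, 0 < A ∧ 0 < b ∧ b < a ∧ a < 1 ∧ a = A * (1 - b) ^ d ∧ b = A * (1 - a) ^ d ∧
      A * w + q / 2 * (a + b) = 1 ∧
      (∀ i, 0 < s i → (x i = a ∧ y i = b) ∨ (x i = b ∧ y i = a)) ∧
      (∑ i, if x i = a then s i else 0) = 1 / 2 ∧
      m = (1 / 2 : ℝ) • stat d a b + (1 / 2 : ℝ) • stat d b a := by
  have hd0 : 0 < d := by omega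
  have hd' : (0 : ℝ) < d := by exact_mod_cast hd0
  have hp : (0 : ℝ) < ((d : ℝ) + 1) / d := by positivity
  have hatom := fun i hi ξ η hξ hη => isMaxOn_rateDeriv_of_atom hd0 hq hw hc hqc hc1.le hs hs1 hx hy
    hm hmax i hi (ξ := ξ) (η := η) hξ hη
  have hm0 : ∑ i, s i * x i = m 0 := by rw [← hm]; simp [stat]
  have hm1 : ∑ i, s i * y i = m 1 := by rw [← hm]; simp [stat]
  have hm2 : ∑ i, s i * (x i * y i) = m 2 := by rw [← hm]; simp [stat]
  have hm2' : ∑ i, s i * (y i * x i) = m 2 := by rw [← hm2]; simp [mul_comm]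
  have hm3 : ∑ i, s i * x i ^ (((d : ℝ) + 1) / d) = m 3 := by rw [← hm]; simp [stat]
  have hm4 : ∑ i, s i * y i ^ (((d : ℝ) + 1) / d) = m 4 := by rw [← hm]; simp [stat]
  obtain ⟨hU, hxe⟩ := euler_coordinate hd0 hq hw hc hc1 hqc hwc hs hs1 hx hy hm0 hm2 hm3
    fun i hi z hz => by
      have := hatom i hi z (y i) hz (hy i)
      simp only [rateDeriv, stat, Matrix.cons_val] at this
      linarith
  obtain ⟨hU', hye⟩ := euler_coordinate hd0 hq hw hc hc1 hqc hwc hs hs1 hy hx hm1 hm2' hm4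
    fun i hi z hz => by
      have := hatom i hi (x i) z (hx i) hz
      simp only [rateDeriv, stat, Matrix.cons_val, mul_comm (x i)] at this
      linarith
  have hmK : m ∈ statHull d c := by
    rw [← hm]
    exact (convex_convexHull ℝ _).sum_mem (fun i _ => hs i) hs1
      fun i _ => subset_convexHull ℝ _ ⟨(x i, y i), ⟨hx i, hy i⟩, rfl⟩
  obtain ⟨b0, b1, b2, b3, b4⟩ := statHull_mono_bounds hc hmK
  have hN : 0 < 1 - q * m 2 := by nlinarith
  have hA : 0 < (1 - q * m 0) / w := div_pos (by nlinarith) hw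
  have hA' : 0 < (1 - q * m 1) / w := div_pos (by nlinarith) hw
  set N := 1 - q * m 2
  set A := (1 - q * m 0) / w with hAdef
  set A' := (1 - q * m 1) / w with hA'def
  have hAw : A * w = 1 - q * m 0 := by rw [hAdef]; field_simp
  have hAw' : A' * w = 1 - q * m 1 := by rw [hA'def]; field_simp
  have hI : A * (w + q * ∑ i, s i * (1 - y i) ^ d) = 1 := by
    have : A * ∑ i, s i * (1 - y i) ^ d = m 0 := by
      rw [← hm0, Finset.mul_sum]
      refine Finset.sum_congr rfl fun i _ => ?_
      rcases (hs i).eq_or_lt with h0 | h0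
      · rw [← h0, zero_mul, zero_mul, mul_zero]
      · conv_rhs => rw [hxe i h0]
        ring
    linear_combination hAw + q * this
  have hI' : A' * (w + q * ∑ i, s i * (1 - x i) ^ d) = 1 := by
    have : A' * ∑ i, s i * (1 - x i) ^ d = m 1 := by
      rw [← hm1, Finset.mul_sum]
      refine Finset.sum_congr rfl fun i _ => ?_
      rcases (hs i).eq_or_lt with h0 | h0
      · rw [← h0, zero_mul, zero_mul, mul_zero]
      · conv_rhs => rw [hye i h0]
        ring
    linear_combination hAw' + q * this
  have hκ : 0 < A ^ ((1 : ℝ) / d) := Real.rpow_pos_of_pos hA _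
  have hκ' : 0 < A' ^ ((1 : ℝ) / d) := Real.rpow_pos_of_pos hA' _
  have hswap : ∀ i, 0 < s i → (x i ^ (((d : ℝ) + 1) / d) - y i ^ (((d : ℝ) + 1) / d)) *
      (A' ^ ((1 : ℝ) / d) - A ^ ((1 : ℝ) / d)) ≤ 0 := fun i hi => by
    have h1 := hatom i hi (y i) (x i) (hy i) (hx i)
    simp only [rateDeriv, stat, Matrix.cons_val] at h1
    rw [hU, hU'] at h1
    have h2 := swap_identity (x := x i) (y := y i) (X := x i ^ (((d : ℝ) + 1) / d))
      (Y := y i ^ (((d : ℝ) + 1) / d)) hp.ne' hN.ne' hκ.ne' hκ'.ne'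
    rw [h2]
    exact mul_nonpos_of_nonneg_of_nonpos (by positivity) (by linarith)
  have hle1 : ∀ i, x i ≤ 1 := fun i => (hx i).2.trans hc1.le
  have hle1' : ∀ i, y i ≤ 1 := fun i => (hy i).2.trans hc1.le
  -- If A < A', every atom has x ≤ y by the swap comparison, which contradicts the normalisation;
  -- the other case is symmetric.
  have hAA : A' = A := by
    rcases lt_trichotomy A A' with h | h | h
    · refine absurd h (not_lt_of_forall_le hq hw hA hs hle1 hle1' hI hI' fun i hi => ?_)
      have hk := Real.rpow_lt_rpow hA.le h (by positivity : (0 : ℝ) < 1 / d)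
      rw [← Real.rpow_le_rpow_iff (hx i).1 (hy i).1 hp]
      by_contra hcon
      have := mul_pos (sub_pos.2 (not_le.1 hcon)) (sub_pos.2 hk)
      linarith [hswap i hi]
    · exact h.symm
    · refine absurd h (not_lt_of_forall_le hq hw hA' hs hle1' hle1 hI' hI fun i hi => ?_)
      have hk := Real.rpow_lt_rpow hA'.le h (by positivity : (0 : ℝ) < 1 / d)
      rw [← Real.rpow_le_rpow_iff (hy i).1 (hx i).1 hp]
      by_contra hcon
      have := mul_pos (sub_pos.2 (not_le.1 hcon)) (sub_pos.2 hk)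
      linarith [hswap i hi]
  rw [hAA] at hye hI' hU'
  have hI1 : ∑ i, s i * (1 - y i) ^ d ≤ 1 := by
    rw [← hs1]
    refine Finset.sum_le_sum fun i _ => mul_le_of_le_one_right (hs i) ?_
    exact pow_le_one₀ (by linarith [hle1' i]) (by linarith [(hy i).1])
  -- The integral in the normalisation `hI` is at most 1, so A(w + q) ≥ 1, and d is at least 5(w +
  -- q).
  have hA5 : 5 ≤ d * A := by
    have h1 : 1 ≤ A * (w + q) := by
      rw [← hI]
      gcongr
      nlinarith
    calc (5 : ℝ) ≤ 5 * (A * (w + q)) := by linarith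
      _ = 5 * (w + q) * A := by ring
      _ ≤ d * A := by gcongr
  have hAlt : A < 1 := by
    rw [hAdef, div_lt_one hw]
    have : 1 < w := by
      rw [div_lt_iff₀ hw] at hwc
      nlinarith
    nlinarith [mul_nonneg hq.le b0.1]
  have hpos : ∀ i, 0 < s i → 0 < x i ∧ x i < 1 ∧ 0 < y i ∧ y i < 1 := fun i hi => by
    have h1 : x i < 1 := (hx i).2.trans_lt hc1
    have h2 : y i < 1 := (hy i).2.trans_lt hc1
    refine ⟨?_, h1, ?_, h2⟩
    · rw [hxe i hi]; exact mul_pos hA (pow_pos (by linarith) d)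
    · rw [hye i hi]; exact mul_pos hA (pow_pos (by linarith) d)
  have hne : ∀ i, 0 < s i → x i ≠ y i := fun i hi heq => by
    obtain ⟨h0, h1, -, -⟩ := hpos i hi
    -- The first message must have room to grow by ε inside the box; x ≤ A ≤ 1/w < c provides it.
    have hxc : x i < c := by
      refine lt_of_le_of_lt ?_ hwc
      rw [hxe i hi, hAdef, div_mul_eq_mul_div]
      gcongr
      have : (1 - y i) ^ d ≤ 1 := pow_le_one₀ (by linarith [hle1' i]) (by linarith [(hy i).1])
      have h2 : 0 ≤ (1 - y i) ^ d := pow_nonneg (by linarith [hle1' i]) d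
      have h3 : 0 ≤ q * m 0 := mul_nonneg hq.le b0.1
      have h4 : 0 < 1 - q * m 0 := by rw [← hAw]; positivity
      nlinarith
    refine not_diagonal_max hd hA hA5 h0 h1 (by conv_rhs => rw [heq, ← hxe i hi])
      (δ := min (x i / 2) (c - x i)) (lt_min (by linarith) (by linarith))
      (lt_of_le_of_lt (min_le_left _ _) (by linarith)) fun ε hε => ?_
    have hε1 := hε.2.trans (min_le_left _ _)
    have hε2 := hε.2.trans (min_le_right _ _)
    have h3 := hatom i hi (x i + ε) (x i - ε) ⟨by linarith [hε.1], by linarith⟩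
      ⟨by linarith, by linarith [hε.1, (hx i).2]⟩
    simp only [rateDeriv, stat, Matrix.cons_val] at h3
    rw [hU, hU', ← heq, ← hA'def, hAA] at h3
    have h4 := spread_identity (x := x i) (ε := ε) (X := x i ^ (((d : ℝ) + 1) / d))
      (Y := (x i + ε) ^ (((d : ℝ) + 1) / d)) (Z := (x i - ε) ^ (((d : ℝ) + 1) / d)) hp.ne' hN.ne'
      hκ.ne'
    have h6 := mul_nonpos_of_nonneg_of_nonpos hN.le (sub_nonpos.2 h3)
    rw [← h4] at h6
    linarith
  obtain ⟨i₀, hi₀⟩ : ∃ i, 0 < s i := by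
    by_contra hcon
    push Not at hcon
    have : ∑ i, s i ≤ 0 := Finset.sum_nonpos fun i _ => hcon i
    linarith
  obtain ⟨a, b, hb0, hba, ha1, hae, hbe⟩ : ∃ a b : ℝ, 0 < b ∧ b < a ∧ a < 1 ∧
      a = A * (1 - b) ^ d ∧ b = A * (1 - a) ^ d := by
    obtain ⟨h0, h1, h2, h3⟩ := hpos i₀ hi₀
    rcases lt_or_gt_of_ne (hne i₀ hi₀) with h | h
    · exact ⟨y i₀, x i₀, h0, h, h3, hye i₀ hi₀, hxe i₀ hi₀⟩
    · exact ⟨x i₀, y i₀, h2, h, h1, hxe i₀ hi₀, hye i₀ hi₀⟩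
  have ha : 0 < a ∧ a < 1 := ⟨hb0.trans hba, ha1⟩
  have hb : 0 < b ∧ b < 1 := ⟨hb0, hba.trans ha1⟩
  have hval : ∀ i, 0 < s i → (x i = a ∧ y i = b) ∨ (x i = b ∧ y i = a) := fun i hi => by
    obtain ⟨h0, h1, h2, h3⟩ := hpos i hi
    rcases lt_or_gt_of_ne (hne i hi) with h | h
    · exact Or.inr (twoCycle_unique hd hA hAlt ⟨h2, h3⟩ ⟨h0, h1⟩ ha hb (hye i hi) (hxe i hi) hae hbe
        h hba).symm
    · exact Or.inl (twoCycle_unique hd hA hAlt ⟨h0, h1⟩ ⟨h2, h3⟩ ha hb (hxe i hi) (hye i hi) hae hbe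
        h hba)
  -- With the same A on both sides the normalisations give equal averages of (1 − x)^d and (1 −
  -- y)^d. Since (1 − a)^d ≠ (1 − b)^d, the two atoms have equal mass.
  have hhalf : (∑ i, if x i = a then s i else 0) = 1 / 2 := by
    have e1 := sum_two_valued hs hs1 hba.ne' hval fun x _ => (1 - x) ^ d
    have e2 := sum_two_valued hs hs1 hba.ne' hval fun _ y => (1 - y) ^ d
    simp only [smul_eq_mul] at e1 e2
    have e3 : ∑ i, s i * (1 - x i) ^ d = ∑ i, s i * (1 - y i) ^ d := by
      have := hI.trans hI'.symm
      have h1 := mul_left_cancel₀ hA.ne' this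
      have h2 := mul_left_cancel₀ hq.ne' (add_left_cancel h1)
      exact h2.symm
    rw [e1, e2] at e3
    have hlt : (1 - a) ^ d < (1 - b) ^ d :=
      pow_lt_pow_left₀ (by linarith) (by linarith) (by omega)
    set S := ∑ i, if x i = a then s i else 0
    have h4 : (2 * S - 1) * ((1 - b) ^ d - (1 - a) ^ d) = 0 := by linear_combination -e3
    rcases mul_eq_zero.1 h4 with h | h
    · linarith
    · linarith
  have hmm : m = (1 / 2 : ℝ) • stat d a b + (1 / 2 : ℝ) • stat d b a := by
    rw [← hm, sum_two_valued hs hs1 hba.ne' hval (stat d), hhalf]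
    norm_num
  refine ⟨A, a, b, hA, hb0, hba, ha1, hae, hbe, ?_, hval, hhalf, hmm⟩
  have : m 0 = (a + b) / 2 := by
    rw [hmm]
    simp [stat]
    ring
  rw [hAw, this]
  ring

end Structure

end HypergraphColouring

namespace HypergraphColouring

/-! ### Fixpoints as points of the relaxed problem -/

section Fixpoints

/-- The total weight `t R₀ + ∑ Rᵢ` of a message vector. -/
noncomputable def totalWeight (q k d : ℕ) (R : Fin (q + 1) → ℝ) : ℝ :=
  tParam q k d * R 0 + ∑ i : Fin q, R i.succ

/-- The pairing `Rᵀ B C`. -/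
noncomputable def pairing (q k d : ℕ) (R C : Fin (q + 1) → ℝ) : ℝ :=
  ∑ i, R i * ∑ j, interaction q k d i j * C j

/-- The growth rate `Δ log (Rᵀ B C) - d log ∑ Rᵢ^p - d log ∑ Cⱼ^p` in terms of messages. -/
noncomputable def messageRate (q k d : ℕ) (R C : Fin (q + 1) → ℝ) : ℝ :=
  ((d : ℝ) + 1) * Real.log (pairing q k d R C)
    - d * Real.log (∑ i, R i ^ (((d : ℝ) + 1) / (d : ℝ)))
    - d * Real.log (∑ j, C j ^ (((d : ℝ) + 1) / (d : ℝ)))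

variable {q k d : ℕ}

/-- With w = q^k − q this says 1/w < 1/(2q), which leaves room for the box size c = 1/(2q). -/
theorem colour_weight_pos (hq : 4 ≤ q) (hk : 2 ≤ k) : (2 * q : ℝ) < (q : ℝ) ^ k - q := by
  have hq' : (4 : ℝ) ≤ q := by exact_mod_cast hq
  have h1 : (q : ℝ) ^ 2 ≤ (q : ℝ) ^ k := pow_le_pow_right₀ (by linarith) hk
  nlinarith

theorem tParam_pos (hq : 4 ≤ q) (hk : 2 ≤ k) : 0 < tParam q k d := by
  have := colour_weight_pos hq hk
  have hq' : (4 : ℝ) ≤ q := by exact_mod_cast hq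
  exact Real.rpow_pos_of_pos (by linarith) _

theorem tParam_pow (hq : 4 ≤ q) (hk : 2 ≤ k) : tParam q k d ^ (d + 1) = (q : ℝ) ^ k - q := by
  have := colour_weight_pos hq hk
  have hq' : (4 : ℝ) ≤ q := by exact_mod_cast hq
  have hd : ((d : ℝ) + 1) ≠ 0 := by positivity
  rw [tParam, ← Real.rpow_natCast, ← Real.rpow_mul (by linarith)]
  push_cast
  rw [one_div, inv_mul_cancel₀ hd, Real.rpow_one]

theorem sum_interaction_zero (C : Fin (q + 1) → ℝ) :
    ∑ j, interaction q k d 0 j * C j = tParam q k d * totalWeight q k d C := by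
  simp only [Fin.sum_univ_succ, interaction, totalWeight, if_true, Fin.succ_ne_zero, if_false,
    mul_add, Finset.mul_sum]
  ring

theorem sum_interaction_succ (C : Fin (q + 1) → ℝ) (i : Fin q) :
    ∑ j, interaction q k d i.succ j * C j = totalWeight q k d C - C i.succ := by
  simp only [Fin.sum_univ_succ, interaction, totalWeight, if_true, Fin.succ_ne_zero, if_false,
    Fin.succ_inj]
  have : ∀ j : Fin q, (if i = j then (0 : ℝ) else 1) * C j.succ
      = C j.succ - if i = j then C j.succ else 0 := fun j => by split_ifs <;> simp
  simp only [this, Finset.sum_sub_distrib, Finset.sum_ite_eq, Finset.mem_univ, if_true]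
  ring

/-- B is the rank-one matrix of (t, 1, …, 1) minus the identity on the ordinary colours. -/
theorem pairing_eq (R C : Fin (q + 1) → ℝ) :
    pairing q k d R C = totalWeight q k d R * totalWeight q k d C
      - ∑ i : Fin q, R i.succ * C i.succ := by
  rw [pairing, Fin.sum_univ_succ, sum_interaction_zero]
  simp only [sum_interaction_succ, mul_sub, Finset.sum_sub_distrib, ← Finset.sum_mul]
  rw [totalWeight.eq_def q k d R]
  ring

theorem isPosFixpoint_iff {R C : Fin (q + 1) → ℝ} : IsPosFixpoint q k d R C ↔
    (∀ i, 0 < R i) ∧ (∀ i, 0 < C i) ∧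
    (∃ A : ℝ, R 0 = A * (tParam q k d ^ d * totalWeight q k d C ^ d) ∧
      ∀ i : Fin q, R i.succ = A * (totalWeight q k d C - C i.succ) ^ d) ∧
    (∃ A : ℝ, C 0 = A * (tParam q k d ^ d * totalWeight q k d R ^ d) ∧
      ∀ i : Fin q, C i.succ = A * (totalWeight q k d R - R i.succ) ^ d) := by
  have e : ∀ (C : Fin (q + 1) → ℝ) (i : Fin q), tParam q k d * C 0
      + ∑ j ∈ Finset.univ.erase i, C j.succ = totalWeight q k d C - C i.succ := fun C i => by
    rw [Finset.sum_erase_eq_sub (Finset.mem_univ i), totalWeight]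
    ring
  constructor
  · rintro ⟨h1, h2, ⟨A, h3, h4⟩, A', h5, h6⟩
    simp only [e] at h4 h6
    exact ⟨h1, h2, ⟨A, h3, h4⟩, A', h5, h6⟩
  · rintro ⟨h1, h2, ⟨A, h3, h4⟩, A', h5, h6⟩
    refine ⟨h1, h2, ⟨A, h3, ?_⟩, A', h5, ?_⟩
    · simpa only [e] using h4
    · simpa only [e] using h6

theorem totalWeight_pos (hq : 4 ≤ q) (hk : 2 ≤ k) {R : Fin (q + 1) → ℝ} (hR : ∀ i, 0 < R i) :
    0 < totalWeight q k d R :=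
  add_pos_of_pos_of_nonneg (mul_pos (tParam_pos hq hk) (hR 0))
    (Finset.sum_nonneg fun _ _ => (hR _).le)

/-- An ordinary message is at most Aχ^d, where χ is the total weight of C, while the special colour
contributes t R₀ = A t^(d+1) χ^d = (q^k − q) A χ^d to the total weight of R. -/
theorem message_le (hq : 4 ≤ q) (hk : 2 ≤ k) {R C : Fin (q + 1) → ℝ} (hR : ∀ i, 0 < R i)
    (hC : ∀ i, 0 < C i)
    (h : ∃ A : ℝ, R 0 = A * (tParam q k d ^ d * totalWeight q k d C ^ d) ∧
      ∀ i : Fin q, R i.succ = A * (totalWeight q k d C - C i.succ) ^ d) (i : Fin q) :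
    R i.succ / totalWeight q k d R ≤ 1 / ((q : ℝ) ^ k - q) := by
  obtain ⟨A, h0, h1⟩ := h
  have ht := tParam_pos (d := d) hq hk
  have hρ := totalWeight_pos (d := d) hq hk hR
  have hχ := totalWeight_pos (d := d) hq hk hC
  have hw := colour_weight_pos hq hk
  have hw0 : (0 : ℝ) < (q : ℝ) ^ k - q := lt_of_le_of_lt (by positivity) hw
  have hA : 0 < A := by
    have h2 := hR 0
    rw [h0] at h2
    exact (pos_iff_pos_of_mul_pos h2).2 (by positivity)
  have hCi : C i.succ ≤ totalWeight q k d C := by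
    rw [totalWeight]
    have h3 : C i.succ ≤ ∑ j : Fin q, C j.succ :=
      Finset.single_le_sum (f := fun j : Fin q => C j.succ) (fun j _ => (hC _).le)
        (Finset.mem_univ i)
    have := mul_pos ht (hC 0)
    linarith
  have h4 : R i.succ ≤ A * totalWeight q k d C ^ d := by
    rw [h1]
    have := hC i.succ
    gcongr
    linarith
  have h5 : A * totalWeight q k d C ^ d * ((q : ℝ) ^ k - q) ≤ totalWeight q k d R := by
    have h6 : tParam q k d * R 0 ≤ totalWeight q k d R := by
      rw [totalWeight]
      have : 0 ≤ ∑ j : Fin q, R j.succ := Finset.sum_nonneg fun j _ => (hR _).le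
      linarith
    refine le_trans (le_of_eq ?_) h6
    rw [h0, ← tParam_pow hq hk (d := d)]
    ring
  rw [div_le_div_iff₀ hρ hw0, one_mul]
  calc R i.succ * ((q : ℝ) ^ k - q) ≤ A * totalWeight q k d C ^ d * ((q : ℝ) ^ k - q) := by gcongr
    _ ≤ _ := h5

/-- With ρ the total weight and w = q^k − q = t^(d+1), R₀ is t^d ρ times (1 − qX)/w. Since (t^d)^p =
t^(d+1) = w, the special colour acts like total mass w carrying the message (1 − qX)/w. -/
theorem sum_rpow_eq_normPow (hd : 0 < d) (hq : 4 ≤ q) (hk : 2 ≤ k) {R : Fin (q + 1) → ℝ}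
    (hR : ∀ i, 0 < R i) {X P : ℝ} (hX : q * X = ∑ i : Fin q, R i.succ / totalWeight q k d R)
    (hP : q * P = ∑ i : Fin q, (R i.succ / totalWeight q k d R) ^ (((d : ℝ) + 1) / (d : ℝ))) :
    ∑ i, R i ^ (((d : ℝ) + 1) / (d : ℝ)) = totalWeight q k d R ^ (((d : ℝ) + 1) / (d : ℝ))
      * normPow d q ((q : ℝ) ^ k - q) X P := by
  have hd' : (0 : ℝ) < d := by exact_mod_cast hd
  have ht := tParam_pos (d := d) hq hk
  have hρ := totalWeight_pos (d := d) hq hk hR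
  have hw0 : (0 : ℝ) < (q : ℝ) ^ k - q := lt_of_le_of_lt (by positivity) (colour_weight_pos hq hk)
  have h1X : 1 - q * X = tParam q k d * R 0 / totalWeight q k d R := by
    rw [hX, ← Finset.sum_div, eq_div_iff hρ.ne', sub_mul, div_mul_cancel₀ _ hρ.ne', one_mul]
    rw [totalWeight]
    ring
  rw [normPow, mul_add, hP, Finset.mul_sum, Fin.sum_univ_succ]
  congr 1
  · have h2 : (1 - q * X) / ((q : ℝ) ^ k - q) = R 0 / (tParam q k d ^ d * totalWeight q k d R) := by
      rw [h1X, ← tParam_pow hq hk (d := d), pow_succ]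
      field_simp
    rw [h2, Real.div_rpow (hR 0).le (by positivity), Real.mul_rpow (by positivity) hρ.le,
      ← Real.rpow_natCast (tParam q k d) d, ← Real.rpow_mul ht.le]
    have h3 : (d : ℝ) * (((d : ℝ) + 1) / d) = ((d + 1 : ℕ) : ℝ) := by
      push_cast; field_simp
    rw [h3, Real.rpow_natCast, tParam_pow hq hk]
    have : totalWeight q k d R ^ (((d : ℝ) + 1) / (d : ℝ)) ≠ 0 :=
      (Real.rpow_pos_of_pos hρ _).ne'
    field_simp
  · refine Finset.sum_congr rfl fun i _ => ?_
    rw [Real.div_rpow (hR _).le hρ.le, mul_div_cancel₀]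
    exact (Real.rpow_pos_of_pos hρ _).ne'

/-- The average of `stat` over the colours, for normalised messages. -/
noncomputable def messageStat (q k d : ℕ) (R C : Fin (q + 1) → ℝ) : Fin 5 → ℝ :=
  ∑ i : Fin q, (1 / (q : ℝ)) •
    stat d (R i.succ / totalWeight q k d R) (C i.succ / totalWeight q k d C)

/-- The scales of R and C drop out, since each total weight enters with exponent (d + 1) − d p = 0.
-/
theorem messageRate_eq (hd : 0 < d) (hq : 4 ≤ q) (hk : 2 ≤ k) {R C : Fin (q + 1) → ℝ}
    (hR : ∀ i, 0 < R i) (hC : ∀ i, 0 < C i) :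
    messageRate q k d R C = rate d q ((q : ℝ) ^ k - q) (messageStat q k d R C) := by
  have hd' : (0 : ℝ) < d := by exact_mod_cast hd
  have hq' : (4 : ℝ) ≤ q := by exact_mod_cast hq
  have hq0 : (q : ℝ) ≠ 0 := by linarith
  have hρ := totalWeight_pos (d := d) hq hk hR
  have hχ := totalWeight_pos (d := d) hq hk hC
  set ρ := totalWeight q k d R with hρd
  set χ := totalWeight q k d C with hχd
  set m := messageStat q k d R C with hm
  have hmj : ∀ j, q * m j = ∑ i : Fin q, stat d (R i.succ / ρ) (C i.succ / χ) j := fun j => by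
    rw [hm, messageStat, Finset.sum_apply, Finset.mul_sum]
    refine Finset.sum_congr rfl fun i _ => ?_
    rw [Pi.smul_apply, smul_eq_mul, ← mul_assoc, mul_one_div_cancel hq0, one_mul]
  have m0 : q * m 0 = ∑ i : Fin q, R i.succ / ρ := hmj 0
  have m1 : q * m 1 = ∑ i : Fin q, C i.succ / χ := hmj 1
  have m2 : q * m 2 = ∑ i : Fin q, R i.succ / ρ * (C i.succ / χ) := hmj 2
  have m3 : q * m 3 = ∑ i : Fin q, (R i.succ / ρ) ^ (((d : ℝ) + 1) / (d : ℝ)) := hmj 3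
  have m4 : q * m 4 = ∑ i : Fin q, (C i.succ / χ) ^ (((d : ℝ) + 1) / (d : ℝ)) := hmj 4
  have hpair : pairing q k d R C = ρ * χ * (1 - q * m 2) := by
    rw [pairing_eq, m2, mul_sub, mul_one, Finset.mul_sum]
    congr 1
    refine Finset.sum_congr rfl fun i _ => ?_
    field_simp
  have hpos : 0 < pairing q k d R C := by
    have h1 : ∀ i, 0 < ∑ j, interaction q k d i j * C j → 0 < R i * ∑ j, interaction q k d i j * C j :=
      fun i h => mul_pos (hR i) h
    rw [pairing]
    refine Finset.sum_pos' (fun i _ => mul_nonneg (hR i).le (Finset.sum_nonneg fun j _ =>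
      mul_nonneg ?_ (hC j).le)) ⟨0, Finset.mem_univ _, h1 0 ?_⟩
    · have := (tParam_pos (d := d) hq hk).le
      unfold interaction
      split_ifs <;> positivity
    · rw [sum_interaction_zero]
      exact mul_pos (tParam_pos hq hk) hχ
  have hN : 0 < 1 - q * m 2 := by
    rw [hpair] at hpos
    exact (pos_iff_pos_of_mul_pos hpos).1 (by positivity)
  have hSR := sum_rpow_eq_normPow hd hq hk hR m0 m3
  have hSC := sum_rpow_eq_normPow hd hq hk hC m1 m4
  have hSR0 : 0 < ∑ i, R i ^ (((d : ℝ) + 1) / (d : ℝ)) :=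
    Finset.sum_pos (fun i _ => Real.rpow_pos_of_pos (hR i) _) ⟨0, Finset.mem_univ _⟩
  have hSC0 : 0 < ∑ i, C i ^ (((d : ℝ) + 1) / (d : ℝ)) :=
    Finset.sum_pos (fun i _ => Real.rpow_pos_of_pos (hC i) _) ⟨0, Finset.mem_univ _⟩
  rw [hSR] at hSR0
  rw [hSC] at hSC0
  have hρp := Real.rpow_pos_of_pos hρ (((d : ℝ) + 1) / (d : ℝ))
  have hχp := Real.rpow_pos_of_pos hχ (((d : ℝ) + 1) / (d : ℝ))
  have hU := (pos_iff_pos_of_mul_pos hSR0).1 hρp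
  have hU' := (pos_iff_pos_of_mul_pos hSC0).1 hχp
  rw [messageRate, rate, hSR, hSC, hpair, Real.log_mul (by positivity) hN.ne',
    Real.log_mul hρ.ne' hχ.ne', Real.log_mul hρp.ne' hU.ne', Real.log_mul hχp.ne' hU'.ne',
    Real.log_rpow hρ, Real.log_rpow hχ]
  field_simp
  ring

theorem hasType_of_two_values {R : Fin (q + 1) → ℝ} {a b : ℝ} {n : ℕ} (hn : 0 < n) (hab : a ≠ b)
    (hval : ∀ i : Fin q, R i.succ = a ∨ R i.succ = b)
    (ha : (Finset.univ.filter fun i : Fin q => R i.succ = a).card = n)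
    (hb : (Finset.univ.filter fun i : Fin q => R i.succ = b).card = n) : HasType R n n 0 := by
  have himg : (Finset.univ.image fun i : Fin q => R i.succ) = {a, b} := by
    ext v
    simp only [Finset.mem_image, Finset.mem_univ, true_and, Finset.mem_insert,
      Finset.mem_singleton]
    constructor
    · rintro ⟨i, rfl⟩
      exact hval i
    · rintro (rfl | rfl)
      · obtain ⟨i, hi⟩ := Finset.card_pos.1 (ha ▸ hn)
        exact ⟨i, (Finset.mem_filter.1 hi).2⟩
      · obtain ⟨i, hi⟩ := Finset.card_pos.1 (hb ▸ hn)
        exact ⟨i, (Finset.mem_filter.1 hi).2⟩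
  rw [HasType, himg, Finset.insert_val_of_notMem (by simpa using hab)]
  simp [ha, hb, hn.ne']

/-- Among the positive fixpoints, `messageRate` is maximised at one of type `(q/2, q/2, 0)`, and
only at fixpoints of that type. -/
theorem exists_fixpoint_max_messageRate (hq : 4 ≤ q) (hq_even : Even q) (hk : 2 ≤ k)
    (hd : d = 5 * q ^ k) :
    ∃ R C : Fin (q + 1) → ℝ, IsPosFixpoint q k d R C ∧ HasType R (q / 2) (q / 2) 0 ∧
      ∀ R' C' : Fin (q + 1) → ℝ, IsPosFixpoint q k d R' C' →
        messageRate q k d R' C' ≤ messageRate q k d R C ∧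
        (messageRate q k d R' C' = messageRate q k d R C → HasType R' (q / 2) (q / 2) 0) := by
  have hq' : (4 : ℝ) ≤ q := by exact_mod_cast hq
  have hq0 : (0 : ℝ) < q := by linarith
  have hw := colour_weight_pos hq hk
  set w : ℝ := (q : ℝ) ^ k - q with hwdef
  have hw0 : 0 < w := by linarith
  have hd2 : 2 ≤ d := by
    have : 1 ≤ q ^ k := Nat.one_le_pow _ _ (by omega)
    omega
  have hd0 : 0 < d := by omega
  -- This is an equality: w + q = q^k.
  have hdR : 5 * (w + q) ≤ (d : ℝ) := by
    rw [hd, hwdef]; push_cast; linarith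
  -- Any value strictly between 1/w, which bounds the messages, and 1/q, which keeps 1 − qX
  -- positive, would do.
  set c : ℝ := 1 / (2 * q) with hc
  have hc0 : 0 < c := by positivity
  have hc1 : c < 1 := by rw [hc, div_lt_one (by positivity)]; linarith
  have hqc : (q : ℝ) * c < 1 := by
    have : (q : ℝ) * c = 1 / 2 := by rw [hc]; field_simp
    rw [this]; norm_num
  have hwc : 1 / w < c := by
    rw [hc]; exact one_div_lt_one_div_of_lt (by positivity) hw
  obtain ⟨h, hh⟩ := hq_even
  have hh2 : q / 2 = h := by omega
  have hh0 : 0 < h := by omega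
  have hqh : (q : ℝ) = 2 * h := by rw [hh]; push_cast; ring
  obtain ⟨m, hm, hmax⟩ := exists_isMaxOn_rate (d := d) hq0 hw0 hc0 hqc hc1.le
  obtain ⟨ι, _, s, z, hs, hs1, hz, hsum⟩ := mem_convexHull_iff_exists_fintype.1 hm
  choose u hu huz using hz
  obtain ⟨A, a, b, hA, hb0, hba, ha1, hae, hbe, htot, -, -, hmab⟩ :=
    maximiser_structure (x := fun i => (u i).1) (y := fun i => (u i).2) hd2 hq0 hw0 hc0 hc1 hqc hwc
      hdR hs hs1 (fun i => (hu i).1) (fun i => (hu i).2) (by rw [← hsum]; simp only [huz]) hmax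
  have ht := tParam_pos (d := d) hq hk
  have ha0 := hb0.trans hba
  -- The relaxed maximiser made discrete: half of the colours carry (a, b), the other half (b, a).
  -- The value at colour 0 makes its weighted contribution A w, so that both total weights are 1.
  set R : Fin (q + 1) → ℝ := Fin.cons (A * tParam q k d ^ d)
    fun i : Fin q => if i.val < h then a else b with hR
  set C : Fin (q + 1) → ℝ := Fin.cons (A * tParam q k d ^ d)
    fun i : Fin q => if i.val < h then b else a with hC
  have hcard : (Finset.univ.filter fun i : Fin q => i.val < h).card = h := by
    rw [Fin.card_filter_val_lt]; omega
  have hcard' : (Finset.univ.filter fun i : Fin q => ¬ i.val < h).card = h := by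
    have := Finset.card_filter_add_card_filter_not (s := (Finset.univ : Finset (Fin q)))
      (fun i : Fin q => i.val < h)
    rw [hcard, Finset.card_univ, Fintype.card_fin] at this
    omega
  have hsumite : ∀ {E : Type} [AddCommGroup E] [Module ℝ E] (x y : E),
      ∑ i : Fin q, (if i.val < h then x else y) = (h : ℝ) • x + (h : ℝ) • y := by
    intro E _ _ x y
    rw [Finset.sum_ite, Finset.sum_const, Finset.sum_const, hcard, hcard', Nat.cast_smul_eq_nsmul,
      Nat.cast_smul_eq_nsmul]
  have htw : (A * tParam q k d ^ d) * tParam q k d = A * w := by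
    rw [hwdef, ← tParam_pow hq hk (d := d)]; ring
  have hRtot : totalWeight q k d R = 1 := by
    simp only [totalWeight, hR, Fin.cons_zero, Fin.cons_succ, hsumite, smul_eq_mul]
    rw [← htot, hqh]
    linear_combination htw
  have hCtot : totalWeight q k d C = 1 := by
    simp only [totalWeight, hC, Fin.cons_zero, Fin.cons_succ, hsumite, smul_eq_mul]
    rw [← htot, hqh]
    linear_combination htw
  have hRpos : ∀ i, 0 < R i := fun i => by
    refine Fin.cases ?_ (fun i => ?_) i
    · simp only [hR, Fin.cons_zero]; positivity
    · simp only [hR, Fin.cons_succ]; split_ifs <;> assumption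
  have hCpos : ∀ i, 0 < C i := fun i => by
    refine Fin.cases ?_ (fun i => ?_) i
    · simp only [hC, Fin.cons_zero]; positivity
    · simp only [hC, Fin.cons_succ]; split_ifs <;> assumption
  have hfix : IsPosFixpoint q k d R C := by
    rw [isPosFixpoint_iff, hRtot, hCtot]
    refine ⟨hRpos, hCpos, ⟨A, by simp [hR], fun i => ?_⟩, A, by simp [hC], fun i => ?_⟩
    · simp only [hR, hC, Fin.cons_succ]; split_ifs <;> assumption
    · simp only [hR, hC, Fin.cons_succ]; split_ifs <;> assumption
  have hstat : messageStat q k d R C = m := by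
    rw [messageStat, hmab, hRtot, hCtot]
    have : ∀ i : Fin q, (1 / (q : ℝ)) • stat d (R i.succ / 1) (C i.succ / 1)
        = if i.val < h then (1 / (q : ℝ)) • stat d a b else (1 / (q : ℝ)) • stat d b a := fun i => by
      simp only [hR, hC, Fin.cons_succ, div_one]; split_ifs <;> rfl
    simp only [this]
    rw [hsumite, smul_smul, smul_smul]
    have h3 : (h : ℝ) * (1 / q) = 1 / 2 := by
      rw [hqh]
      have : (h : ℝ) ≠ 0 := by exact_mod_cast hh0.ne'
      field_simp
    rw [h3]
  refine ⟨R, C, hfix, ?_, fun R' C' hfix' => ?_⟩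
  · rw [hh2]
    refine hasType_of_two_values hh0 hba.ne' (fun i => ?_) ?_ ?_
    · simp only [hR, Fin.cons_succ]; split_ifs <;> simp
    · rw [← hcard]
      congr 1
      ext i
      simp only [hR, Fin.cons_succ, Finset.mem_filter, Finset.mem_univ, true_and]
      split_ifs with h1 <;> simp [h1, hba.ne]
    · rw [← hcard']
      congr 1
      ext i
      simp only [hR, Fin.cons_succ, Finset.mem_filter, Finset.mem_univ, true_and]
      split_ifs with h1 <;> simp [h1, hba.ne']
  · obtain ⟨hR', hC', hRe, hCe⟩ := isPosFixpoint_iff.1 hfix'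
    have hρ := totalWeight_pos (d := d) hq hk hR'
    have hχ := totalWeight_pos (d := d) hq hk hC'
    set x : Fin q → ℝ := fun i => R' i.succ / totalWeight q k d R' with hx
    set y : Fin q → ℝ := fun i => C' i.succ / totalWeight q k d C' with hy
    have hxI : ∀ i, x i ∈ Set.Icc 0 c := fun i =>
      ⟨(div_pos (hR' _) hρ).le, (message_le hq hk hR' hC' hRe i).trans hwc.le⟩
    have hyI : ∀ i, y i ∈ Set.Icc 0 c := fun i =>
      ⟨(div_pos (hC' _) hχ).le, (message_le hq hk hC' hR' hCe i).trans hwc.le⟩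
    have hone : ∑ _i : Fin q, (1 / (q : ℝ)) = 1 := by
      rw [Finset.sum_const, Finset.card_univ, Fintype.card_fin, nsmul_eq_mul]
      field_simp
    have hmem : messageStat q k d R' C' ∈ statHull d c :=
      (convex_convexHull ℝ _).sum_mem (fun i _ => by positivity) hone
        fun i _ => subset_convexHull ℝ _ ⟨(x i, y i), ⟨hxI i, hyI i⟩, rfl⟩
    rw [messageRate_eq hd0 hq hk hR' hC', messageRate_eq hd0 hq hk hRpos hCpos, hstat]
    refine ⟨hmax hmem, fun heq => ?_⟩
    -- Equality of the values makes this fixpoint a relaxed maximiser, with mass 1/q at each colour,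
    -- so the structure theorem applies to it.
    have hmax' : IsMaxOn (rate d q w) (statHull d c) (messageStat q k d R' C') := fun v hv => by
      have := hmax hv
      simp only [Set.mem_ofPred_eq] at this ⊢
      rwa [heq]
    obtain ⟨A₁, a₁, b₁, -, -, hba₁, -, -, -, -, hval, hhalf, -⟩ :=
      maximiser_structure (s := fun _ : Fin q => 1 / (q : ℝ)) hd2 hq0 hw0 hc0 hc1 hqc hwc hdR
        (fun i => by positivity) hone hxI hyI rfl hmax'
    have hval' : ∀ i, x i = a₁ ∨ x i = b₁ := fun i =>
      (hval i (by positivity)).imp And.left And.left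
    have hx_iff : ∀ i v, R' i.succ = v * totalWeight q k d R' ↔ x i = v := fun i v => by
      rw [hx]; exact (div_eq_iff hρ.ne').symm
    have hca : (Finset.univ.filter fun i : Fin q => x i = a₁).card = h := by
      rw [Finset.sum_ite, Finset.sum_const_zero, add_zero, Finset.sum_const, nsmul_eq_mul] at hhalf
      have h3 : ((Finset.univ.filter fun i : Fin q => x i = a₁).card : ℝ) = h := by
        rw [hqh] at hhalf hq0
        field_simp at hhalf
        linarith
      exact_mod_cast h3
    have hcb : (Finset.univ.filter fun i : Fin q => x i = b₁).card = h := by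
      have h3 := Finset.card_filter_add_card_filter_not (s := (Finset.univ : Finset (Fin q)))
        (fun i : Fin q => x i = a₁)
      rw [hca, Finset.card_univ, Fintype.card_fin] at h3
      have h4 : (Finset.univ.filter fun i : Fin q => ¬ x i = a₁)
          = Finset.univ.filter fun i : Fin q => x i = b₁ := by
        ext i
        simp only [Finset.mem_filter, Finset.mem_univ, true_and]
        constructor
        · exact fun h5 => (hval' i).resolve_left h5
        · intro h5 h6
          exact hba₁.ne (h5.symm.trans h6)
      rw [h4] at h3
      omega
    rw [hh2]
    refine hasType_of_two_values (a := a₁ * totalWeight q k d R') (b := b₁ * totalWeight q k d R')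
      hh0 (fun h3 => hba₁.ne' (mul_right_cancel₀ hρ.ne' h3)) (fun i => ?_) ?_ ?_
    · simpa only [hx_iff] using hval' i
    · simpa only [hx_iff] using hca
    · simpa only [hx_iff] using hcb

end Fixpoints

end HypergraphColouring

namespace HypergraphColouring

/-! ### Functions with prescribed fibre sizes -/

section Counting

variable {E κ : Type*} [Fintype E] [DecidableEq E] [Fintype κ] [DecidableEq κ]

/-- The functions whose fibre over `j` has `m j` elements. -/
def functionsWithCounts (E : Type*) [Fintype E] [DecidableEq E] {κ : Type*} [Fintype κ]
    [DecidableEq κ] (m : κ → ℕ) : Finset (E → κ) :=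
  Finset.univ.filter fun c => ∀ j, (Finset.univ.filter fun e => c e = j).card = m j

theorem mem_functionsWithCounts {m : κ → ℕ} {c : E → κ} :
    c ∈ functionsWithCounts E m ↔ ∀ j, (Finset.univ.filter fun e => c e = j).card = m j := by
  simp [functionsWithCounts]

theorem exists_perm_comp_eq {m : κ → ℕ} {c c' : E → κ} (hc : c ∈ functionsWithCounts E m)
    (hc' : c' ∈ functionsWithCounts E m) : ∃ π : Equiv.Perm E, c ∘ π = c' := by
  rw [mem_functionsWithCounts] at hc hc'
  have e : ∀ j, Nonempty ({x // c' x = j} ≃ {x // c x = j}) := fun j => by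
    refine ⟨Fintype.equivOfCardEq ?_⟩
    rw [Fintype.card_subtype, Fintype.card_subtype, hc, hc']
  exact ⟨Equiv.ofFiberEquiv fun j => (e j).some, funext fun x => Equiv.ofFiberEquiv_map _ x⟩

theorem comp_perm_mem_functionsWithCounts {m : κ → ℕ} {c : E → κ} (π : Equiv.Perm E) :
    c ∘ π ∈ functionsWithCounts E m ↔ c ∈ functionsWithCounts E m := by
  simp only [mem_functionsWithCounts]
  refine forall_congr' fun j => ?_
  have : (Finset.univ.filter fun e => (c ∘ π) e = j).card
      = (Finset.univ.filter fun e => c e = j).card := by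
    refine Finset.card_bij (fun e _ => π e) ?_ ?_ ?_
    · simp
    · intro a _ b _ h; exact π.injective h
    · intro b hb; exact ⟨π.symm b, by simpa using hb, by simp⟩
  rw [this]

/-- The permutations taking `c` to `c'` form a coset of the stabiliser of `c`, which permutes each
fibre separately. -/
theorem card_perm_comp_eq {m : κ → ℕ} {c c' : E → κ} (hc : c ∈ functionsWithCounts E m)
    (hc' : c' ∈ functionsWithCounts E m) :
    (Finset.univ.filter fun π : Equiv.Perm E => c ∘ π = c').card = ∏ j, (m j).factorial := by
  obtain ⟨π₀, rfl⟩ := exists_perm_comp_eq hc hc'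
  have hstab := DomMulAct.stabilizer_card c
  rw [Fintype.card_subtype] at hstab
  have : ∏ j, (Fintype.card {e // c e = j}).factorial = ∏ j, (m j).factorial := by
    refine Finset.prod_congr rfl fun j _ => ?_
    rw [Fintype.card_subtype, mem_functionsWithCounts.1 hc]
  rw [← this, ← hstab]
  refine Finset.card_bij (fun π _ => π₀.symm.trans π) ?_ ?_ ?_
  · intro π hπ
    simp only [Finset.mem_filter, Finset.mem_univ, true_and] at hπ ⊢
    funext e
    have := congrFun hπ (π₀.symm e)
    simpa using this
  · intro a _ b _ h
    ext e
    have := congrArg (fun g : Equiv.Perm E => g (π₀ e)) h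
    simpa using this
  · intro g hg
    simp only [Finset.mem_filter, Finset.mem_univ, true_and] at hg
    refine ⟨π₀.trans g, ?_, ?_⟩
    · simp only [Finset.mem_filter, Finset.mem_univ, true_and]
      funext e
      exact congrFun hg (π₀ e)
    · ext e; simp

/-- Summing over all rearrangements of `c` counts every function with the same fibre sizes
`∏ j, (m j)!` times. -/
theorem sum_perm_comp {m : κ → ℕ} {c : E → κ} (hc : c ∈ functionsWithCounts E m)
    (Φ : (E → κ) → ℝ) :
    ∑ π : Equiv.Perm E, Φ (c ∘ π) =
      (∏ j, ((m j).factorial : ℝ)) * ∑ c' ∈ functionsWithCounts E m, Φ c' := by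
  rw [← Finset.sum_fiberwise_of_maps_to (s := Finset.univ) (t := functionsWithCounts E m)
    (g := fun π : Equiv.Perm E => c ∘ π)
    (fun π _ => (comp_perm_mem_functionsWithCounts π).2 hc), Finset.mul_sum]
  refine Finset.sum_congr rfl fun c' hc' => ?_
  rw [Finset.sum_congr rfl (g := fun _ => Φ c') fun π hπ => by
    rw [(Finset.mem_filter.1 hπ).2], Finset.sum_const, card_perm_comp_eq hc hc', nsmul_eq_mul]
  push_cast
  rfl

theorem functionsWithCounts_nonempty {m : κ → ℕ} (hm : ∑ j, m j = Fintype.card E) :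
    (functionsWithCounts E m).Nonempty := by
  have hcard : Fintype.card E = Fintype.card (Σ j, Fin (m j)) := by
    rw [Fintype.card_sigma]
    simp [hm]
  let e := Fintype.equivOfCardEq hcard
  refine ⟨fun x => (e x).1, mem_functionsWithCounts.2 fun j => ?_⟩
  have : (Finset.univ.filter fun x => (e x).1 = j).card
      = (Finset.univ : Finset (Fin (m j))).card := by
    symm
    refine Finset.card_bij (fun i _ => e.symm ⟨j, i⟩) ?_ ?_ ?_
    · simp
    · intro a _ b _ h
      simpa using h
    · intro x hx
      simp only [Finset.mem_filter, Finset.mem_univ, true_and] at hx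
      refine ⟨hx ▸ (e x).2, Finset.mem_univ _, ?_⟩
      rw [Equiv.symm_apply_eq]
      subst hx
      rfl
  rw [this, Finset.card_univ, Fintype.card_fin]

theorem card_functionsWithCounts {m : κ → ℕ} (hm : ∑ j, m j = Fintype.card E) :
    ((functionsWithCounts E m).card : ℝ) * ∏ j, ((m j).factorial : ℝ)
      = (Fintype.card E).factorial := by
  obtain ⟨c, hc⟩ := functionsWithCounts_nonempty hm
  have := sum_perm_comp hc fun _ => (1 : ℝ)
  simp only [Finset.sum_const, nsmul_eq_mul, mul_one, Finset.card_univ, Fintype.card_perm] at this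
  rw [this, mul_comm]

end Counting

/-! ### Bounds on sums over colourings of half-edges -/

section PairSums

variable {E I J : Type*} [Fintype E] [DecidableEq E] [Fintype J] [DecidableEq J]

/-- The total weight of the right colourings with fibre sizes `b`, for a given left colouring. -/
noncomputable def pairSum (B : I → J → ℝ) (b : J → ℕ) (s : E → I) : ℝ :=
  ∑ c ∈ functionsWithCounts E b, ∏ e, B (s e) (c e)

/-- As the sum runs over all rearrangements of the right colouring, only the fibre sizes of `s`
matter. -/
theorem pairSum_comp_perm (B : I → J → ℝ) (b : J → ℕ) (s : E → I) (π : Equiv.Perm E) :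
    pairSum B b (s ∘ π) = pairSum B b s := by
  unfold pairSum
  refine Finset.sum_bij (fun c _ => c ∘ π.symm) ?_ ?_ ?_ ?_
  · intro c hc; exact (comp_perm_mem_functionsWithCounts _).2 hc
  · intro a _ b _ h
    funext e
    simpa using congrFun h (π e)
  · intro c hc
    exact ⟨c ∘ π, (comp_perm_mem_functionsWithCounts _).2 hc, by funext e; simp⟩
  · intro c _
    refine Fintype.prod_equiv π _ _ fun e => ?_
    simp

theorem pairSum_nonneg {B : I → J → ℝ} (hB : ∀ i j, 0 ≤ B i j) (b : J → ℕ) (s : E → I) :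
    0 ≤ pairSum B b s :=
  Finset.sum_nonneg fun _ _ => Finset.prod_nonneg fun _ _ => hB _ _

variable [Fintype I] [DecidableEq I]

theorem prod_comp_of_counts {m : I → ℕ} {s : E → I} (hs : s ∈ functionsWithCounts E m) (f : I → ℝ) :
    ∏ e, f (s e) = ∏ i, f i ^ m i := by
  rw [← Finset.prod_fiberwise (Finset.univ : Finset E) s fun e => f (s e)]
  refine Finset.prod_congr rfl fun i _ => ?_
  rw [← mem_functionsWithCounts.1 hs i]
  exact Finset.prod_eq_pow_card fun e he => by rw [(Finset.mem_filter.1 he).2]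

/-- Saddle point upper bound. -/
theorem pairSum_le {B : I → J → ℝ} (hB : ∀ i j, 0 ≤ B i j) {a : I → ℕ} {b : J → ℕ} {s : E → I}
    (hs : s ∈ functionsWithCounts E a) {z : J → ℝ} (hz : ∀ j, 0 < z j) :
    pairSum B b s * ∏ j, z j ^ b j ≤ ∏ i, (∑ j, B i j * z j) ^ a i := by
  have h1 : ∏ i, (∑ j, B i j * z j) ^ a i = ∑ c : E → J, ∏ e, (B (s e) (c e) * z (c e)) := by
    rw [← prod_comp_of_counts hs fun i => ∑ j, B i j * z j, Finset.prod_univ_sum]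
    simp
  rw [h1, pairSum, Finset.sum_mul]
  -- The product expands over all right colourings; the terms with fibre sizes `b` alone give the
  -- left-hand side, and the others are nonnegative.
  refine le_trans (le_of_eq (Finset.sum_congr rfl fun c hc => ?_))
    (Finset.sum_le_sum_of_subset_of_nonneg (Finset.subset_univ (functionsWithCounts E b))
      fun c _ _ => Finset.prod_nonneg fun e _ => mul_nonneg (hB _ _) (hz _).le)
  rw [Finset.prod_mul_distrib, prod_comp_of_counts hc z]

/-- Lower bound by the contribution of a single matrix of joint counts. -/
theorem le_pairSum {B : I → J → ℝ} (hB : ∀ i j, 0 ≤ B i j) {a : I → ℕ} {b : J → ℕ} {s : E → I}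
    (hs : s ∈ functionsWithCounts E a) {N : I × J → ℕ} (hrow : ∀ i, ∑ j, N (i, j) = a i)
    (hcol : ∀ j, ∑ i, N (i, j) = b j) :
    (∏ i, ((a i).factorial : ℝ)) * ∏ x, B x.1 x.2 ^ N x
      ≤ pairSum B b s * ∏ x, ((N x).factorial : ℝ) := by
  have hcardE : ∑ i, a i = Fintype.card E := by
    have h := Finset.card_eq_sum_card_fiberwise (s := (Finset.univ : Finset E)) (t := Finset.univ)
      (f := s) (fun _ _ => Finset.mem_coe.2 (Finset.mem_univ _))
    rw [Finset.card_univ] at h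
    rw [h]
    exact Finset.sum_congr rfl fun i _ => (mem_functionsWithCounts.1 hs i).symm
  have hN : ∑ x, N x = Fintype.card E := by
    rw [Fintype.sum_prod_type, ← hcardE]
    exact Finset.sum_congr rfl fun i _ => hrow i
  have hfst : ∀ g ∈ functionsWithCounts E N, (fun e => (g e).1) ∈ functionsWithCounts E a ∧
      (fun e => (g e).2) ∈ functionsWithCounts E b := fun g hg => by
    rw [mem_functionsWithCounts] at hg
    constructor
    · refine mem_functionsWithCounts.2 fun i => ?_
      rw [← hrow i, Finset.card_eq_sum_card_fiberwise (t := Finset.univ) (f := fun e => (g e).2)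
        (fun _ _ => Finset.mem_coe.2 (Finset.mem_univ _))]
      refine Finset.sum_congr rfl fun j _ => ?_
      rw [← hg (i, j), Finset.filter_filter]
      congr 1
      ext e
      simp [Prod.ext_iff]
    · refine mem_functionsWithCounts.2 fun j => ?_
      rw [← hcol j, Finset.card_eq_sum_card_fiberwise (t := Finset.univ) (f := fun e => (g e).1)
        (fun _ _ => Finset.mem_coe.2 (Finset.mem_univ _))]
      refine Finset.sum_congr rfl fun i _ => ?_
      rw [← hg (i, j), Finset.filter_filter]
      congr 1
      ext e
      simp [Prod.ext_iff, and_comm]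
  -- By invariance, fixing the left colouring amounts to averaging over all left colourings with
  -- fibre sizes `a`; joint colourings can then be counted directly.
  have hsum : ((Fintype.card E).factorial : ℝ) * pairSum B b s
      = (∏ i, ((a i).factorial : ℝ)) * ∑ s' ∈ functionsWithCounts E a, pairSum B b s' := by
    rw [← sum_perm_comp hs (pairSum B b)]
    simp only [pairSum_comp_perm, Finset.sum_const, nsmul_eq_mul, Finset.card_univ,
      Fintype.card_perm]
  have hle : ((functionsWithCounts E N).card : ℝ) * ∏ x, B x.1 x.2 ^ N x
      ≤ ∑ s' ∈ functionsWithCounts E a, pairSum B b s' := by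
    unfold pairSum
    rw [← Finset.sum_product', ← nsmul_eq_mul, ← Finset.sum_const]
    have h1 : ∑ g ∈ functionsWithCounts E N, ∏ x : I × J, B x.1 x.2 ^ N x
        = ∑ y ∈ (functionsWithCounts E N).image fun g => (fun e => (g e).1, fun e => (g e).2),
          ∏ e, B (y.1 e) (y.2 e) := by
      rw [Finset.sum_image]
      · refine Finset.sum_congr rfl fun g hg => ?_
        rw [← prod_comp_of_counts hg fun x => B x.1 x.2]
      · intro g _ g' _ h
        funext e
        have h1 := congrFun (congrArg Prod.fst h) e
        have h2 := congrFun (congrArg Prod.snd h) e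
        exact Prod.ext h1 h2
    rw [h1]
    refine Finset.sum_le_sum_of_subset_of_nonneg ?_
      fun y _ _ => Finset.prod_nonneg fun e _ => hB _ _
    intro y hy
    obtain ⟨g, hg, rfl⟩ := Finset.mem_image.1 hy
    exact Finset.mem_product.2 (hfst g hg)
  have hcard := card_functionsWithCounts (E := E) hN
  have hF : (0 : ℝ) < (Fintype.card E).factorial := by exact_mod_cast Nat.factorial_pos _
  refine le_of_mul_le_mul_left ?_ hF
  calc ((Fintype.card E).factorial : ℝ) * ((∏ i, ((a i).factorial : ℝ)) * ∏ x, B x.1 x.2 ^ N x)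
      = (∏ i, ((a i).factorial : ℝ)) * (((functionsWithCounts E N).card : ℝ)
          * ∏ x, B x.1 x.2 ^ N x) * ∏ x, ((N x).factorial : ℝ) := by rw [← hcard]; ring
    _ ≤ (∏ i, ((a i).factorial : ℝ)) * (∑ s' ∈ functionsWithCounts E a, pairSum B b s')
          * ∏ x, ((N x).factorial : ℝ) := by gcongr
    _ = _ := by rw [← hsum]; ring

end PairSums

end HypergraphColouring

namespace HypergraphColouring

/-! ### Arrangements with distinct labels in each row -/

section Grids

variable {α V : Type*} [Fintype α] [DecidableEq α] [DecidableEq V]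

/-- The sequences of `j` elements of `S` with distinct labels. -/
def rows (φ : α → V) (j : ℕ) (S : Finset α) : Finset (Fin j → α) :=
  Finset.univ.filter fun r => (∀ k, r k ∈ S) ∧ Function.Injective (φ ∘ r)

/-- The arrangements of elements of `S` without repetition in rows of length `Δ`, indexed by `ρ`,
such that the labels in each row are distinct. -/
def grids (φ : α → V) (Δ : ℕ) (ρ : Type*) [Fintype ρ] [DecidableEq ρ] (S : Finset α) :
    Finset (ρ → Fin Δ → α) :=
  Finset.univ.filter fun h => (∀ u, h u ∈ rows φ Δ S) ∧
    Function.Injective fun x : ρ × Fin Δ => h x.1 x.2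

theorem mem_rows {φ : α → V} {j : ℕ} {S : Finset α} {r : Fin j → α} :
    r ∈ rows φ j S ↔ (∀ k, r k ∈ S) ∧ Function.Injective (φ ∘ r) := by
  simp [rows]

theorem mem_grids {φ : α → V} {Δ : ℕ} {ρ : Type*} [Fintype ρ] [DecidableEq ρ] {S : Finset α}
    {h : ρ → Fin Δ → α} : h ∈ grids φ Δ ρ S ↔ (∀ u, h u ∈ rows φ Δ S) ∧
      Function.Injective fun x : ρ × Fin Δ => h x.1 x.2 := by
  simp [grids]

variable {φ : α → V} {Δ : ℕ}

/-- A further entry must avoid the labels of the `j` present ones, and each label excludes at most Δ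
elements. -/
theorem card_rows_succ (hφ : ∀ v, (Finset.univ.filter fun x => φ x = v).card ≤ Δ) (j : ℕ)
    (S : Finset α) : (S.card - j * Δ) * (rows φ j S).card ≤ (rows φ (j + 1) S).card := by
  have hext : ∀ r : Fin j → α, S.card - j * Δ ≤ (S.filter fun x => ∀ k, φ x ≠ φ (r k)).card := by
    intro r
    have h1 : (S.filter fun x => ¬ ∀ k, φ x ≠ φ (r k)).card ≤ j * Δ := by
      calc (S.filter fun x => ¬ ∀ k, φ x ≠ φ (r k)).card
          ≤ (Finset.univ.biUnion fun k : Fin j =>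
              Finset.univ.filter fun x => φ x = φ (r k)).card := by
            refine Finset.card_le_card fun x hx => ?_
            have := (Finset.mem_filter.1 hx).2
            push Not at this
            simpa using this
        _ ≤ ∑ k : Fin j, (Finset.univ.filter fun x => φ x = φ (r k)).card :=
            Finset.card_biUnion_le
        _ ≤ ∑ _k : Fin j, Δ := Finset.sum_le_sum fun k _ => hφ _
        _ = j * Δ := by simp
    have h2 := Finset.card_filter_add_card_filter_not (s := S) (fun x => ∀ k, φ x ≠ φ (r k))
    omega
  calc (S.card - j * Δ) * (rows φ j S).card
      = ∑ _r ∈ rows φ j S, (S.card - j * Δ) := by simp [mul_comm]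
    _ ≤ ∑ r ∈ rows φ j S, (S.filter fun x => ∀ k, φ x ≠ φ (r k)).card :=
        Finset.sum_le_sum fun r _ => hext r
    _ = ((rows φ j S).sigma fun r => S.filter fun x => ∀ k, φ x ≠ φ (r k)).card :=
        (Finset.card_sigma _ _).symm
    _ ≤ (rows φ (j + 1) S).card := by
        refine Finset.card_le_card_of_injOn
          (fun y : (_ : Fin j → α) × α => (Fin.cons y.2 y.1 : Fin (j + 1) → α)) ?_ ?_
        · rintro ⟨r, x⟩ hy
          obtain ⟨hr, hx⟩ := Finset.mem_sigma.1 (Finset.mem_coe.1 hy)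
          obtain ⟨hrS, hri⟩ := mem_rows.1 hr
          obtain ⟨hxS, hxr⟩ := Finset.mem_filter.1 hx
          refine Finset.mem_coe.2 (mem_rows.2 ⟨fun k => ?_, ?_⟩)
          · refine Fin.cases ?_ (fun k => ?_) k
            · simpa using hxS
            · simpa using hrS k
          · intro k l h
            induction k using Fin.cases with
            | zero =>
              induction l using Fin.cases with
              | zero => rfl
              | succ l => exact absurd (by simpa using h) (hxr l)
            | succ k =>
              induction l using Fin.cases with
              | zero => exact absurd (by simpa using h.symm) (hxr k)
              | succ l => rw [hri (a₁ := k) (a₂ := l) (by simpa using h)]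
        · rintro ⟨r, x⟩ - ⟨r', x'⟩ - h
          obtain ⟨h1, h2⟩ := Fin.cons_inj.1 h
          simp only at h1 h2
          rw [h1, h2]

/-- The count is at least the product of the factors |S| − iΔ for i < j, each bounded below by the
last one. -/
theorem le_card_rows (hφ : ∀ v, (Finset.univ.filter fun x => φ x = v).card ≤ Δ) (j : ℕ)
    (S : Finset α) : (S.card - (j - 1) * Δ) ^ j ≤ (rows φ j S).card := by
  induction j with
  | zero =>
    have : (rows φ 0 S).Nonempty :=
      ⟨Fin.elim0, mem_rows.2 ⟨fun k => k.elim0, fun k => k.elim0⟩⟩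
    simpa using this.card_pos
  | succ j ih =>
    calc (S.card - (j + 1 - 1) * Δ) ^ (j + 1)
        = (S.card - j * Δ) * (S.card - j * Δ) ^ j := by rw [Nat.add_sub_cancel, pow_succ, mul_comm]
      _ ≤ (S.card - j * Δ) * (S.card - (j - 1) * Δ) ^ j := by
          gcongr
          omega
      _ ≤ (S.card - j * Δ) * (rows φ j S).card := by gcongr
      _ ≤ _ := card_rows_succ hφ j S

/-- The first row is chosen freely and then removed from `S`. Since the remaining set depends on
that row, `L` has to be a bound uniform over such sets. -/
theorem card_grids_succ {L a : ℕ} {S : Finset α}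
    (hL : ∀ S' ⊆ S, S'.card = S.card - Δ → L ≤ (grids φ Δ (Fin a) S').card) :
    (rows φ Δ S).card * L ≤ (grids φ Δ (Fin (a + 1)) S).card := by
  have hinj : ∀ r ∈ rows φ Δ S, Function.Injective r := fun r hr =>
    Function.Injective.of_comp (mem_rows.1 hr).2
  calc (rows φ Δ S).card * L = ∑ _r ∈ rows φ Δ S, L := by simp
    _ ≤ ∑ r ∈ rows φ Δ S, (grids φ Δ (Fin a) (S \ Finset.univ.image r)).card := by
        refine Finset.sum_le_sum fun r hr => hL _ Finset.sdiff_subset ?_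
        rw [Finset.card_sdiff_of_subset, Finset.card_image_of_injective _ (hinj r hr)]
        · simp
        · intro x hx
          obtain ⟨k, -, rfl⟩ := Finset.mem_image.1 hx
          exact (mem_rows.1 hr).1 k
    _ = ((rows φ Δ S).sigma fun r => grids φ Δ (Fin a) (S \ Finset.univ.image r)).card :=
        (Finset.card_sigma _ _).symm
    _ ≤ _ := by
        refine Finset.card_le_card_of_injOn
          (fun y : (_ : Fin Δ → α) × (Fin a → Fin Δ → α) =>
            (Fin.cons y.1 y.2 : Fin (a + 1) → Fin Δ → α)) ?_ ?_
        · rintro ⟨r, h⟩ hy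
          obtain ⟨hr, hh⟩ := Finset.mem_sigma.1 (Finset.mem_coe.1 hy)
          obtain ⟨hrow, hh2⟩ := mem_grids.1 hh
          have hdisj : ∀ u k l, h u k ≠ r l := fun u k l he => by
            have := (mem_rows.1 (hrow u)).1 k
            rw [Finset.mem_sdiff] at this
            exact this.2 (by simp [he])
          refine Finset.mem_coe.2 (mem_grids.2 ⟨fun u => ?_, ?_⟩)
          · refine Fin.cases ?_ (fun u => ?_) u
            · simpa using hr
            · obtain ⟨h1, h2⟩ := mem_rows.1 (hrow u)
              exact mem_rows.2 ⟨fun k => by simpa using (Finset.mem_sdiff.1 (h1 k)).1, by simpa using h2⟩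
          · rintro ⟨u, k⟩ ⟨v, l⟩ he
            induction u using Fin.cases with
            | zero =>
              induction v using Fin.cases with
              | zero => rw [hinj r hr (a₁ := k) (a₂ := l) (by simpa using he)]
              | succ v => exact absurd (by simpa using he.symm) (hdisj v l k)
            | succ u =>
              induction v using Fin.cases with
              | zero => exact absurd (by simpa using he) (hdisj u k l)
              | succ v =>
                have := @hh2 (u, k) (v, l) (by simpa using he)
                rw [Prod.mk.injEq] at this
                rw [this.1, this.2]
        · rintro ⟨r, h⟩ - ⟨r', h'⟩ - he
          obtain ⟨h1, h2⟩ := Fin.cons_inj.1 he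
          simp only at h1 h2
          rw [h1, h2]

end Grids

/-! ### Grids with distinct labels make up a polynomial fraction -/

section RoundRobin

variable {α V : Type*} [Fintype α] [DecidableEq α] [LinearOrder V] {φ : α → V} {Δ : ℕ}

/-- Listing the elements by label and dealing them out cyclically to `a ≥ Δ` rows. -/
theorem grids_nonempty (hφ : ∀ v, (Finset.univ.filter fun x => φ x = v).card ≤ Δ) {a : ℕ}
    (ha : Δ ≤ a) {S : Finset α} (hS : S.card = Δ * a) : (grids φ Δ (Fin a) S).Nonempty := by
  have e : Fin (Δ * a) ≃ S := Fintype.equivOfCardEq (by simp [hS])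
  set f : Fin (Δ * a) → V := fun i => φ (e i) with hf
  set g : Fin (Δ * a) → α := fun i => e (Tuple.sort f i) with hg
  have hmono : Monotone (φ ∘ g) := Tuple.monotone_sort f
  have hginj : Function.Injective g := fun i j hij =>
    (Tuple.sort f).injective (e.injective (Subtype.ext hij))
  refine ⟨fun u k => g (finProdFinEquiv (k, u)), mem_grids.2 ⟨fun u => mem_rows.2
    ⟨fun k => (e _).2, ?_⟩, ?_⟩⟩
  -- Entry k of row u sits at position ak + u of the sorted list. Two equal labels in one row would
  -- force at least a + 1 > Δ consecutive entries with that label.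
  · have key : ∀ k l : Fin Δ, k < l → φ (g (finProdFinEquiv (k, u))) ≠ φ (g (finProdFinEquiv (l, u))) := by
      intro k l hkl heq
      have hsub : (Finset.Icc (finProdFinEquiv (k, u)) (finProdFinEquiv (l, u))).image g
          ⊆ Finset.univ.filter fun x => φ x = φ (g (finProdFinEquiv (k, u))) := by
        intro x hx
        obtain ⟨i, hi, rfl⟩ := Finset.mem_image.1 hx
        obtain ⟨h1, h2⟩ := Finset.mem_Icc.1 hi
        refine Finset.mem_filter.2 ⟨Finset.mem_univ _, le_antisymm ?_ (hmono h1)⟩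
        rw [heq]
        exact hmono h2
      have hcard := (Finset.card_le_card hsub).trans (hφ _)
      rw [Finset.card_image_of_injective _ hginj, Fin.card_Icc] at hcard
      simp only [finProdFinEquiv_apply_val] at hcard
      have h3 : a * (k : ℕ) + a ≤ a * (l : ℕ) := by
        calc a * (k : ℕ) + a = a * ((k : ℕ) + 1) := by ring
          _ ≤ a * (l : ℕ) := Nat.mul_le_mul_left a hkl
      omega
    intro k l hkl
    rcases lt_trichotomy k l with h | h | h
    · exact absurd hkl (key k l h)
    · exact h
    · exact absurd hkl.symm (key l k h)
  · rintro ⟨u, k⟩ ⟨v, l⟩ he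
    have := finProdFinEquiv.injective (hginj he)
    exact Prod.ext (congrArg Prod.snd this) (congrArg Prod.fst this)

/-- Up to a polynomial factor, all arrangements of `Δ a` elements with label multiplicities at most
`Δ` in `a` rows have distinct labels in each row. -/
theorem factorial_le_card_grids (hφ : ∀ v, (Finset.univ.filter fun x => φ x = v).card ≤ Δ) {a : ℕ}
    (ha : Δ ≤ a) {S : Finset α} (hS : S.card = Δ * a) :
    (Δ * a).factorial ≤
      (Δ * Δ).factorial * a.descFactorial (Δ - 1) ^ Δ * (grids φ Δ (Fin a) S).card := by
  induction a, ha using Nat.le_induction generalizing S with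
  | base =>
    -- One valid arrangement suffices here, because the constant (Δ²)! already bounds the number of
    -- all arrangements.
    have h1 := (grids_nonempty hφ le_rfl hS).card_pos
    have h2 : 0 < Δ.descFactorial (Δ - 1) := Nat.descFactorial_pos.2 (Nat.sub_le _ _)
    calc (Δ * Δ).factorial = (Δ * Δ).factorial * 1 * 1 := by ring
      _ ≤ _ := by
        gcongr
        · exact Nat.one_le_pow _ _ h2
        · exact h1
  | succ a ha ih =>
    have hsub : ∀ S' ⊆ S, S'.card = S.card - Δ → S'.card = Δ * a := fun S' _ h => by
      rw [h, hS, mul_add, mul_one, Nat.add_sub_cancel]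
    obtain ⟨L, hL, hLa⟩ : ∃ L : ℕ, (∀ S' ⊆ S, S'.card = S.card - Δ →
        L ≤ (grids φ Δ (Fin a) S').card) ∧
        (Δ * a).factorial ≤ (Δ * Δ).factorial * a.descFactorial (Δ - 1) ^ Δ * L := by
      obtain ⟨S₀, hS₀, hc₀⟩ := Finset.exists_subset_card_eq (Nat.sub_le S.card Δ)
      obtain ⟨S₁, hS₁, hmin⟩ := Finset.exists_min_image
        (S.powerset.filter fun S' => S'.card = S.card - Δ)
        (fun S' => (grids φ Δ (Fin a) S').card)
        ⟨S₀, by simp [hS₀, hc₀]⟩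
      rw [Finset.mem_filter, Finset.mem_powerset] at hS₁
      refine ⟨_, fun S' h1 h2 => hmin S' (by simp [h1, h2]), ih (hsub S₁ hS₁.1 hS₁.2)⟩
    have hrows : (Δ * (a + 1 - (Δ - 1))) ^ Δ ≤ (rows φ Δ S).card := by
      refine le_trans (le_of_eq ?_) (le_card_rows hφ Δ S)
      rw [hS, Nat.mul_sub, mul_comm (Δ - 1) Δ]
    -- The loss at each step is ((a + 1)/(a + 1 − (Δ − 1)))^Δ. This identity makes the losses
    -- telescope into a falling factorial, hence into a polynomial in `a`.
    have hdesc := Nat.succ_descFactorial a (Δ - 1)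
    calc (Δ * (a + 1)).factorial ≤ (Δ * a).factorial * (Δ * (a + 1)) ^ Δ := by
          rw [mul_add, mul_one, ← Nat.factorial_mul_ascFactorial]
          gcongr
          exact Nat.ascFactorial_le_pow_add _ _
      _ ≤ ((Δ * Δ).factorial * a.descFactorial (Δ - 1) ^ Δ * L) * (Δ * (a + 1)) ^ Δ := by gcongr
      _ = (Δ * Δ).factorial * (a + 1).descFactorial (Δ - 1) ^ Δ *
            ((Δ * (a + 1 - (Δ - 1))) ^ Δ * L) := by
          rw [mul_pow Δ (a + 1), mul_pow Δ (a + 1 - (Δ - 1))]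
          have := congrArg (· ^ Δ) hdesc
          simp only [mul_pow] at this
          calc _ = (Δ * Δ).factorial * Δ ^ Δ * L * ((a + 1) ^ Δ * a.descFactorial (Δ - 1) ^ Δ) := by
                ring
            _ = _ := by rw [← this]; ring
      _ ≤ (Δ * Δ).factorial * (a + 1).descFactorial (Δ - 1) ^ Δ *
            ((rows φ Δ S).card * L) := by gcongr
      _ ≤ _ := by
          gcongr
          exact card_grids_succ hL

theorem card_grids_congr (φ : α → V) (Δ : ℕ) {ρ ρ' : Type*} [Fintype ρ] [DecidableEq ρ] [Fintype ρ']
    [DecidableEq ρ'] (e : ρ ≃ ρ') (S : Finset α) :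
    (grids φ Δ ρ' S).card ≤ (grids φ Δ ρ S).card := by
  refine Finset.card_le_card_of_injOn (fun h u => h (e u)) ?_ ?_
  · intro h hh
    obtain ⟨h1, h2⟩ := mem_grids.1 (Finset.mem_coe.1 hh)
    refine Finset.mem_coe.2 (mem_grids.2 ⟨fun u => h1 _, ?_⟩)
    rintro ⟨u, k⟩ ⟨v, l⟩ he
    have := @h2 (e u, k) (e v, l) he
    simpa using this
  · intro h _ h' _ he
    funext u
    have := congrFun he (e.symm u)
    simpa using this

end RoundRobin

end HypergraphColouring

namespace HypergraphColouring

/-! ### Removing multiple edges -/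

section Simplicity

/-- The maps from left half-edges to right vertices in which every right vertex has degree `Δ`. -/
def balanced (Δ n : ℕ) : Finset (Fin n × Fin Δ → Fin n) :=
  functionsWithCounts (Fin n × Fin Δ) fun _ => Δ

/-- The balanced maps without multiple edges. -/
def simpleMaps (Δ n : ℕ) : Finset (Fin n × Fin Δ → Fin n) :=
  (balanced Δ n).filter fun f => ∀ u, Function.Injective fun k => f (u, k)

/-- The factor by which forbidding multiple edges at `a` vertices reduces the number of
configurations, at most. -/
def simplicityFactor (Δ a : ℕ) : ℕ := (Δ * Δ).factorial * a.descFactorial (Δ - 1) ^ Δ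

variable {Δ n : ℕ} {κ : Type*} [Fintype κ] [DecidableEq κ]

theorem halfEdge_counts {σ : Fin n → κ} {a : κ → ℕ} (hσ : σ ∈ functionsWithCounts (Fin n) a) :
    (fun e : Fin n × Fin Δ => σ e.1) ∈ functionsWithCounts (Fin n × Fin Δ) fun i => Δ * a i := by
  rw [mem_functionsWithCounts] at hσ ⊢
  intro i
  have : (Finset.univ.filter fun e : Fin n × Fin Δ => σ e.1 = i)
      = (Finset.univ.filter fun u => σ u = i) ×ˢ (Finset.univ : Finset (Fin Δ)) := by
    ext e
    simp
  rw [this, Finset.card_product, hσ, Finset.card_univ, Fintype.card_fin, mul_comm]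

/-- Many colour-preserving rearrangements of the half-edges remove all multiple edges. -/
theorem prod_factorial_le_card_rearrangements {σ : Fin n → κ} {a : κ → ℕ}
    (hσ : σ ∈ functionsWithCounts (Fin n) a) (ha : ∀ i, Δ ≤ a i) {f : Fin n × Fin Δ → Fin n}
    (hf : f ∈ balanced Δ n) :
    ∏ i, (Δ * a i).factorial ≤ (∏ i, simplicityFactor Δ (a i)) *
      (Finset.univ.filter fun h : Equiv.Perm (Fin n × Fin Δ) => (∀ e, σ (h e).1 = σ e.1) ∧
        ∀ u, Function.Injective fun k => f (h (u, k))).card := by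
  have hf' : ∀ v, (Finset.univ.filter fun x => f x = v).card ≤ Δ := fun v =>
    (mem_functionsWithCounts.1 hf v).le
  set S : κ → Finset (Fin n × Fin Δ) := fun i => Finset.univ.filter fun e => σ e.1 = i with hS
  have hScard : ∀ i, (S i).card = Δ * a i := fun i =>
    mem_functionsWithCounts.1 (halfEdge_counts hσ) i
  have e : ∀ i, {u // σ u = i} ≃ Fin (a i) := fun i => Fintype.equivOfCardEq (by
    rw [Fintype.card_subtype, mem_functionsWithCounts.1 hσ i, Fintype.card_fin])
  have hgrid : ∀ i, (Δ * a i).factorial ≤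
      simplicityFactor Δ (a i) * (grids f Δ {u // σ u = i} (S i)).card := fun i =>
    (factorial_le_card_grids hf' (ha i) (hScard i)).trans
      (Nat.mul_le_mul_left _ (card_grids_congr f Δ (e i) (S i)))
  calc ∏ i, (Δ * a i).factorial
      ≤ ∏ i, (simplicityFactor Δ (a i) * (grids f Δ {u // σ u = i} (S i)).card) :=
        Finset.prod_le_prod' fun i _ => hgrid i
    _ = (∏ i, simplicityFactor Δ (a i)) *
          (Fintype.piFinset fun i => grids f Δ {u // σ u = i} (S i)).card := by
        rw [Finset.prod_mul_distrib, Fintype.card_piFinset]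
    _ ≤ _ := by
        gcongr
        -- Grids chosen for the colour classes are glued into one map of half-edges. Grid `i` uses
        -- only half-edges of colour `i`, so the result preserves colours and is injective.
        set Θ : (∀ i, {u // σ u = i} → Fin Δ → Fin n × Fin Δ) → (Fin n × Fin Δ → Fin n × Fin Δ) :=
          fun g x => g (σ x.1) ⟨x.1, rfl⟩ x.2 with hΘ
        have hinj : Function.Injective Θ := fun g g' h => by
          funext i u k
          obtain ⟨u, rfl⟩ := u
          exact congrFun h (u, k)
        rw [← Finset.card_image_of_injective _ hinj]
        refine le_trans (Finset.card_le_card ?_) (Finset.card_image_le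
          (f := fun h : Equiv.Perm (Fin n × Fin Δ) => (h : Fin n × Fin Δ → Fin n × Fin Δ)))
        intro F hF
        obtain ⟨g, hg, rfl⟩ := Finset.mem_image.1 hF
        have hg := fun i => mem_grids.1 (Fintype.mem_piFinset.1 hg i)
        have hcol : ∀ x, σ (Θ g x).1 = σ x.1 := fun x => by
          have := (mem_rows.1 ((hg (σ x.1)).1 ⟨x.1, rfl⟩)).1 x.2
          exact (Finset.mem_filter.1 this).2
        have hFinj : Function.Injective (Θ g) := by
          rintro ⟨u, k⟩ ⟨v, l⟩ hxy
          have hc : σ u = σ v := by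
            have h1 := hcol (u, k)
            have h2 := hcol (v, l)
            rw [hxy] at h1
            exact h1.symm.trans h2
          have key : ∀ i (hu : σ u = i) (hv : σ v = i), g i ⟨u, hu⟩ k = g i ⟨v, hv⟩ l →
              (u, k) = (v, l) := fun i hu hv h => by
            have := (hg i).2 (a₁ := (⟨u, hu⟩, k)) (a₂ := (⟨v, hv⟩, l)) h
            simpa using this
          have heq : ∀ i (hv : σ v = i), g (σ v) ⟨v, rfl⟩ l = g i ⟨v, hv⟩ l := by
            rintro i rfl; rfl
          exact key (σ u) rfl hc.symm (hxy.trans (heq _ _))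
        refine Finset.mem_image.2 ⟨Equiv.ofBijective (Θ g) (Finite.injective_iff_bijective.1 hFinj),
          Finset.mem_filter.2 ⟨Finset.mem_univ _, hcol, fun u => ?_⟩, rfl⟩
        exact (mem_rows.1 ((hg (σ u)).1 ⟨u, rfl⟩)).2

/-- Restricting to simple maps costs at most a polynomial factor. -/
theorem sum_balanced_le {σ : Fin n → κ} {a : κ → ℕ} (hσ : σ ∈ functionsWithCounts (Fin n) a)
    (ha : ∀ i, Δ ≤ a i) {w : (Fin n × Fin Δ → Fin n) → ℝ} (hw : ∀ f, 0 ≤ w f)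
    (hinv : ∀ h : Equiv.Perm (Fin n × Fin Δ), (∀ e, σ (h e).1 = σ e.1) → ∀ f, w (f ∘ h) = w f) :
    ∑ f ∈ balanced Δ n, w f ≤ (∏ i, (simplicityFactor Δ (a i) : ℝ)) * ∑ f ∈ simpleMaps Δ n, w f := by
  set H : Finset (Equiv.Perm (Fin n × Fin Δ)) :=
    Finset.univ.filter fun h => ∀ e, σ (h e).1 = σ e.1 with hH
  have hHcard : H.card = ∏ i, (Δ * a i).factorial := by
    rw [← card_perm_comp_eq (halfEdge_counts (Δ := Δ) hσ) (halfEdge_counts (Δ := Δ) hσ), hH]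
    congr 1
    ext h
    simp only [Finset.mem_filter, Finset.mem_univ, true_and]
    exact ⟨fun h1 => funext h1, fun h1 e => congrFun h1 e⟩
  have hHpos : (0 : ℝ) < H.card := by
    rw [hHcard]
    exact_mod_cast Finset.prod_pos fun i _ => Nat.factorial_pos _
  -- Double counting: each colour-preserving `h` permutes the balanced maps without changing the
  -- weight, so the simple maps are counted once for every `h`.
  have hcount : ∑ f ∈ balanced Δ n, ∑ h ∈ H, (if ∀ u, Function.Injective fun k => f (h (u, k))
      then w f else 0) = H.card * ∑ f ∈ simpleMaps Δ n, w f := by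
    rw [Finset.sum_comm, ← nsmul_eq_mul, ← Finset.sum_const]
    refine Finset.sum_congr rfl fun h hh => ?_
    rw [simpleMaps, Finset.sum_filter]
    refine Finset.sum_bij (fun f _ => f ∘ h) ?_ ?_ ?_ ?_
    · intro f hf
      exact (comp_perm_mem_functionsWithCounts h).2 hf
    · intro f _ f' _ hff
      funext e
      simpa using congrFun hff (h.symm e)
    · intro f hf
      exact ⟨f ∘ h.symm, (comp_perm_mem_functionsWithCounts h.symm).2 hf, by funext e; simp⟩
    · intro f _
      rw [hinv h (Finset.mem_filter.1 hh).2]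
      rfl
  refine le_of_mul_le_mul_left ?_ hHpos
  rw [mul_left_comm, ← hcount, Finset.mul_sum, Finset.mul_sum]
  refine Finset.sum_le_sum fun f hf => ?_
  rw [← Finset.sum_filter, Finset.sum_const, nsmul_eq_mul, ← mul_assoc]
  refine mul_le_mul_of_nonneg_right ?_ (hw f)
  have := prod_factorial_le_card_rearrangements hσ ha hf
  rw [hHcard, hH, Finset.filter_filter]
  exact_mod_cast this

end Simplicity

end HypergraphColouring

namespace HypergraphColouring

/-! ### Regular bipartite graphs as maps of half-edges -/

section Graphs

variable {Δ n : ℕ}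

open scoped Classical in
/-- The right neighbours of a left vertex. -/
noncomputable def leftNbrs (G : SimpleGraph (Fin n ⊕ Fin n)) (u : Fin n) : Finset (Fin n) :=
  Finset.univ.filter fun v => G.Adj (Sum.inl u) (Sum.inr v)

/-- The neighbourhood systems of `Δ`-regular bipartite graphs. -/
def regularNbrs (Δ n : ℕ) : Finset (Fin n → Finset (Fin n)) :=
  Finset.univ.filter fun A => (∀ u, (A u).card = Δ) ∧
    ∀ v, (Finset.univ.filter fun u => v ∈ A u).card = Δ

/-- The bipartite graph with given right neighbourhoods of the left vertices. -/
def graphOfNbrs (A : Fin n → Finset (Fin n)) : SimpleGraph (Fin n ⊕ Fin n) where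
  Adj x y := (∃ u v, x = Sum.inl u ∧ y = Sum.inr v ∧ v ∈ A u) ∨
    ∃ u v, y = Sum.inl u ∧ x = Sum.inr v ∧ v ∈ A u
  symm := ⟨fun _ _ h => h.symm⟩
  loopless := ⟨fun x h => by
    rcases h with ⟨u, v, h1, h2, -⟩ | ⟨u, v, h1, h2, -⟩ <;> rw [h1] at h2 <;> cases h2⟩

theorem leftNbrs_graphOfNbrs (A : Fin n → Finset (Fin n)) : leftNbrs (graphOfNbrs A) = A := by
  funext u
  ext v
  simp [leftNbrs, graphOfNbrs]

theorem mem_leftNbrs {G : SimpleGraph (Fin n ⊕ Fin n)} {u v : Fin n} :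
    v ∈ leftNbrs G u ↔ G.Adj (Sum.inl u) (Sum.inr v) := by
  simp [leftNbrs]

theorem graphOfNbrs_leftNbrs {G : SimpleGraph (Fin n ⊕ Fin n)}
    (hG : G ≤ completeBipartiteGraph (Fin n) (Fin n)) : graphOfNbrs (leftNbrs G) = G := by
  ext x y
  constructor
  · rintro (⟨u, v, rfl, rfl, h⟩ | ⟨u, v, rfl, rfl, h⟩)
    · exact mem_leftNbrs.1 h
    · exact (mem_leftNbrs.1 h).symm
  · intro h
    have := hG h
    rcases x with u | v <;> rcases y with u' | v'
    · simp at this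
    · exact Or.inl ⟨u, v', rfl, rfl, mem_leftNbrs.2 h⟩
    · exact Or.inr ⟨u', v, rfl, rfl, mem_leftNbrs.2 h.symm⟩
    · simp at this

theorem graphOfNbrs_le (A : Fin n → Finset (Fin n)) :
    graphOfNbrs A ≤ completeBipartiteGraph (Fin n) (Fin n) := by
  rintro x y (⟨u, v, rfl, rfl, h⟩ | ⟨u, v, rfl, rfl, h⟩) <;> simp

open scoped Classical in
theorem degree_graphOfNbrs_inl (A : Fin n → Finset (Fin n)) (u : Fin n) :
    (graphOfNbrs A).degree (Sum.inl u) = (A u).card := by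
  rw [← SimpleGraph.card_neighborFinset_eq_degree,
    ← Finset.card_map (Function.Embedding.inr : Fin n ↪ Fin n ⊕ Fin n)]
  congr 1
  ext x
  rw [SimpleGraph.mem_neighborFinset]
  rcases x with x | x <;> simp [graphOfNbrs]

open scoped Classical in
theorem degree_graphOfNbrs_inr (A : Fin n → Finset (Fin n)) (v : Fin n) :
    (graphOfNbrs A).degree (Sum.inr v) = (Finset.univ.filter fun u => v ∈ A u).card := by
  rw [← SimpleGraph.card_neighborFinset_eq_degree,
    ← Finset.card_map (Function.Embedding.inl : Fin n ↪ Fin n ⊕ Fin n)]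
  congr 1
  ext x
  rw [SimpleGraph.mem_neighborFinset]
  rcases x with x | x <;> simp [graphOfNbrs]

theorem mem_regularNbrs {A : Fin n → Finset (Fin n)} : A ∈ regularNbrs Δ n ↔
    (∀ u, (A u).card = Δ) ∧ ∀ v, (Finset.univ.filter fun u => v ∈ A u).card = Δ := by
  simp [regularNbrs]

open scoped Classical in
theorem mem_regularBipartite {G : SimpleGraph (Fin n ⊕ Fin n)} : G ∈ regularBipartite Δ n ↔
    G ≤ completeBipartiteGraph (Fin n) (Fin n) ∧ ∀ x, G.degree x = Δ := by
  rw [regularBipartite, Finset.mem_filter, SimpleGraph.IsRegularOfDegree]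
  simp only [Finset.mem_univ, true_and]

theorem graphOfNbrs_mem_regularBipartite {A : Fin n → Finset (Fin n)} :
    graphOfNbrs A ∈ regularBipartite Δ n ↔ A ∈ regularNbrs Δ n := by
  classical
  rw [mem_regularNbrs, mem_regularBipartite]
  simp only [graphOfNbrs_le, true_and, Sum.forall, degree_graphOfNbrs_inl, degree_graphOfNbrs_inr]

theorem sum_regularBipartite (F : (Fin n → Finset (Fin n)) → ℝ) :
    ∑ G ∈ regularBipartite Δ n, F (leftNbrs G) = ∑ A ∈ regularNbrs Δ n, F A := by
  have hle : ∀ G ∈ regularBipartite Δ n, G ≤ completeBipartiteGraph (Fin n) (Fin n) :=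
    fun G hG => (mem_regularBipartite.1 hG).1
  refine Finset.sum_bij' (fun G _ => leftNbrs G) (fun A _ => graphOfNbrs A) ?_ ?_ ?_ ?_ ?_
  · intro G hG
    rw [← graphOfNbrs_mem_regularBipartite, graphOfNbrs_leftNbrs (hle G hG)]
    exact hG
  · intro A hA
    exact graphOfNbrs_mem_regularBipartite.2 hA
  · intro G hG
    exact graphOfNbrs_leftNbrs (hle G hG)
  · intro A _
    exact leftNbrs_graphOfNbrs A
  · intro G _
    rfl

theorem card_enumerations {α : Type*} [Fintype α] [DecidableEq α] {A : Finset α} (hA : A.card = Δ) :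
    (Finset.univ.filter fun r : Fin Δ → α => Finset.univ.image r = A).card = Δ.factorial := by
  have hcard : Fintype.card (Fin Δ ≃ A) = Δ.factorial := by
    rw [Fintype.card_equiv (Fintype.equivOfCardEq (by simp [hA])), Fintype.card_fin]
  rw [← hcard, ← Finset.card_univ]
  symm
  refine Finset.card_bij (fun e _ k => (e k : α)) ?_ ?_ ?_
  · intro e _
    simp only [Finset.mem_filter, Finset.mem_univ, true_and]
    ext x
    simp only [Finset.mem_image, Finset.mem_univ, true_and]
    constructor
    · rintro ⟨k, rfl⟩
      exact (e k).2
    · intro hx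
      exact ⟨e.symm ⟨x, hx⟩, by simp⟩
  · intro e _ e' _ h
    ext k
    exact congrFun h k
  · intro r hr
    have hr : Finset.univ.image r = A := (Finset.mem_filter.1 hr).2
    have hmem : ∀ k, r k ∈ A := fun k => by
      rw [← hr]; exact Finset.mem_image_of_mem _ (Finset.mem_univ _)
    have hsurj : Function.Surjective fun k => (⟨r k, hmem k⟩ : A) := by
      rintro ⟨x, hx⟩
      rw [← hr] at hx
      obtain ⟨k, -, rfl⟩ := Finset.mem_image.1 hx
      exact ⟨k, rfl⟩
    have hbij := (Fintype.bijective_iff_surjective_and_card _).2 ⟨hsurj, by simp [hA]⟩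
    exact ⟨Equiv.ofBijective _ hbij, Finset.mem_univ _, rfl⟩

/-- The neighbourhoods described by a map from half-edges. -/
def nbrsOfMap (f : Fin n × Fin Δ → Fin n) (u : Fin n) : Finset (Fin n) :=
  Finset.univ.image fun k => f (u, k)

theorem injective_row_of_card {f : Fin n × Fin Δ → Fin n} {u : Fin n}
    (h : (nbrsOfMap f u).card = Δ) : Function.Injective fun k => f (u, k) := by
  have := Finset.card_image_iff (s := (Finset.univ : Finset (Fin Δ))) (f := fun k => f (u, k))
  rw [Finset.card_univ, Fintype.card_fin] at this
  simpa using this.1 h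

theorem mem_simpleMaps_iff {f : Fin n × Fin Δ → Fin n} :
    f ∈ simpleMaps Δ n ↔ nbrsOfMap f ∈ regularNbrs Δ n := by
  have hdeg : (∀ u, Function.Injective fun k => f (u, k)) → ∀ v,
      (Finset.univ.filter fun u => v ∈ nbrsOfMap f u).card
        = (Finset.univ.filter fun e => f e = v).card := fun hinj v => by
    symm
    refine Finset.card_bij (fun e _ => e.1) ?_ ?_ ?_
    · intro e he
      simp only [Finset.mem_filter, Finset.mem_univ, true_and] at he ⊢
      exact Finset.mem_image.2 ⟨e.2, Finset.mem_univ _, he⟩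
    · rintro ⟨u, k⟩ he ⟨u', k'⟩ he' h
      simp only [Finset.mem_filter, Finset.mem_univ, true_and] at he he' h
      subst h
      rw [hinj u (a₁ := k) (a₂ := k') (he.trans he'.symm)]
    · intro u hu
      simp only [Finset.mem_filter, Finset.mem_univ, true_and] at hu
      obtain ⟨k, -, hk⟩ := Finset.mem_image.1 hu
      exact ⟨(u, k), by simpa using hk, rfl⟩
  rw [simpleMaps, Finset.mem_filter, mem_regularNbrs, balanced, mem_functionsWithCounts]
  constructor
  · rintro ⟨hbal, hinj⟩
    refine ⟨fun u => ?_, fun v => (hdeg hinj v).trans (hbal v)⟩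
    rw [nbrsOfMap, Finset.card_image_of_injective _ (hinj u), Finset.card_univ, Fintype.card_fin]
  · rintro ⟨hrow, hcol⟩
    have hinj := fun u => injective_row_of_card (hrow u)
    exact ⟨fun v => (hdeg hinj v).symm.trans (hcol v), hinj⟩

/-- A neighbourhood system comes from exactly (Δ!)^n simple maps, one for each choice of orderings
of the n neighbourhoods. -/
theorem sum_simpleMaps (F : (Fin n → Finset (Fin n)) → ℝ) :
    ∑ f ∈ simpleMaps Δ n, F (nbrsOfMap f)
      = (Δ.factorial : ℝ) ^ n * ∑ A ∈ regularNbrs Δ n, F A := by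
  rw [← Finset.sum_fiberwise_of_maps_to (t := regularNbrs Δ n) (g := nbrsOfMap)
    (fun f hf => mem_simpleMaps_iff.1 hf), Finset.mul_sum]
  refine Finset.sum_congr rfl fun A hA => ?_
  rw [Finset.sum_congr rfl (g := fun _ => F A) fun f hf => by rw [(Finset.mem_filter.1 hf).2],
    Finset.sum_const, nsmul_eq_mul]
  congr 1
  have hcard : ((simpleMaps Δ n).filter fun f => nbrsOfMap f = A).card
      = (Fintype.piFinset fun u => Finset.univ.filter fun r : Fin Δ → Fin n =>
          Finset.univ.image r = A u).card := by
    refine Finset.card_bij (fun f _ u k => f (u, k)) ?_ ?_ ?_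
    · intro f hf
      refine Fintype.mem_piFinset.2 fun u => ?_
      simp only [Finset.mem_filter, Finset.mem_univ, true_and]
      exact congrFun (Finset.mem_filter.1 hf).2 u
    · intro f _ f' _ h
      funext e
      exact congrFun (congrFun h e.1) e.2
    · intro r hr
      have hr := fun u => (Finset.mem_filter.1 (Fintype.mem_piFinset.1 hr u)).2
      have hnb : nbrsOfMap (fun e : Fin n × Fin Δ => r e.1 e.2) = A := funext hr
      refine ⟨fun e => r e.1 e.2, Finset.mem_filter.2 ⟨?_, hnb⟩, rfl⟩
      rw [mem_simpleMaps_iff, hnb]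
      exact hA
  rw [hcard, Fintype.card_piFinset, Finset.prod_congr rfl fun u _ =>
    card_enumerations ((mem_regularNbrs.1 hA).1 u)]
  simp

/-- The weight of a colouring, edge by edge. -/
noncomputable def mapWeight {q : ℕ} (B : Matrix (Fin (q + 1)) (Fin (q + 1)) ℝ)
    (σ τ : Fin n → Fin (q + 1)) (f : Fin n × Fin Δ → Fin n) : ℝ :=
  ∏ e, B (σ e.1) (τ (f e))

theorem sum_mapWeight {q : ℕ} (B : Matrix (Fin (q + 1)) (Fin (q + 1)) ℝ)
    (σ τ : Fin n → Fin (q + 1)) :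
    ∑ f ∈ simpleMaps Δ n, mapWeight B σ τ f
      = (Δ.factorial : ℝ) ^ n * ∑ G ∈ regularBipartite Δ n, weight B G σ τ := by
  have h1 : ∀ G : SimpleGraph (Fin n ⊕ Fin n),
      weight B G σ τ = ∏ u, ∏ v ∈ leftNbrs G u, B (σ u) (τ v) := fun G => by
    unfold weight
    refine Finset.prod_congr rfl fun u _ => ?_
    rw [leftNbrs, Finset.prod_filter]
  simp only [h1]
  rw [sum_regularBipartite fun A => ∏ u, ∏ v ∈ A u, B (σ u) (τ v), ← sum_simpleMaps]
  refine Finset.sum_congr rfl fun f hf => ?_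
  rw [mapWeight, Fintype.prod_prod_type]
  refine Finset.prod_congr rfl fun u _ => ?_
  rw [nbrsOfMap, Finset.prod_image]
  intro k _ l _ h
  exact (Finset.mem_filter.1 hf).2 u h

theorem card_simpleMaps :
    ((simpleMaps Δ n).card : ℝ) = (Δ.factorial : ℝ) ^ n * (regularBipartite Δ n).card := by
  have h1 := sum_simpleMaps (Δ := Δ) (n := n) fun _ => 1
  have h2 := sum_regularBipartite (Δ := Δ) (n := n) fun _ => 1
  simp only [Finset.sum_const, nsmul_eq_mul, mul_one] at h1 h2
  rw [h1, h2]

end Graphs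

end HypergraphColouring

namespace HypergraphColouring

/-! ### Two-sided bounds on the first moment -/

section FirstMoment

variable {Δ n q : ℕ} {B : Matrix (Fin (q + 1)) (Fin (q + 1)) ℝ}

theorem mem_assignments {a : Fin (q + 1) → ℕ} {σ : Fin n → Fin (q + 1)} :
    σ ∈ assignments n a ↔ σ ∈ functionsWithCounts (Fin n) a := by
  simp only [assignments, functionsWithCounts, Finset.mem_filter, Finset.mem_univ, true_and]

theorem assignments_eq (a : Fin (q + 1) → ℕ) :
    assignments n a = functionsWithCounts (Fin n) a :=
  Finset.ext fun _ => mem_assignments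

theorem card_assignments {a : Fin (q + 1) → ℕ} (ha : ∑ i, a i = n) :
    ((assignments n a).card : ℝ) = (n.factorial : ℝ) / ∏ i, ((a i).factorial : ℝ) := by
  have h := card_functionsWithCounts (E := Fin n) (m := a) (by simpa using ha)
  have hpos : (0 : ℝ) < ∏ i, ((a i).factorial : ℝ) :=
    Finset.prod_pos fun i _ => by exact_mod_cast Nat.factorial_pos _
  rw [eq_div_iff hpos.ne', assignments_eq, h, Fintype.card_fin]

theorem fst_mem_balanced : (Prod.fst : Fin n × Fin Δ → Fin n) ∈ balanced Δ n := by
  refine mem_functionsWithCounts.2 fun v => ?_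
  have : (Finset.univ.filter fun e : Fin n × Fin Δ => e.1 = v)
      = {v} ×ˢ (Finset.univ : Finset (Fin Δ)) := by
    ext e
    simp [Prod.ext_iff, eq_comm]
  rw [this, Finset.card_product]
  simp

theorem card_balanced :
    ((balanced Δ n).card : ℝ) * (Δ.factorial : ℝ) ^ n = (n * Δ).factorial := by
  have h := card_functionsWithCounts (E := Fin n × Fin Δ) (m := fun _ : Fin n => Δ) (by simp)
  simpa [balanced] using h

/-- A permutation of the half-edges yields both a balanced map and a rearrangement of the right
half-edge colouring. Summing over all permutations in these two ways gives the identity. -/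
theorem sum_balanced_mapWeight {b : Fin (q + 1) → ℕ} (σ : Fin n → Fin (q + 1))
    {τ : Fin n → Fin (q + 1)} (hτ : τ ∈ assignments n b) :
    (∑ f ∈ balanced Δ n, mapWeight B σ τ f) * (n * Δ).factorial =
      (balanced Δ n).card * ((∏ j, ((Δ * b j).factorial : ℝ)) *
        pairSum B (fun j => Δ * b j) fun e : Fin n × Fin Δ => σ e.1) := by
  have h1 := sum_perm_comp (fst_mem_balanced (n := n) (Δ := Δ)) (mapWeight B σ τ)
  have h2 := sum_perm_comp (halfEdge_counts (Δ := Δ) (mem_assignments.1 hτ)) fun c => ∏ e, B (σ e.1) (c e)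
  have h3 : ∑ π : Equiv.Perm (Fin n × Fin Δ), mapWeight B σ τ (Prod.fst ∘ π)
      = ∑ π : Equiv.Perm (Fin n × Fin Δ),
        ∏ e, B (σ e.1) (((fun e : Fin n × Fin Δ => τ e.1) ∘ π) e) := rfl
  rw [h3, h2] at h1
  simp only [Finset.prod_const, Finset.card_univ, Fintype.card_fin] at h1
  have h4 : pairSum B (fun j => Δ * b j) (fun e : Fin n × Fin Δ => σ e.1)
      = ∑ c ∈ functionsWithCounts (Fin n × Fin Δ) fun j => Δ * b j, ∏ e, B (σ e.1) (c e) := rfl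
  rw [← card_balanced, h4, h1, balanced]
  ring

theorem mapWeight_nonneg (hB : ∀ i j, 0 ≤ B i j) (σ τ : Fin n → Fin (q + 1))
    (f : Fin n × Fin Δ → Fin n) : 0 ≤ mapWeight B σ τ f :=
  Finset.prod_nonneg fun _ _ => hB _ _

/-- The case of a single colour and constant weight in `sum_balanced_le`. -/
theorem card_balanced_le (hn : Δ ≤ n) :
    ((balanced Δ n).card : ℝ) ≤ simplicityFactor Δ n * (simpleMaps Δ n).card := by
  have h := sum_balanced_le (Δ := Δ) (n := n) (κ := Unit) (σ := fun _ => ()) (a := fun _ => n)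
    (mem_functionsWithCounts.2 fun j => by simp) (fun _ => hn) (w := fun _ => 1)
    (fun _ => zero_le_one) (fun _ _ _ => rfl)
  simpa using h

theorem card_simpleMaps_pos (hn : Δ ≤ n) : (0 : ℝ) < (simpleMaps Δ n).card := by
  have h1 := card_balanced_le hn
  have h2 : (0 : ℝ) < (balanced Δ n).card := by
    exact_mod_cast Finset.card_pos.2 ⟨_, fst_mem_balanced⟩
  by_contra h
  have h3 : ((simpleMaps Δ n).card : ℝ) = 0 := le_antisymm (not_lt.1 h) (Nat.cast_nonneg _)
  rw [h3, mul_zero] at h1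
  linarith

theorem firstMoment_eq (a b : Fin (q + 1) → ℕ) :
    firstMoment B Δ n a b = ∑ σ ∈ assignments n a, ∑ τ ∈ assignments n b,
      (∑ f ∈ simpleMaps Δ n, mapWeight B σ τ f) / (simpleMaps Δ n).card := by
  have hF : (Δ.factorial : ℝ) ^ n ≠ 0 := by
    have : (0 : ℝ) < Δ.factorial := by exact_mod_cast Nat.factorial_pos _
    positivity
  unfold firstMoment partitionFunction
  rw [Finset.sum_comm, Finset.sum_div]
  refine Finset.sum_congr rfl fun σ _ => ?_
  rw [Finset.sum_comm, Finset.sum_div]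
  refine Finset.sum_congr rfl fun τ _ => ?_
  rw [sum_mapWeight, card_simpleMaps, mul_div_mul_left _ _ hF]

/-- The expected weight of one colouring in the configuration model. -/
noncomputable def configWeight (B : Matrix (Fin (q + 1)) (Fin (q + 1)) ℝ) (Δ n : ℕ)
    (b : Fin (q + 1) → ℕ) (σ : Fin n → Fin (q + 1)) : ℝ :=
  (∏ j, ((Δ * b j).factorial : ℝ)) *
    pairSum B (fun j => Δ * b j) (fun e : Fin n × Fin Δ => σ e.1) / (n * Δ).factorial

theorem configWeight_eq (b : Fin (q + 1) → ℕ) (σ : Fin n → Fin (q + 1)) :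
    configWeight B Δ n b σ = (∏ j, ((Δ * b j).factorial : ℝ)) / (n * Δ).factorial *
      pairSum B (fun j => Δ * b j) (fun e : Fin n × Fin Δ => σ e.1) :=
  mul_div_right_comm _ _ _

theorem sum_balanced_eq_configWeight {b : Fin (q + 1) → ℕ} (σ : Fin n → Fin (q + 1))
    {τ : Fin n → Fin (q + 1)} (hτ : τ ∈ assignments n b) :
    ∑ f ∈ balanced Δ n, mapWeight B σ τ f = (balanced Δ n).card * configWeight B Δ n b σ := by
  have hF : ((n * Δ).factorial : ℝ) ≠ 0 := by exact_mod_cast (Nat.factorial_pos _).ne'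
  rw [configWeight, ← mul_div_assoc, eq_div_iff hF, sum_balanced_mapWeight σ hτ]

theorem configWeight_nonneg (hB : ∀ i j, 0 ≤ B i j) (b : Fin (q + 1) → ℕ)
    (σ : Fin n → Fin (q + 1)) : 0 ≤ configWeight B Δ n b σ :=
  div_nonneg (mul_nonneg (Finset.prod_nonneg fun _ _ => Nat.cast_nonneg _) (pairSum_nonneg hB _ _))
    (Nat.cast_nonneg _)

/-- Multiple edges are simply admitted in the numerator; only the normalising count costs the
factor. -/
theorem average_mapWeight_le (hB : ∀ i j, 0 ≤ B i j) (hn : Δ ≤ n) {b : Fin (q + 1) → ℕ}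
    (σ : Fin n → Fin (q + 1)) {τ : Fin n → Fin (q + 1)} (hτ : τ ∈ assignments n b) :
    (∑ f ∈ simpleMaps Δ n, mapWeight B σ τ f) / (simpleMaps Δ n).card
      ≤ simplicityFactor Δ n * configWeight B Δ n b σ := by
  rw [div_le_iff₀ (card_simpleMaps_pos hn)]
  calc ∑ f ∈ simpleMaps Δ n, mapWeight B σ τ f ≤ ∑ f ∈ balanced Δ n, mapWeight B σ τ f :=
        Finset.sum_le_sum_of_subset_of_nonneg (Finset.filter_subset _ _)
          fun f _ _ => mapWeight_nonneg hB σ τ f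
    _ = (balanced Δ n).card * configWeight B Δ n b σ := sum_balanced_eq_configWeight σ hτ
    _ ≤ (simplicityFactor Δ n * (simpleMaps Δ n).card) * configWeight B Δ n b σ :=
        mul_le_mul_of_nonneg_right (card_balanced_le hn) (configWeight_nonneg hB b σ)
    _ = _ := by ring

/-- Here the normalising count is the trivial side, and colour-preserving rearrangements control the
numerator. They need at least Δ vertices in each left colour class. -/
theorem le_average_mapWeight (hB : ∀ i j, 0 ≤ B i j) (hn : Δ ≤ n) {a b : Fin (q + 1) → ℕ}
    (ha : ∀ i, Δ ≤ a i) {σ τ : Fin n → Fin (q + 1)} (hσ : σ ∈ assignments n a)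
    (hτ : τ ∈ assignments n b) :
    configWeight B Δ n b σ ≤ (∏ i, (simplicityFactor Δ (a i) : ℝ)) *
      ((∑ f ∈ simpleMaps Δ n, mapWeight B σ τ f) / (simpleMaps Δ n).card) := by
  have hpos := card_simpleMaps_pos hn
  rw [← mul_div_assoc, le_div_iff₀ hpos]
  have hcard : ((simpleMaps Δ n).card : ℝ) ≤ (balanced Δ n).card := by
    exact_mod_cast Finset.card_le_card (Finset.filter_subset _ _)
  calc configWeight B Δ n b σ * (simpleMaps Δ n).card
      ≤ configWeight B Δ n b σ * (balanced Δ n).card :=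
        mul_le_mul_of_nonneg_left hcard (configWeight_nonneg hB b σ)
    _ = ∑ f ∈ balanced Δ n, mapWeight B σ τ f := by
        rw [sum_balanced_eq_configWeight σ hτ, mul_comm]
    _ ≤ _ := sum_balanced_le (mem_assignments.1 hσ) ha (mapWeight_nonneg hB σ τ) fun h hh f => by
        unfold mapWeight
        refine Fintype.prod_equiv h _ _ fun e => ?_
        rw [hh e]
        rfl

theorem firstMoment_le (hB : ∀ i j, 0 ≤ B i j) (hn : Δ ≤ n) {a b : Fin (q + 1) → ℕ}
    (ha : ∑ i, a i = n) (hb : ∑ i, b i = n) {z : Fin (q + 1) → ℝ} (hz : ∀ j, 0 < z j) :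
    firstMoment B Δ n a b ≤ simplicityFactor Δ n
      * ((n.factorial : ℝ) / ∏ i, ((a i).factorial : ℝ))
      * ((n.factorial : ℝ) / ∏ j, ((b j).factorial : ℝ))
      * ((∏ j, ((Δ * b j).factorial : ℝ)) / (n * Δ).factorial)
      * ((∏ i, (∑ j, B i j * z j) ^ (Δ * a i)) / ∏ j, z j ^ (Δ * b j)) := by
  have hzp : 0 < ∏ j, z j ^ (Δ * b j) := Finset.prod_pos fun j _ => pow_pos (hz j) _
  have hconf : ∀ σ ∈ assignments n a, configWeight B Δ n b σ
      ≤ ((∏ j, ((Δ * b j).factorial : ℝ)) / (n * Δ).factorial)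
      * ((∏ i, (∑ j, B i j * z j) ^ (Δ * a i)) / ∏ j, z j ^ (Δ * b j)) := fun σ hσ => by
    rw [configWeight_eq]
    refine mul_le_mul_of_nonneg_left ?_ (div_nonneg (Finset.prod_nonneg fun _ _ => Nat.cast_nonneg _)
      (Nat.cast_nonneg _))
    rw [le_div_iff₀ hzp]
    exact pairSum_le hB (halfEdge_counts (mem_assignments.1 hσ)) hz
  rw [firstMoment_eq, ← card_assignments ha, ← card_assignments hb]
  calc _ ≤ ∑ σ ∈ assignments n a, ∑ τ ∈ assignments n b, simplicityFactor Δ n *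
        (((∏ j, ((Δ * b j).factorial : ℝ)) / (n * Δ).factorial)
      * ((∏ i, (∑ j, B i j * z j) ^ (Δ * a i)) / ∏ j, z j ^ (Δ * b j))) :=
        Finset.sum_le_sum fun σ hσ => Finset.sum_le_sum fun τ hτ =>
          (average_mapWeight_le hB hn σ hτ).trans
            (mul_le_mul_of_nonneg_left (hconf σ hσ) (Nat.cast_nonneg _))
    _ = _ := by
        rw [Finset.sum_const, Finset.sum_const, nsmul_eq_mul, nsmul_eq_mul]
        ring

theorem le_firstMoment (hB : ∀ i j, 0 ≤ B i j) (hn : Δ ≤ n) {a b : Fin (q + 1) → ℕ}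
    (haΔ : ∀ i, Δ ≤ a i) (ha : ∑ i, a i = n) (hb : ∑ i, b i = n)
    {N : Fin (q + 1) × Fin (q + 1) → ℕ} (hrow : ∀ i, ∑ j, N (i, j) = Δ * a i)
    (hcol : ∀ j, ∑ i, N (i, j) = Δ * b j) :
    ((n.factorial : ℝ) / ∏ i, ((a i).factorial : ℝ))
      * ((n.factorial : ℝ) / ∏ j, ((b j).factorial : ℝ))
      * ((∏ j, ((Δ * b j).factorial : ℝ)) / (n * Δ).factorial)
      * ((∏ i, ((Δ * a i).factorial : ℝ)) * (∏ x, B x.1 x.2 ^ N x) / ∏ x, ((N x).factorial : ℝ))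
      ≤ (∏ i, (simplicityFactor Δ (a i) : ℝ)) * firstMoment B Δ n a b := by
  have hNp : 0 < ∏ x, ((N x).factorial : ℝ) :=
    Finset.prod_pos fun i _ => by exact_mod_cast Nat.factorial_pos _
  have hconf : ∀ σ ∈ assignments n a, ((∏ j, ((Δ * b j).factorial : ℝ)) / (n * Δ).factorial)
      * ((∏ i, ((Δ * a i).factorial : ℝ)) * (∏ x, B x.1 x.2 ^ N x) / ∏ x, ((N x).factorial : ℝ))
      ≤ configWeight B Δ n b σ := fun σ hσ => by
    rw [configWeight_eq]
    refine mul_le_mul_of_nonneg_left ?_ (div_nonneg (Finset.prod_nonneg fun _ _ => Nat.cast_nonneg _)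
      (Nat.cast_nonneg _))
    rw [div_le_iff₀ hNp]
    exact le_pairSum hB (halfEdge_counts (mem_assignments.1 hσ)) hrow hcol
  rw [firstMoment_eq, ← card_assignments ha, ← card_assignments hb, Finset.mul_sum]
  calc _ = ∑ σ ∈ assignments n a, ∑ τ ∈ assignments n b,
        ((∏ j, ((Δ * b j).factorial : ℝ)) / (n * Δ).factorial)
      * ((∏ i, ((Δ * a i).factorial : ℝ)) * (∏ x, B x.1 x.2 ^ N x)
        / ∏ x, ((N x).factorial : ℝ)) := by
        rw [Finset.sum_const, Finset.sum_const, nsmul_eq_mul, nsmul_eq_mul]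
        ring
    _ ≤ _ := Finset.sum_le_sum fun σ hσ => by
        rw [Finset.mul_sum]
        exact Finset.sum_le_sum fun τ hτ =>
          (hconf σ hσ).trans (le_average_mapWeight hB hn haΔ hσ hτ)

end FirstMoment

end HypergraphColouring

namespace HypergraphColouring

/-! ### Exponential growth rates -/

section Stirling

theorem log_factorial_lower (m : ℕ) : (m : ℝ) * Real.log m - m ≤ Real.log m.factorial := by
  rcases Nat.eq_zero_or_pos m with rfl | hm
  · simp
  · have h := Stirling.le_log_factorial_stirling hm.ne'
    have h1 : 0 ≤ Real.log m := Real.log_natCast_nonneg m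
    have h2 : 0 ≤ Real.log (2 * Real.pi) := Real.log_nonneg (by linarith [Real.pi_gt_three])
    linarith

theorem log_factorial_upper (m : ℕ) :
    Real.log m.factorial ≤ (m : ℝ) * Real.log m - m + 1 + Real.log m := by
  rcases Nat.eq_zero_or_pos m with rfl | hm
  · simp
  · obtain ⟨k, rfl⟩ := Nat.exists_eq_succ_of_ne_zero hm.ne'
    -- The Stirling sequence decreases from its first term e/√2, hence m! ≤ e √m (m/e)^m.
    have h := Stirling.stirlingSeq'_antitone (Nat.zero_le k)
    simp only [Function.comp, Nat.succ_eq_add_one, zero_add] at h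
    rw [Stirling.stirlingSeq_one] at h
    have hm0 : (0 : ℝ) < ((k + 1 : ℕ) : ℝ) := by positivity
    have hlog := Real.log_le_log (by
      unfold Stirling.stirlingSeq
      positivity) h
    rw [Stirling.log_stirlingSeq_formula, Real.log_div (Real.exp_pos 1).ne' (by positivity),
      Real.log_exp, Real.log_sqrt (by norm_num), Real.log_div hm0.ne' (Real.exp_pos 1).ne',
      Real.log_exp, Real.log_mul (by norm_num) hm0.ne'] at hlog
    have h1 : 0 ≤ Real.log ((k + 1 : ℕ) : ℝ) := Real.log_natCast_nonneg _
    simp only [Nat.succ_eq_add_one]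
    linarith

variable {X : Type*} {l : Filter X} {n : X → ℕ}

theorem tendsto_log_div (hn : Tendsto n l atTop) :
    Tendsto (fun x => Real.log (n x) / (n x : ℝ)) l (𝓝 0) :=
  (Real.isLittleO_log_id_atTop.tendsto_div_nhds_zero.comp
    (tendsto_natCast_atTop_atTop.comp hn))

theorem tendsto_inv_natCast (hn : Tendsto n l atTop) :
    Tendsto (fun x => 1 / (n x : ℝ)) l (𝓝 0) := by
  have := tendsto_inv_atTop_zero.comp ((tendsto_natCast_atTop_atTop (R := ℝ)).comp hn)
  simpa [Function.comp_def] using this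

/-- The subtracted term is the divergent part. It is linear in `m` and therefore cancels in
multinomial coefficients. The case c = 0 is included, with 0 log 0 = 0. -/
theorem tendsto_log_factorial (hn : Tendsto n l atTop) {m : X → ℕ} {c : ℝ}
    (hm : Tendsto (fun x => (m x : ℝ) / n x) l (𝓝 c)) :
    Tendsto (fun x => 1 / (n x : ℝ) * Real.log (m x).factorial
      - (m x : ℝ) / n x * (Real.log (n x) - 1)) l (𝓝 (c * Real.log c)) := by
  have hlow : Tendsto (fun x => (m x : ℝ) / n x * Real.log ((m x : ℝ) / n x)) l
      (𝓝 (c * Real.log c)) := (Real.continuous_mul_log.tendsto c).comp hm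
  have hup : Tendsto (fun x => (m x : ℝ) / n x * Real.log ((m x : ℝ) / n x)
      + (1 / (n x : ℝ) + (Real.log (n x) / n x + (m x : ℝ) / n x * (1 / (n x : ℝ))))) l
      (𝓝 (c * Real.log c + (0 + (0 + c * 0)))) :=
    hlow.add ((tendsto_inv_natCast hn).add ((tendsto_log_div hn).add
      (hm.mul (tendsto_inv_natCast hn))))
  simp only [mul_zero, add_zero] at hup
  have hid : ∀ x, 0 < n x → 1 / (n x : ℝ) * ((m x : ℝ) * Real.log (m x) - m x)
      - (m x : ℝ) / n x * (Real.log (n x) - 1) = (m x : ℝ) / n x * Real.log ((m x : ℝ) / n x) := by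
    intro x hx
    have hx' : (0 : ℝ) < n x := by exact_mod_cast hx
    rcases Nat.eq_zero_or_pos (m x) with h0 | h0
    · simp [h0]
    · have h0' : (0 : ℝ) < m x := by exact_mod_cast h0
      rw [Real.log_div h0'.ne' hx'.ne']
      field_simp
      ring
  refine tendsto_of_tendsto_of_tendsto_of_le_of_le' hlow hup ?_ ?_
  · filter_upwards [hn.eventually_gt_atTop 0] with x hx
    rw [← hid x hx]
    have := log_factorial_lower (m x)
    gcongr
  · filter_upwards [hn.eventually_gt_atTop 0] with x hx
    have hx' : (0 : ℝ) < n x := by exact_mod_cast hx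
    have hlogm : Real.log (m x) ≤ Real.log (n x) + (m x : ℝ) / n x := by
      rcases Nat.eq_zero_or_pos (m x) with h0 | h0
      · simpa [h0] using Real.log_natCast_nonneg (n x)
      · have h0' : (0 : ℝ) < m x := by exact_mod_cast h0
        have h1 := Real.log_le_sub_one_of_pos (div_pos h0' hx')
        rw [Real.log_div h0'.ne' hx'.ne'] at h1
        linarith
    rw [← hid x hx]
    have h2 := log_factorial_upper (m x)
    have h3 : 1 / (n x : ℝ) * Real.log (m x).factorial ≤ 1 / (n x : ℝ) *
        ((m x : ℝ) * Real.log (m x) - m x + 1 + (Real.log (n x) + (m x : ℝ) / n x)) := by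
      gcongr
      linarith
    calc _ ≤ 1 / (n x : ℝ) *
        ((m x : ℝ) * Real.log (m x) - m x + 1 + (Real.log (n x) + (m x : ℝ) / n x))
        - (m x : ℝ) / n x * (Real.log (n x) - 1) := by gcongr
      _ = _ := by ring

/-- The exponential growth rate of multinomial coefficients. -/
theorem tendsto_log_multinomial (hn : Tendsto n l atTop) {ι : Type*} [Fintype ι] {M : X → ℕ}
    {m : X → ι → ℕ} {C : ℝ} {c : ι → ℝ} (hM : Tendsto (fun x => (M x : ℝ) / n x) l (𝓝 C))
    (hm : ∀ i, Tendsto (fun x => (m x i : ℝ) / n x) l (𝓝 (c i)))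
    (hsum : ∀ᶠ x in l, ∑ i, m x i = M x) :
    Tendsto (fun x => 1 / (n x : ℝ) *
      Real.log ((M x).factorial / ∏ i, ((m x i).factorial : ℝ))) l
      (𝓝 (C * Real.log C - ∑ i, c i * Real.log (c i))) := by
  have h := (tendsto_log_factorial hn hM).sub
    (tendsto_finsetSum Finset.univ fun i _ => tendsto_log_factorial hn (hm i))
  refine h.congr' ?_
  filter_upwards [hsum] with x hx
  have hf : ∀ k : ℕ, (k.factorial : ℝ) ≠ 0 := fun k => by exact_mod_cast (Nat.factorial_pos k).ne'
  rw [Real.log_div (hf _) (Finset.prod_ne_zero_iff.2 fun i _ => hf _),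
    Real.log_prod fun i _ => hf _, Finset.sum_sub_distrib, ← Finset.sum_mul, ← Finset.sum_div,
    ← Nat.cast_sum, hx, ← Finset.mul_sum]
  ring

/-- The condition concerns the powers, not `y`, so that a zero entry of B is allowed when its count
is 0. -/
theorem tendsto_log_prod_pow {ι : Type*} [Fintype ι] {m : X → ι → ℕ} {c : ι → ℝ}
    (hm : ∀ i, Tendsto (fun x => (m x i : ℝ) / n x) l (𝓝 (c i))) {y : ι → ℝ}
    (hy : ∀ᶠ x in l, ∀ i, y i ^ m x i ≠ 0) :
    Tendsto (fun x => 1 / (n x : ℝ) * Real.log (∏ i, y i ^ m x i)) l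
      (𝓝 (∑ i, c i * Real.log (y i))) := by
  have h := tendsto_finsetSum Finset.univ fun i _ => (hm i).mul_const (Real.log (y i))
  refine h.congr' ?_
  filter_upwards [hy] with x hx
  rw [Real.log_prod fun i _ => hx i, Finset.mul_sum]
  refine Finset.sum_congr rfl fun i _ => ?_
  rw [Real.log_pow]
  ring

theorem tendsto_log_simplicityFactor (hn : Tendsto n l atTop) (Δ : ℕ) {m : X → ℕ}
    (hm : ∀ᶠ x in l, m x ≤ n x) (hΔ : ∀ᶠ x in l, Δ ≤ m x) :
    Tendsto (fun x => 1 / (n x : ℝ) * Real.log (simplicityFactor Δ (m x))) l (𝓝 0) := by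
  have hup : Tendsto (fun x => 1 / (n x : ℝ) * Real.log (Δ * Δ).factorial
      + ((Δ - 1 : ℕ) * Δ : ℕ) * (Real.log (n x) / n x)) l (𝓝 0) := by
    have := ((tendsto_inv_natCast hn).mul_const (Real.log (Δ * Δ).factorial)).add
      ((tendsto_log_div hn).const_mul (((Δ - 1 : ℕ) * Δ : ℕ) : ℝ))
    simpa using this
  refine tendsto_of_tendsto_of_tendsto_of_le_of_le' tendsto_const_nhds hup ?_ ?_
  · filter_upwards with x
    exact mul_nonneg (by positivity) (Real.log_natCast_nonneg _)
  · filter_upwards [hm, hΔ, hn.eventually_gt_atTop 0] with x hx hxΔ hx0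
    have hn0 : (0 : ℝ) < n x := by exact_mod_cast hx0
    have hf : (0 : ℝ) < (Δ * Δ).factorial := by exact_mod_cast Nat.factorial_pos _
    have hpos : 0 < simplicityFactor Δ (m x) :=
      Nat.mul_pos (Nat.factorial_pos _) (pow_pos (Nat.descFactorial_pos.2 (by omega)) _)
    have h1 : simplicityFactor Δ (m x) ≤ (Δ * Δ).factorial * n x ^ ((Δ - 1) * Δ) := by
      rw [simplicityFactor, pow_mul]
      gcongr
      exact (Nat.descFactorial_le_pow _ _).trans (Nat.pow_le_pow_left hx _)
    have h2 : Real.log (simplicityFactor Δ (m x)) ≤ Real.log (Δ * Δ).factorial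
        + ((Δ - 1 : ℕ) * Δ : ℕ) * Real.log (n x) := by
      rw [← Real.log_pow, ← Real.log_mul hf.ne' (by positivity)]
      refine Real.log_le_log (by exact_mod_cast hpos) ?_
      exact_mod_cast h1
    calc _ ≤ 1 / (n x : ℝ) * (Real.log (Δ * Δ).factorial
        + ((Δ - 1 : ℕ) * Δ : ℕ) * Real.log (n x)) := by gcongr
      _ = _ := by ring

end Stirling

end HypergraphColouring

namespace HypergraphColouring

/-! ### Integer edge counts with prescribed margins -/

section JointCounts

variable {X : Type*} {l : Filter X} {n : X → ℕ}

theorem eventually_le_of_tendsto_div (hn : Tendsto n l atTop) {u v : X → ℕ} {U V : ℝ} (hVU : V < U)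
    (hu : Tendsto (fun x => (u x : ℝ) / n x) l (𝓝 U))
    (hv : Tendsto (fun x => (v x : ℝ) / n x) l (𝓝 V)) : ∀ᶠ x in l, v x ≤ u x := by
  filter_upwards [hv.eventually_lt hu hVU, hn.eventually_gt_atTop 0] with x hx hx0
  have hx0' : (0 : ℝ) < n x := by exact_mod_cast hx0
  exact_mod_cast ((div_lt_div_iff_of_pos_right hx0').1 hx).le

theorem tendsto_natSub_div (hn : Tendsto n l atTop) {u v : X → ℕ} {U V : ℝ} (hVU : V < U)
    (hu : Tendsto (fun x => (u x : ℝ) / n x) l (𝓝 U))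
    (hv : Tendsto (fun x => (v x : ℝ) / n x) l (𝓝 V)) :
    Tendsto (fun x => ((u x - v x : ℕ) : ℝ) / n x) l (𝓝 (U - V)) := by
  refine (hu.sub hv).congr' ?_
  filter_upwards [eventually_le_of_tendsto_div hn hVU hu hv] with x hx
  rw [Nat.cast_sub hx, sub_div]

theorem tendsto_natSum_div {ι : Type*} [Fintype ι] {u : X → ι → ℕ} {U : ι → ℝ}
    (hu : ∀ i, Tendsto (fun x => (u x i : ℝ) / n x) l (𝓝 (U i))) :
    Tendsto (fun x => ((∑ i, u x i : ℕ) : ℝ) / n x) l (𝓝 (∑ i, U i)) := by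
  refine (tendsto_finsetSum Finset.univ fun i _ => hu i).congr fun x => ?_
  rw [Nat.cast_sum, Finset.sum_div]

theorem tendsto_natMul_div (Δ : ℕ) {u : X → ℕ} {U : ℝ}
    (hu : Tendsto (fun x => (u x : ℝ) / n x) l (𝓝 U)) :
    Tendsto (fun x => ((Δ * u x : ℕ) : ℝ) / n x) l (𝓝 (Δ * U)) := by
  refine (hu.const_mul (Δ : ℝ)).congr fun x => ?_
  push_cast
  ring

/-- Rounding a real matrix to integer matrices with prescribed margins; the error is absorbed in
the first row and column. -/
theorem exists_joint_counts {q : ℕ} (hn : Tendsto n l atTop) {a b : X → Fin (q + 1) → ℕ}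
    {α β : Fin (q + 1) → ℝ} (ha : ∀ i, Tendsto (fun x => (a x i : ℝ) / n x) l (𝓝 (α i)))
    (hb : ∀ i, Tendsto (fun x => (b x i : ℝ) / n x) l (𝓝 (β i)))
    (hsum : ∀ᶠ x in l, ∑ i, a x i = n x ∧ ∑ i, b x i = n x) {Δ : ℕ} (hΔ : 0 < Δ)
    {p : Fin (q + 1) → Fin (q + 1) → ℝ} (hp : ∀ i j, 0 ≤ p i j) (hp0 : ∀ i, 0 < p i 0)
    (hp0' : ∀ j, 0 < p 0 j) (hrow : ∀ i, ∑ j, p i j = α i) (hcol : ∀ j, ∑ i, p i j = β j) :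
    ∃ N : X → Fin (q + 1) × Fin (q + 1) → ℕ,
      (∀ y, Tendsto (fun x => (N x y : ℝ) / n x) l (𝓝 (Δ * p y.1 y.2))) ∧
      (∀ᶠ x in l, (∀ i, ∑ j, N x (i, j) = Δ * a x i) ∧ ∀ j, ∑ i, N x (i, j) = Δ * b x j) ∧
      ∀ x y, p y.1 y.2 = 0 → N x y = 0 := by
  have hΔ' : (0 : ℝ) < Δ := by exact_mod_cast hΔ
  -- Only the block of ordinary colours is rounded, so zeros of `p` stay exactly 0. Positivity of
  -- `p` in row 0 and column 0 keeps the remainders nonnegative eventually.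
  set M : X → Fin q → Fin q → ℕ := fun x i j => ⌊(Δ * p i.succ j.succ) * (n x : ℝ)⌋₊ with hM
  have hMl : ∀ i j, Tendsto (fun x => (M x i j : ℝ) / n x) l (𝓝 (Δ * p i.succ j.succ)) := fun i j =>
    (tendsto_nat_floor_mul_div_atTop (mul_nonneg hΔ'.le (hp _ _))).comp
      (tendsto_natCast_atTop_atTop.comp hn)
  set r : X → Fin q → ℕ := fun x i => Δ * a x i.succ - ∑ j, M x i j with hr
  set c : X → Fin q → ℕ := fun x j => Δ * b x j.succ - ∑ i, M x i j with hc
  have hrl0 : ∀ i : Fin q, ∑ j : Fin q, (Δ : ℝ) * p i.succ j.succ < Δ * α i.succ := fun i => by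
    rw [← hrow, Fin.sum_univ_succ, ← Finset.mul_sum]
    have := hp0 i.succ
    gcongr
    linarith
  have hcl0 : ∀ j : Fin q, ∑ i : Fin q, (Δ : ℝ) * p i.succ j.succ < Δ * β j.succ := fun j => by
    rw [← hcol, Fin.sum_univ_succ, ← Finset.mul_sum]
    have := hp0' j.succ
    gcongr
    linarith
  have hrl : ∀ i, Tendsto (fun x => (r x i : ℝ) / n x) l (𝓝 (Δ * p i.succ 0)) := fun i => by
    have := tendsto_natSub_div hn (hrl0 i) (tendsto_natMul_div Δ (ha i.succ))
      (tendsto_natSum_div fun j => hMl i j)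
    have e : (Δ : ℝ) * α i.succ - ∑ j : Fin q, (Δ : ℝ) * p i.succ j.succ = Δ * p i.succ 0 := by
      rw [← hrow, Fin.sum_univ_succ, ← Finset.mul_sum]; ring
    rwa [e] at this
  have hcl : ∀ j, Tendsto (fun x => (c x j : ℝ) / n x) l (𝓝 (Δ * p 0 j.succ)) := fun j => by
    have := tendsto_natSub_div hn (hcl0 j) (tendsto_natMul_div Δ (hb j.succ))
      (tendsto_natSum_div fun i => hMl i j)
    have e : (Δ : ℝ) * β j.succ - ∑ i : Fin q, (Δ : ℝ) * p i.succ j.succ = Δ * p 0 j.succ := by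
      rw [← hcol, Fin.sum_univ_succ, ← Finset.mul_sum]; ring
    rwa [e] at this
  set z : X → ℕ := fun x => Δ * a x 0 - ∑ j, c x j with hz
  have hzl0 : ∑ j : Fin q, (Δ : ℝ) * p 0 j.succ < Δ * α 0 := by
    rw [← hrow, Fin.sum_univ_succ, ← Finset.mul_sum]
    have := hp0 0
    gcongr
    linarith
  have hzl : Tendsto (fun x => (z x : ℝ) / n x) l (𝓝 (Δ * p 0 0)) := by
    have := tendsto_natSub_div hn hzl0 (tendsto_natMul_div Δ (ha 0)) (tendsto_natSum_div hcl)
    have e : (Δ : ℝ) * α 0 - ∑ j : Fin q, (Δ : ℝ) * p 0 j.succ = Δ * p 0 0 := by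
      rw [← hrow, Fin.sum_univ_succ, ← Finset.mul_sum]; ring
    rwa [e] at this
  refine ⟨fun x y => (Fin.cons (Fin.cons (z x) (c x) : Fin (q + 1) → ℕ)
    (fun i => (Fin.cons (r x i) (M x i) : Fin (q + 1) → ℕ)) : Fin (q + 1) → Fin (q + 1) → ℕ) y.1 y.2,
    ?_, ?_, ?_⟩
  · rintro ⟨i, j⟩
    induction i using Fin.cases with
    | zero =>
      induction j using Fin.cases with
      | zero => simpa using hzl
      | succ j => simpa using hcl j
    | succ i =>
      induction j using Fin.cases with
      | zero => simpa using hrl i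
      | succ j => simpa using hMl i j
  · have er : ∀ᶠ x in l, ∀ i, ∑ j, M x i j ≤ Δ * a x i.succ := eventually_all.2 fun i =>
      eventually_le_of_tendsto_div hn (hrl0 i) (tendsto_natMul_div Δ (ha i.succ))
        (tendsto_natSum_div fun j => hMl i j)
    have ec : ∀ᶠ x in l, ∀ j, ∑ i, M x i j ≤ Δ * b x j.succ := eventually_all.2 fun j =>
      eventually_le_of_tendsto_div hn (hcl0 j) (tendsto_natMul_div Δ (hb j.succ))
        (tendsto_natSum_div fun i => hMl i j)
    have ez := eventually_le_of_tendsto_div hn hzl0 (tendsto_natMul_div Δ (ha 0))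
      (tendsto_natSum_div hcl)
    filter_upwards [er, ec, ez, hsum] with x h1 h2 h3 h4
    have hr' : ∀ i, r x i + ∑ j, M x i j = Δ * a x i.succ := fun i => Nat.sub_add_cancel (h1 i)
    have hc' : ∀ j, c x j + ∑ i, M x i j = Δ * b x j.succ := fun j => Nat.sub_add_cancel (h2 j)
    have hz' : z x + ∑ j, c x j = Δ * a x 0 := Nat.sub_add_cancel h3
    constructor
    · intro i
      induction i using Fin.cases with
      | zero => simpa [Fin.sum_univ_succ] using hz'
      | succ i => simpa [Fin.sum_univ_succ] using hr' i
    · intro j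
      induction j using Fin.cases with
      | zero =>
        simp only [Fin.sum_univ_succ, Fin.cons_zero, Fin.cons_succ]
        -- The sum of column 0 is not imposed; it comes out right because both margins have total Δ
        -- n.
        have s1 : ∑ i, r x i + ∑ i, ∑ j, M x i j = Δ * ∑ i : Fin q, a x i.succ := by
          rw [← Finset.sum_add_distrib, Finset.mul_sum]
          exact Finset.sum_congr rfl fun i _ => hr' i
        have s2 : ∑ j, c x j + ∑ i, ∑ j, M x i j = Δ * ∑ j : Fin q, b x j.succ := by
          rw [Finset.sum_comm, ← Finset.sum_add_distrib, Finset.mul_sum]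
          exact Finset.sum_congr rfl fun j _ => hc' j
        have s3 : Δ * a x 0 + Δ * ∑ i : Fin q, a x i.succ
            = Δ * b x 0 + Δ * ∑ i : Fin q, b x i.succ := by
          rw [← mul_add, ← mul_add, ← Fin.sum_univ_succ, ← Fin.sum_univ_succ, h4.1, h4.2]
        omega
      | succ j => simpa [Fin.sum_univ_succ] using hc' j
  · rintro x ⟨i, j⟩ h0
    induction i using Fin.cases with
    | zero => exact absurd h0 (hp0' j).ne'
    | succ i =>
      induction j using Fin.cases with
      | zero => exact absurd h0 (hp0 _).ne'
      | succ j =>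
        simp only at h0
        simp [hM, h0]

end JointCounts

/-! ### The limit process is nontrivial -/

section PhaseFilter

variable {q : ℕ} {α β : Fin (q + 1) → ℝ}

theorem tendsto_fst_phaseFilter : Tendsto (fun x => x.1) (phaseFilter α β) atTop :=
  tendsto_comap.mono_left (inf_le_left.trans (inf_le_left.trans inf_le_left))

theorem tendsto_left_phaseFilter (i : Fin (q + 1)) :
    Tendsto (fun x => (x.2.1 i : ℝ) / (x.1 : ℝ)) (phaseFilter α β) (𝓝 (α i)) :=
  (tendsto_pi_nhds.1 (tendsto_comap.mono_left
    (inf_le_left.trans (inf_le_left.trans inf_le_right)) :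
      Tendsto (fun (x : ℕ × (Fin (q + 1) → ℕ) × (Fin (q + 1) → ℕ)) i => (x.2.1 i : ℝ) / (x.1 : ℝ))
        (phaseFilter α β) (𝓝 α))) i

theorem tendsto_right_phaseFilter (i : Fin (q + 1)) :
    Tendsto (fun x => (x.2.2 i : ℝ) / (x.1 : ℝ)) (phaseFilter α β) (𝓝 (β i)) :=
  (tendsto_pi_nhds.1 (tendsto_comap.mono_left (inf_le_left.trans inf_le_right) :
      Tendsto (fun (x : ℕ × (Fin (q + 1) → ℕ) × (Fin (q + 1) → ℕ)) i => (x.2.2 i : ℝ) / (x.1 : ℝ))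
        (phaseFilter α β) (𝓝 β))) i

theorem eventually_sum_phaseFilter :
    ∀ᶠ x in phaseFilter α β, ∑ i, x.2.1 i = x.1 ∧ ∑ i, x.2.2 i = x.1 :=
  (inf_le_right : phaseFilter α β ≤ _) (mem_principal_self _)

/-- Ordinary colours are rounded down and colour 0 takes the remainder. -/
theorem exists_counts_tendsto (hα : ∀ i, 0 < α i) (hα1 : ∑ i, α i = 1) :
    ∃ a : ℕ → Fin (q + 1) → ℕ, (∀ i, Tendsto (fun n => (a n i : ℝ) / (n : ℝ)) atTop (𝓝 (α i))) ∧
      ∀ᶠ n in atTop, ∑ i, a n i = n := by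
  set c : ℕ → Fin q → ℕ := fun n i => ⌊α i.succ * (n : ℝ)⌋₊ with hc
  have hcl : ∀ i, Tendsto (fun n => (c n i : ℝ) / (n : ℝ)) atTop (𝓝 (α i.succ)) := fun i =>
    (tendsto_nat_floor_mul_div_atTop (hα _).le).comp tendsto_natCast_atTop_atTop
  have hone : Tendsto (fun n : ℕ => (n : ℝ) / (n : ℝ)) atTop (𝓝 1) := by
    refine tendsto_const_nhds.congr' ?_
    filter_upwards [eventually_gt_atTop 0] with n hn
    rw [div_self (by exact_mod_cast hn.ne')]
  have hlt : ∑ i : Fin q, α i.succ < 1 := by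
    rw [← hα1, Fin.sum_univ_succ]; linarith [hα 0]
  have h0 := tendsto_natSub_div tendsto_id hlt hone (tendsto_natSum_div hcl)
  have hle := eventually_le_of_tendsto_div tendsto_id hlt hone (tendsto_natSum_div hcl)
  refine ⟨fun n => Fin.cons (n - ∑ i, c n i) (c n), fun i => ?_, ?_⟩
  · induction i using Fin.cases with
    | zero =>
      have e : 1 - ∑ i : Fin q, α i.succ = α 0 := by rw [← hα1, Fin.sum_univ_succ]; ring
      rw [e] at h0
      simpa using h0
    | succ i => simpa using hcl i
  · filter_upwards [hle] with n hn
    simp only [Fin.sum_univ_succ, Fin.cons_zero, Fin.cons_succ]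
    exact Nat.sub_add_cancel hn

/-- Along the trivial filter every value would be a limit; this is what lets `limUnder` identify Ψ₁.
-/
theorem phaseFilter_neBot (hα : ∀ i, 0 < α i) (hα1 : ∑ i, α i = 1) (hβ : ∀ i, 0 < β i)
    (hβ1 : ∑ i, β i = 1) : (phaseFilter α β).NeBot := by
  obtain ⟨a, ha, ha'⟩ := exists_counts_tendsto hα hα1
  obtain ⟨b, hb, hb'⟩ := exists_counts_tendsto hβ hβ1
  refine NeBot.mono (map_neBot (f := (atTop : Filter ℕ)) (m := fun n => (n, a n, b n))) ?_
  refine le_inf (le_inf (le_inf ?_ ?_) ?_) ?_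
  · exact map_le_iff_le_comap.1 (by rw [map_map]; exact tendsto_id)
  · exact map_le_iff_le_comap.1 (by rw [map_map]; exact tendsto_pi_nhds.2 ha)
  · exact map_le_iff_le_comap.1 (by rw [map_map]; exact tendsto_pi_nhds.2 hb)
  · rw [le_principal_iff, mem_map]
    filter_upwards [ha', hb'] with n h1 h2
    exact ⟨h1, h2⟩

end PhaseFilter

end HypergraphColouring

namespace HypergraphColouring

/-! ### The limit of the first moment -/

section Limit

variable {q Δ : ℕ} {B : Matrix (Fin (q + 1)) (Fin (q + 1)) ℝ} {α β : Fin (q + 1) → ℝ}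

theorem simplicityFactor_pos {Δ a : ℕ} (h : Δ ≤ a) : 0 < simplicityFactor Δ a :=
  Nat.mul_pos (Nat.factorial_pos _) (pow_pos (Nat.descFactorial_pos.2 (by omega)) _)

/-- The growth rate of the first moment, given matching saddle point and single term bounds. -/
theorem tendsto_logFirstMoment (hB : ∀ i j, 0 ≤ B i j) (hΔ : 0 < Δ) (hα : ∀ i, 0 < α i)
    {z : Fin (q + 1) → ℝ} (hz : ∀ j, 0 < z j)
    (hBz : ∀ i, 0 < ∑ j, B i j * z j) {p : Fin (q + 1) → Fin (q + 1) → ℝ} (hp : ∀ i j, 0 ≤ p i j)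
    (hp0 : ∀ i, 0 < p i 0) (hp0' : ∀ j, 0 < p 0 j) (hpB : ∀ i j, B i j = 0 → p i j = 0)
    (hrow : ∀ i, ∑ j, p i j = α i) (hcol : ∀ j, ∑ i, p i j = β j) {V : ℝ}
    (hup : V = (1 * Real.log 1 - ∑ i, α i * Real.log (α i))
      + (1 * Real.log 1 - ∑ j, β j * Real.log (β j))
      - (Δ * Real.log Δ - ∑ j, Δ * β j * Real.log (Δ * β j))
      + (∑ i, Δ * α i * Real.log (∑ j, B i j * z j) - ∑ j, Δ * β j * Real.log (z j)))
    (hlow : V = (1 * Real.log 1 - ∑ i, α i * Real.log (α i))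
      + (1 * Real.log 1 - ∑ j, β j * Real.log (β j))
      - (Δ * Real.log Δ - ∑ j, Δ * β j * Real.log (Δ * β j))
      - (Δ * Real.log Δ - ∑ i, Δ * α i * Real.log (Δ * α i))
      + (∑ y : Fin (q + 1) × Fin (q + 1), Δ * p y.1 y.2 * Real.log (B y.1 y.2)
        + (Δ * Real.log Δ - ∑ y : Fin (q + 1) × Fin (q + 1),
          Δ * p y.1 y.2 * Real.log (Δ * p y.1 y.2)))) :
    Tendsto (logFirstMoment B Δ) (phaseFilter α β) (𝓝 V) := by
  have hn := tendsto_fst_phaseFilter (α := α) (β := β)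
  have ha := tendsto_left_phaseFilter (α := α) (β := β)
  have hb := tendsto_right_phaseFilter (α := α) (β := β)
  have hs := eventually_sum_phaseFilter (α := α) (β := β)
  have hΔ' : (0 : ℝ) < Δ := by exact_mod_cast hΔ
  have hone : Tendsto (fun x : ℕ × (Fin (q + 1) → ℕ) × (Fin (q + 1) → ℕ) => (x.1 : ℝ) / (x.1 : ℝ))
      (phaseFilter α β) (𝓝 1) := by
    refine tendsto_const_nhds.congr' ?_
    filter_upwards [hn.eventually_gt_atTop 0] with x hx
    rw [div_self (by exact_mod_cast hx.ne')]
  have hnΔ : Tendsto (fun x : ℕ × (Fin (q + 1) → ℕ) × (Fin (q + 1) → ℕ) =>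
      ((x.1 * Δ : ℕ) : ℝ) / (x.1 : ℝ)) (phaseFilter α β) (𝓝 Δ) := by
    have := tendsto_natMul_div Δ hone
    simpa [mul_comm] using this
  have haΔ : ∀ᶠ x in phaseFilter α β, ∀ i, Δ ≤ x.2.1 i := eventually_all.2 fun i => by
    have hzero : Tendsto (fun x : ℕ × (Fin (q + 1) → ℕ) × (Fin (q + 1) → ℕ) => (Δ : ℝ) / (x.1 : ℝ))
        (phaseFilter α β) (𝓝 0) := by
      have := (tendsto_inv_natCast hn).const_mul (Δ : ℝ)
      simpa [div_eq_mul_inv] using this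
    exact eventually_le_of_tendsto_div hn (hα i) (ha i) hzero
  have han : ∀ᶠ x in phaseFilter α β, ∀ i, x.2.1 i ≤ x.1 := by
    filter_upwards [hs] with x hx i
    rw [← hx.1]
    exact Finset.single_le_sum (f := x.2.1) (fun _ _ => Nat.zero_le _) (Finset.mem_univ i)
  have hnle : ∀ᶠ x in phaseFilter α β, Δ ≤ x.1 := by
    filter_upwards [haΔ, han] with x h1 h2
    exact (h1 0).trans (h2 0)
  obtain ⟨N, hN, hNm, hN0⟩ := exists_joint_counts hn ha hb hs hΔ hp hp0 hp0' hrow hcol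
  have hf : ∀ k : ℕ, (0 : ℝ) < k.factorial := fun k => by exact_mod_cast Nat.factorial_pos k
  have hfp : ∀ {ι : Type} [Fintype ι] (m : ι → ℕ), 0 < ∏ i, ((m i).factorial : ℝ) :=
    fun m => Finset.prod_pos fun i _ => hf _
  have tA := tendsto_log_multinomial hn hone ha (hs.mono fun x hx => hx.1)
  have tB := tendsto_log_multinomial hn hone hb (hs.mono fun x hx => hx.2)
  have tΔB := tendsto_log_multinomial hn hnΔ (fun j => tendsto_natMul_div Δ (hb j))
    (hs.mono fun x hx => by rw [← Finset.mul_sum, hx.2, mul_comm])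
  have tΔA := tendsto_log_multinomial hn hnΔ (fun i => tendsto_natMul_div Δ (ha i))
    (hs.mono fun x hx => by rw [← Finset.mul_sum, hx.1, mul_comm])
  have tN := tendsto_log_multinomial hn hnΔ hN (by
    filter_upwards [hNm, hs] with x hx hx'
    rw [Fintype.sum_prod_type, Finset.sum_congr rfl fun i _ => hx.1 i, ← Finset.mul_sum, hx'.1,
      mul_comm])
  have tBz := tendsto_log_prod_pow (fun i => tendsto_natMul_div Δ (ha i))
    (y := fun i => ∑ j, B i j * z j) (Eventually.of_forall fun x i => pow_ne_zero _ (hBz i).ne')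
  have tz := tendsto_log_prod_pow (fun i => tendsto_natMul_div Δ (hb i))
    (y := z) (Eventually.of_forall fun x i => pow_ne_zero _ (hz i).ne')
  have hBN : ∀ x y, B y.1 y.2 ^ N x y ≠ 0 := fun x y => by
    by_cases h0 : B y.1 y.2 = 0
    · rw [hN0 x y (hpB _ _ h0), pow_zero]; exact one_ne_zero
    · exact pow_ne_zero _ h0
  have tBN := tendsto_log_prod_pow hN (y := fun y => B y.1 y.2) (Eventually.of_forall hBN)
  have tF := tendsto_log_simplicityFactor hn Δ (Eventually.of_forall fun x => le_refl x.1) hnle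
  have tFa : Tendsto (fun x : ℕ × (Fin (q + 1) → ℕ) × (Fin (q + 1) → ℕ) =>
      ∑ i, 1 / (x.1 : ℝ) * Real.log (simplicityFactor Δ (x.2.1 i))) (phaseFilter α β) (𝓝 0) := by
    have := tendsto_finsetSum (Finset.univ : Finset (Fin (q + 1))) fun i _ =>
      tendsto_log_simplicityFactor hn Δ (han.mono fun x hx => hx i) (haΔ.mono fun x hx => hx i)
    simpa using this
  -- The limits of the logarithms of the two bounds; by `hup` and `hlow` both equal `V`, the
  -- simplicity factors contributing 0.
  have hupl := (tF.add (((tA.add tB).sub tΔB).add (tBz.sub tz)))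
  have hlowl := ((((tA.add tB).sub tΔB).sub tΔA).add (tBN.add tN)).sub tFa
  rw [zero_add, ← hup] at hupl
  rw [sub_zero, ← hlow] at hlowl
  have hlow_pos : ∀ x, 0 < ((x.1.factorial : ℝ) / ∏ i, ((x.2.1 i).factorial : ℝ))
      * ((x.1.factorial : ℝ) / ∏ j, ((x.2.2 j).factorial : ℝ))
      * ((∏ j, ((Δ * x.2.2 j).factorial : ℝ)) / (x.1 * Δ).factorial)
      * ((∏ i, ((Δ * x.2.1 i).factorial : ℝ)) * (∏ y, B y.1 y.2 ^ N x y)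
        / ∏ y, ((N x y).factorial : ℝ)) := fun x => by
    have hBNp : 0 < ∏ y, B y.1 y.2 ^ N x y := Finset.prod_pos fun y _ =>
      lt_of_le_of_ne (pow_nonneg (hB _ _) _) (hBN x y).symm
    have := hfp x.2.1
    have := hfp x.2.2
    have := hfp fun j => Δ * x.2.2 j
    have := hfp fun j => Δ * x.2.1 j
    have := hfp (N x)
    have := hf x.1
    have := hf (x.1 * Δ)
    positivity
  have hFapos : ∀ x : ℕ × (Fin (q + 1) → ℕ) × (Fin (q + 1) → ℕ), (∀ i, Δ ≤ x.2.1 i) →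
      ∀ i, (0 : ℝ) < simplicityFactor Δ (x.2.1 i) := fun x hx i => by
    exact_mod_cast simplicityFactor_pos (hx i)
  -- The logarithm of the upper bound is informative only once the first moment is known to be
  -- positive, which the lower bound supplies.
  have hfm_pos : ∀ᶠ x in phaseFilter α β, 0 < firstMoment B Δ x.1 x.2.1 x.2.2 := by
    filter_upwards [haΔ, hnle, hs, hNm] with x h1 h2 h3 h4
    have h5 := (hlow_pos x).trans_le (le_firstMoment hB h2 h1 h3.1 h3.2 h4.1 h4.2)
    exact (pos_iff_pos_of_mul_pos h5).1 (Finset.prod_pos fun i _ => hFapos x h1 i)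
  refine tendsto_of_tendsto_of_tendsto_of_le_of_le' hlowl hupl ?_ ?_
  · filter_upwards [haΔ, hnle, hs, hNm, hfm_pos] with x h1 h2 h3 h4 h5
    have hle := Real.log_le_log (hlow_pos x) (le_firstMoment hB h2 h1 h3.1 h3.2 h4.1 h4.2)
    have c1 := hf x.1
    have c2 := hf (x.1 * Δ)
    have d1 := hfp x.2.1
    have d2 := hfp x.2.2
    have d3 := hfp fun j => Δ * x.2.2 j
    have d4 := hfp fun j => Δ * x.2.1 j
    have d5 := hfp (N x)
    have d6 : ∏ y, B y.1 y.2 ^ N x y ≠ 0 := Finset.prod_ne_zero_iff.2 fun y _ => hBN x y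
    rw [Real.log_mul (Finset.prod_ne_zero_iff.2 fun i _ => (hFapos x h1 i).ne') h5.ne',
      Real.log_prod fun i _ => (hFapos x h1 i).ne',
      Real.log_mul (by positivity) (div_ne_zero (mul_ne_zero d4.ne' d6) d5.ne'),
      Real.log_mul (by positivity) (by positivity),
      Real.log_mul (by positivity) (by positivity),
      Real.log_div d3.ne' c2.ne', Real.log_div (mul_ne_zero d4.ne' d6) d5.ne',
      Real.log_mul d4.ne' d6] at hle
    rw [Real.log_div c2.ne' d3.ne', Real.log_div c2.ne' d4.ne', Real.log_div c2.ne' d5.ne',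
      ← Finset.mul_sum, logFirstMoment]
    have hinv : (0 : ℝ) ≤ 1 / x.1 := by positivity
    have := mul_le_mul_of_nonneg_left hle hinv
    linarith
  · filter_upwards [hnle, hs, hfm_pos] with x h2 h3 h5
    have hle := Real.log_le_log h5 (firstMoment_le hB h2 h3.1 h3.2 hz)
    have c1 := hf x.1
    have c2 := hf (x.1 * Δ)
    have d1 := hfp x.2.1
    have d2 := hfp x.2.2
    have d3 := hfp fun j => Δ * x.2.2 j
    have d4 : 0 < ∏ i, (∑ j, B i j * z j) ^ (Δ * x.2.1 i) :=
      Finset.prod_pos fun i _ => pow_pos (hBz i) _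
    have d5 : 0 < ∏ j, z j ^ (Δ * x.2.2 j) := Finset.prod_pos fun i _ => pow_pos (hz i) _
    have d6 : (0 : ℝ) < simplicityFactor Δ x.1 := by exact_mod_cast simplicityFactor_pos h2
    rw [Real.log_mul (by positivity) (by positivity), Real.log_mul (by positivity) (by positivity),
      Real.log_mul (by positivity) (by positivity), Real.log_mul (by positivity) (by positivity),
      Real.log_div d3.ne' c2.ne', Real.log_div d4.ne' d5.ne'] at hle
    rw [Real.log_div c2.ne' d3.ne', logFirstMoment]
    have hinv : (0 : ℝ) ≤ 1 / x.1 := by positivity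
    have := mul_le_mul_of_nonneg_left hle hinv
    linarith

end Limit

end HypergraphColouring

namespace HypergraphColouring

/-! ### The growth rate at a positive fixpoint -/

section Fixpoints

variable {q k d : ℕ} {R C : Fin (q + 1) → ℝ}

theorem interaction_nonneg (hq : 4 ≤ q) (hk : 2 ≤ k) (i j : Fin (q + 1)) :
    0 ≤ interaction q k d i j := by
  have := (tParam_pos (d := d) hq hk).le
  unfold interaction
  split_ifs <;> positivity

theorem interaction_symm (i j : Fin (q + 1)) : interaction q k d i j = interaction q k d j i := by
  unfold interaction
  by_cases hi : i = 0 <;> by_cases hj : j = 0 <;> simp [hi, hj, eq_comm]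

theorem interaction_zero_right_pos (hq : 4 ≤ q) (hk : 2 ≤ k) (i : Fin (q + 1)) :
    0 < interaction q k d i 0 := by
  have := tParam_pos (d := d) hq hk
  unfold interaction
  split_ifs <;> positivity

theorem sum_interaction_pos (hq : 4 ≤ q) (hk : 2 ≤ k) (hC : ∀ i, 0 < C i) (i : Fin (q + 1)) :
    0 < ∑ j, interaction q k d i j * C j :=
  Finset.sum_pos' (fun j _ => mul_nonneg (interaction_nonneg hq hk i j) (hC j).le)
    ⟨0, Finset.mem_univ _, mul_pos (interaction_zero_right_pos hq hk i) (hC 0)⟩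

theorem pairing_pos (hq : 4 ≤ q) (hk : 2 ≤ k) (hR : ∀ i, 0 < R i) (hC : ∀ i, 0 < C i) :
    0 < pairing q k d R C :=
  Finset.sum_pos (fun i _ => mul_pos (hR i) (sum_interaction_pos hq hk hC i)) ⟨0, Finset.mem_univ _⟩

theorem pairing_comm : pairing q k d R C = pairing q k d C R := by
  rw [pairing_eq, pairing_eq, mul_comm]
  simp only [mul_comm]

/-- A message is a power of the incoming field, in the form used for the `p`-norm. -/
theorem exists_root_eq_field (hd : 0 < d) (hq : 4 ≤ q) (hk : 2 ≤ k) (hR : ∀ i, 0 < R i)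
    (hC : ∀ i, 0 < C i)
    (h : ∃ A : ℝ, R 0 = A * (tParam q k d ^ d * totalWeight q k d C ^ d) ∧
      ∀ i : Fin q, R i.succ = A * (totalWeight q k d C - C i.succ) ^ d) :
    ∃ κ : ℝ, 0 < κ ∧ ∀ i, R i ^ ((1 : ℝ) / d) = κ * ∑ j, interaction q k d i j * C j := by
  obtain ⟨A, h0, h1⟩ := h
  have hd' : (0 : ℝ) < d := by exact_mod_cast hd
  have hfield := sum_interaction_pos (d := d) hq hk hC
  have hall : ∀ i, R i = A * (∑ j, interaction q k d i j * C j) ^ d := fun i => by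
    induction i using Fin.cases with
    | zero => rw [sum_interaction_zero, mul_pow, h0]
    | succ i => rw [sum_interaction_succ, h1]
  have hA : 0 < A := by
    have h2 := hR 0
    rw [hall 0] at h2
    exact (pos_iff_pos_of_mul_pos h2).2 (pow_pos (hfield 0) d)
  refine ⟨A ^ ((1 : ℝ) / d), Real.rpow_pos_of_pos hA _, fun i => ?_⟩
  rw [hall i, Real.mul_rpow hA.le (pow_nonneg (hfield i).le d), ← Real.rpow_natCast,
    ← Real.rpow_mul (hfield i).le, mul_one_div_cancel hd'.ne', Real.rpow_one]

theorem sum_phase (hR : ∀ i, 0 < R i) : ∑ i, phase d R i = 1 := by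
  unfold phase
  rw [← Finset.sum_div]
  exact div_self (Finset.sum_pos (fun i _ => Real.rpow_pos_of_pos (hR i) _)
    ⟨0, Finset.mem_univ _⟩).ne'

theorem phase_pos (hR : ∀ i, 0 < R i) (i : Fin (q + 1)) : 0 < phase d R i :=
  div_pos (Real.rpow_pos_of_pos (hR i) _)
    (Finset.sum_pos (fun i _ => Real.rpow_pos_of_pos (hR i) _) ⟨0, Finset.mem_univ _⟩)

/-- The phase of a fixpoint is the margin of the edge distribution `Rᵢ Bᵢⱼ Cⱼ / Rᵀ B C`. -/
theorem phase_eq_margin (hd : 0 < d) (hq : 4 ≤ q) (hk : 2 ≤ k) (hR : ∀ i, 0 < R i)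
    (hC : ∀ i, 0 < C i) {κ : ℝ} (hκ : 0 < κ)
    (h : ∀ i, R i ^ ((1 : ℝ) / d) = κ * ∑ j, interaction q k d i j * C j) :
    ∑ i, R i ^ (((d : ℝ) + 1) / d) = κ * pairing q k d R C ∧
    ∀ i, phase d R i = R i * (∑ j, interaction q k d i j * C j) / pairing q k d R C := by
  have hd' : (0 : ℝ) < d := by exact_mod_cast hd
  have hpow : ∀ i, R i ^ (((d : ℝ) + 1) / d) = κ * (R i * ∑ j, interaction q k d i j * C j) :=
    fun i => by
    have : ((d : ℝ) + 1) / d = 1 + 1 / d := by field_simp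
    rw [this, Real.rpow_add (hR i), Real.rpow_one, h]
    ring
  have hsum : ∑ i, R i ^ (((d : ℝ) + 1) / d) = κ * pairing q k d R C := by
    rw [pairing, Finset.mul_sum]
    exact Finset.sum_congr rfl fun i _ => hpow i
  have hW := pairing_pos (d := d) hq hk hR hC
  refine ⟨hsum, fun i => ?_⟩
  rw [phase, hsum, hpow]
  field_simp

theorem log_phase (hR : ∀ i, 0 < R i) (i : Fin (q + 1)) :
    Real.log (phase d R i) = ((d : ℝ) + 1) / d * Real.log (R i)
      - Real.log (∑ j, R j ^ (((d : ℝ) + 1) / d)) := by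
  rw [phase, Real.log_div (Real.rpow_pos_of_pos (hR i) _).ne', Real.log_rpow (hR i)]
  exact (Finset.sum_pos (fun i _ => Real.rpow_pos_of_pos (hR i) _) ⟨0, Finset.mem_univ _⟩).ne'

theorem sum_phase_log (hR : ∀ i, 0 < R i) :
    ∑ i, phase d R i * Real.log (phase d R i) = ((d : ℝ) + 1) / d * ∑ i, phase d R i * Real.log (R i)
      - Real.log (∑ j, R j ^ (((d : ℝ) + 1) / d)) := by
  simp only [log_phase hR, mul_sub, Finset.sum_sub_distrib, ← Finset.sum_mul, sum_phase hR, one_mul,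
    Finset.mul_sum]
  congr 1
  exact Finset.sum_congr rfl fun i _ => by ring

theorem sum_mul_phase_log (hR : ∀ i, 0 < R i) {D : ℝ} (hD : 0 < D) :
    ∑ i, D * phase d R i * Real.log (D * phase d R i)
      = D * Real.log D + D * ∑ i, phase d R i * Real.log (phase d R i) := by
  have : ∀ i, D * phase d R i * Real.log (D * phase d R i)
      = D * Real.log D * phase d R i + D * (phase d R i * Real.log (phase d R i)) := fun i => by
    rw [Real.log_mul hD.ne' (phase_pos hR i).ne']
    ring
  simp only [this, Finset.sum_add_distrib, ← Finset.mul_sum, sum_phase hR, mul_one]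

/-- The growth rate of the first moment at a positive fixpoint. -/
theorem tendsto_logFirstMoment_fixpoint (hd : 0 < d) (hq : 4 ≤ q) (hk : 2 ≤ k)
    (hfix : IsPosFixpoint q k d R C) :
    Tendsto (logFirstMoment (interaction q k d) (d + 1)) (phaseFilter (phase d R) (phase d C))
      (𝓝 (messageRate q k d R C)) := by
  obtain ⟨hR, hC, hRe, hCe⟩ := isPosFixpoint_iff.1 hfix
  have hd' : (0 : ℝ) < d := by exact_mod_cast hd
  obtain ⟨κ, hκ, hκR⟩ := exists_root_eq_field hd hq hk hR hC hRe
  obtain ⟨κ', hκ', hκC⟩ := exists_root_eq_field hd hq hk hC hR hCe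
  obtain ⟨hSR, hα⟩ := phase_eq_margin hd hq hk hR hC hκ hκR
  obtain ⟨hSC, hβ⟩ := phase_eq_margin hd hq hk hC hR hκ' hκC
  have hW := pairing_pos (d := d) hq hk hR hC
  rw [← pairing_comm] at hSC hβ
  have hfield := sum_interaction_pos (d := d) hq hk hC
  set W := pairing q k d R C with hWdef
  -- The edge distribution at the fixpoint. The two fixpoint equations give it the phases as
  -- margins, which makes it admissible in the lower bound.
  set p : Fin (q + 1) → Fin (q + 1) → ℝ := fun i j => R i * interaction q k d i j * C j / W with hp
  have hrow : ∀ i, ∑ j, p i j = phase d R i := fun i => by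
    rw [hα, hp, ← Finset.sum_div, Finset.mul_sum]
    simp only [mul_assoc]
  have hcol : ∀ j, ∑ i, p i j = phase d C j := fun j => by
    rw [hβ, hp, ← Finset.sum_div, Finset.mul_sum]
    congr 1
    refine Finset.sum_congr rfl fun i _ => ?_
    rw [interaction_symm i j]
    ring
  have hcol_pos := interaction_zero_right_pos (d := d) hq hk
  have hΔ : (0 : ℝ) < ((d + 1 : ℕ) : ℝ) := by positivity
  set a := ∑ i, phase d R i * Real.log (R i) with ha
  set b := ∑ i, phase d C i * Real.log (C i) with hb
  have hlogκ : Real.log κ = Real.log (∑ i, R i ^ (((d : ℝ) + 1) / d)) - Real.log W := by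
    rw [hSR, Real.log_mul hκ.ne' hW.ne']; ring
  have e1 : ∑ i, ((d + 1 : ℕ) : ℝ) * phase d R i * Real.log (∑ j, interaction q k d i j * C j)
      = ((d + 1 : ℕ) : ℝ) * (a / d - Real.log κ) := by
    have : ∀ i, ((d + 1 : ℕ) : ℝ) * phase d R i * Real.log (∑ j, interaction q k d i j * C j)
        = ((d + 1 : ℕ) : ℝ) / d * (phase d R i * Real.log (R i))
          - ((d + 1 : ℕ) : ℝ) * Real.log κ * phase d R i := fun i => by
      have h1 := congrArg Real.log (hκR i)
      rw [Real.log_rpow (hR i), Real.log_mul hκ.ne' (hfield i).ne'] at h1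
      have h2 : Real.log (∑ j, interaction q k d i j * C j)
          = 1 / d * Real.log (R i) - Real.log κ := by linarith
      rw [h2]
      ring
    simp only [this, Finset.sum_sub_distrib, ← Finset.mul_sum, sum_phase hR, ← ha]
    ring
  have e2 : ∑ j, ((d + 1 : ℕ) : ℝ) * phase d C j * Real.log (C j) = ((d + 1 : ℕ) : ℝ) * b := by
    simp only [mul_assoc, ← Finset.mul_sum, ← hb]
  have e3 : ∑ y : Fin (q + 1) × Fin (q + 1), ((d + 1 : ℕ) : ℝ) * p y.1 y.2
        * Real.log (interaction q k d y.1 y.2)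
      - ∑ y : Fin (q + 1) × Fin (q + 1),
        ((d + 1 : ℕ) : ℝ) * p y.1 y.2 * Real.log (((d + 1 : ℕ) : ℝ) * p y.1 y.2)
      = ((d + 1 : ℕ) : ℝ) * (Real.log W - Real.log ((d + 1 : ℕ) : ℝ) - a - b) := by
    have hterm : ∀ i j, ((d + 1 : ℕ) : ℝ) * p i j * Real.log (interaction q k d i j)
        - ((d + 1 : ℕ) : ℝ) * p i j * Real.log (((d + 1 : ℕ) : ℝ) * p i j)
        = ((d + 1 : ℕ) : ℝ) * (Real.log W - Real.log ((d + 1 : ℕ) : ℝ)) * p i j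
          - ((d + 1 : ℕ) : ℝ) * Real.log (R i) * p i j
          - ((d + 1 : ℕ) : ℝ) * Real.log (C j) * p i j := fun i j => by
      -- Where B vanishes so does `p`, and all terms are 0; elsewhere log p splits into
      -- contributions of R, B and C.
      rcases (interaction_nonneg (d := d) hq hk i j).eq_or_lt with h0 | h0
      · simp [hp, ← h0]
      · have h1 := hR i
        have h2 := hC j
        have h3 : Real.log (((d + 1 : ℕ) : ℝ) * p i j) = Real.log ((d + 1 : ℕ) : ℝ)
            + (Real.log (R i) + Real.log (interaction q k d i j) + Real.log (C j) - Real.log W) := by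
          rw [hp, Real.log_mul hΔ.ne' (by positivity), Real.log_div (by positivity) hW.ne',
            Real.log_mul (by positivity) h2.ne', Real.log_mul h1.ne' h0.ne']
        rw [h3]
        ring
    have s0 : ∑ i, ∑ j, p i j = 1 := by simp only [hrow, sum_phase hR]
    have s1 : ∑ i, ∑ j, ((d + 1 : ℕ) : ℝ) * Real.log (R i) * p i j = ((d + 1 : ℕ) : ℝ) * a := by
      simp only [← Finset.mul_sum, hrow, ha]
      rw [Finset.mul_sum]
      exact Finset.sum_congr rfl fun i _ => by ring
    have s2 : ∑ i, ∑ j, ((d + 1 : ℕ) : ℝ) * Real.log (C j) * p i j = ((d + 1 : ℕ) : ℝ) * b := by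
      rw [Finset.sum_comm]
      simp only [← Finset.mul_sum, hcol, hb]
      rw [Finset.mul_sum]
      exact Finset.sum_congr rfl fun i _ => by ring
    rw [← Finset.sum_sub_distrib, Fintype.sum_prod_type]
    simp only [hterm, Finset.sum_sub_distrib]
    rw [s1, s2]
    simp only [← Finset.mul_sum]
    rw [s0]
    ring
  -- The saddle point variables are z = C: the field ∑ Bᵢⱼ Cⱼ is then proportional to Rᵢ^(1/d), and
  -- the upper bound agrees with the lower one.
  refine tendsto_logFirstMoment (Δ := d + 1) (interaction_nonneg hq hk) (by omega) (phase_pos hR) hC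
    hfield (p := p) (fun i j => ?_) (fun i => ?_) (fun j => ?_) (fun i j h0 => ?_) hrow hcol ?_ ?_
  · exact div_nonneg (mul_nonneg (mul_nonneg (hR i).le (interaction_nonneg hq hk i j)) (hC j).le)
      hW.le
  · exact div_pos (mul_pos (mul_pos (hR i) (hcol_pos i)) (hC 0)) hW
  · refine div_pos (mul_pos (mul_pos (hR 0) ?_) (hC j)) hW
    rw [interaction_symm]
    exact hcol_pos j
  · simp [hp, h0]
  · rw [e1, e2, sum_mul_phase_log hC hΔ, sum_phase_log hR, sum_phase_log hC, ← ha, ← hb, hlogκ,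
      messageRate, ← hWdef, Real.log_one]
    push_cast
    field_simp
    ring
  · rw [sum_mul_phase_log hC hΔ, sum_mul_phase_log hR hΔ, sum_phase_log hR, sum_phase_log hC, ← ha,
      ← hb, messageRate, ← hWdef, Real.log_one]
    have e4 := eq_add_of_sub_eq e3
    erw [e4]
    generalize ∑ y : Fin (q + 1) × Fin (q + 1),
        ((d + 1 : ℕ) : ℝ) * p y.1 y.2 * Real.log (((d + 1 : ℕ) : ℝ) * p y.1 y.2) = S
    push_cast
    field_simp
    ring

theorem psi1At_eq (hd : 0 < d) (hq : 4 ≤ q) (hk : 2 ≤ k) (hfix : IsPosFixpoint q k d R C) :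
    psi1At q k d R C = messageRate q k d R C := by
  have : (phaseFilter (phase d R) (phase d C)).NeBot :=
    phaseFilter_neBot (phase_pos hfix.R_pos) (sum_phase hfix.R_pos) (phase_pos hfix.C_pos)
      (sum_phase hfix.C_pos)
  exact (tendsto_logFirstMoment_fixpoint hd hq hk hfix).limUnder_eq

end Fixpoints

end HypergraphColouring

/-- For even `q ≥ 4`, `k ≥ 2` and `d = 5q^k`: the limit defining `Ψ₁` exists at every positive
fixpoint of the tree recursion; the maximum of `Ψ₁` over the positive fixpoints is attained at a
fixpoint of type `(q/2, q/2, 0)`, and only at fixpoints of that type. -/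
theorem mainTheorem3 (q k d : ℕ) (hq : 4 ≤ q) (hq_even : Even q) (hk : 2 ≤ k)
    (hd : d = 5 * q ^ k) :
    (∀ R C : Fin (q + 1) → ℝ, IsPosFixpoint q k d R C →
      Filter.Tendsto (logFirstMoment (interaction q k d) (d + 1))
        (phaseFilter (phase d R) (phase d C)) (nhds (psi1At q k d R C))) ∧
    ∃ R C : Fin (q + 1) → ℝ, IsPosFixpoint q k d R C ∧ HasType R (q / 2) (q / 2) 0 ∧
      ∀ R' C' : Fin (q + 1) → ℝ, IsPosFixpoint q k d R' C' →
        psi1At q k d R' C' ≤ psi1At q k d R C ∧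
        (psi1At q k d R' C' = psi1At q k d R C → HasType R' (q / 2) (q / 2) 0) := by
  have hd0 : 0 < d := by
    rw [hd]
    have : 0 < q ^ k := Nat.pow_pos (by omega)
    omega
  refine ⟨fun R C hfix => ?_, ?_⟩
  · rw [psi1At_eq hd0 hq hk hfix]
    exact tendsto_logFirstMoment_fixpoint hd0 hq hk hfix
  · obtain ⟨R, C, hfix, htype, hmax⟩ := exists_fixpoint_max_messageRate hq hq_even hk hd
    refine ⟨R, C, hfix, htype, fun R' C' hfix' => ?_⟩
    rw [psi1At_eq hd0 hq hk hfix, psi1At_eq hd0 hq hk hfix']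
    exact hmax R' C' hfix'
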